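/- Setting. Let $r_0>0$, $\omega\in\{1,-1\}$, and let $a(s,r)>0$ be smooth on $\mathbb R\times\,]-r_0,r_0[$ with $a(s,0)=1$, $\partial_r a(s,0)=0$ and $a(s+2\pi,r)=a(s,\omega r)$; thus $dr^2+a^2ds^2$ is the metric of a surface in Fermi coordinates along a closed geodesic $\{r=0\}$ of length $2\pi$ (the points $(s+2\pi,r)$ and $(s,\omega r)$ are identified). Let $R(s)$ be the Gauss curvature (which is $-\partial_r^2a/a$) at $r=0$. Assume that the geodesic is stable and non-degenerate: the linearized Poincaré map $(r(0),\rho(0))\mapsto(r(2\pi),\rho(2\pi))$ of the system $\dot r=2\rho$, $\dot\rho=-\frac12R(s)r$ has the eigenvalues $e^{\pm i\lambda}$ with $\lambda\in\mathbb R$, and there are $\tau,\mu>0$ with $$\Big|p-q\frac{\lambda}{\pi}\Big|\ge\frac{\mu}{(|p|+|q|)^{\tau}}\qquad\text{for all }(p,q)\in(\mathbb Z\times\mathbb N)\setminus\{(0,0)\}.$$ Normalization. Call $(\Lambda,a_0,\beta)$ a normalized Floquet triple if $\Lambda\in\mathbb R$, $a_0:\mathbb R\to\mathbb C$ solves $\ddot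 a_0+Ra_0=0$ with $a_0(0)>0$ and $\mathrm{Im}(\overline{a_0(0)}\,\dot a_0(0))=1$ (for instance $a_0(0)=1$, $\dot a_0(0)=i$), $\beta$ is continuous with $\beta(0)=0$ and $a_0=|a_0|e^{i\beta}$, and both $|a_0|$ and $\beta(s)-\frac{\Lambda}{2\pi}s$ are $2\pi$-periodic. For such a triple put $\alpha=\log|a_0|$, and for $k\in\mathbb N$ put $E_0(k)=-\frac{\Lambda}{4\pi}+\frac12k\big(\frac{\omega-1}{2}-\frac{\Lambda}{\pi}\big)$ and $$w_k(s,x)=e^{-isE_0(k)}e^{i\dot\alpha(s)x^2/2}e^{-i(\frac12+k)\beta(s)}e^{-\frac12\alpha(s)}\varphi_k\big(xe^{-\alpha(s)}\big),$$ where $\varphi_k$ is the $k$-th $L^2(\mathbb R)$-normalized Hermite function (eigenfunction of $-\frac12\partial_x^2+\frac12x^2$ with eigenvalue $k+\frac12$). Hierarchy. Let $\varepsilon,\delta\in\mathbb R$. Inserting $u=\delta h^{-1/4}e^{is/h}v(s,r/\sqrt h)$ in $-\Delta u=\Lambda_hu-\varepsilon|u|^2u$ (where $\Lambda_h$ denotes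 the nonlinear eigenvalue), writing $E=\frac{1-h^2\Lambda_h}{2h}$ and $r=\sqrt h\,x$, and multiplying by $h/2$, one gets $$i\partial_sv+\tfrac12\partial_x^2v+i(B-1)\partial_sv+\tfrac h2B\,\partial_s^2v-\tfrac{1}{2h}(B-1)v+\tfrac12C(iv+h\partial_sv)+\tfrac{\sqrt h}{2}D\,\partial_xv=Ev+\tfrac12\varepsilon\delta^2\sqrt h\,|v|^2v,$$ where $B=a^{-2}$, $C=a^{-1}\partial_s(a^{-1})$, $D=a^{-1}\partial_ra$ are taken at $(s,\sqrt h\,x)$ and Taylor expanded in powers of $\sqrt h$. Insert the formal series $v=\sum_jh^{j/2}v_j$, $E=\sum_jh^{j/2}E_j$, with $\delta$ treated as a parameter independent of $h$. The coefficient of $h^{0}$ gives $$\big(i\partial_s+\tfrac12\partial_x^2-\tfrac12R(s)x^2-E_0\big)v_0=0,$$ and for $p\ge1$ the coefficient of $h^{p/2}$ gives $$\big(i\partial_s+\tfrac12\partial_x^2-\tfrac12R(s)x^2-E_0\big)v_p=E_pv_0+Q_p,\qquad(\mathrm{Eq}_p)$$ where $Q_p$ depends only on $s,x$, $(v_j)_{j\le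 p-1}$ and $(E_j)_{j\le p-1}$, and $(\mathrm{Eq}_0)$ denotes the first equation. Statement. There is a normalized Floquet triple with $\Lambda\equiv\lambda$ or $\Lambda\equiv-\lambda$ modulo $2\pi$. For every normalized Floquet triple, every $k_0\in\mathbb N$ and all $\varepsilon,\delta\in\mathbb R$, there exist $E_p\in\mathbb C$ and smooth $v_p:\mathbb R\times\mathbb R\to\mathbb C$ for all $p\ge0$, with $E_0=E_0(k_0)$ and $v_0=w_{k_0}$, such that for every $p\ge0$ $$v_p\in C^\infty([0,2\pi],\mathcal S(\mathbb R)),\qquad v_p(s+2\pi,x)=v_p(s,\omega x)\quad(s,x\in\mathbb R),$$ and $(\mathrm{Eq}_p)$ holds on $\mathbb R\times\mathbb R$. Moreover, for every $p\ge0$, any $(E_j,v_j)_{0\le j<p}$ with these properties, including $E_0=E_0(k_0)$ and $v_0=w_{k_0}$ if $p\ge1$, can be extended by some $(E_p,v_p)$ with these properties; for $p=0$ this is the pair $(E_0(k_0),w_{k_0})$. -/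

import Mathlib

open scoped Nat

namespace WKB

noncomputable section

/-- `a` is the coefficient of a smooth metric `dr² + a(s,r)² ds²` written in Fermi coordinates
`(s, r) ∈ ℝ × ]-r₀, r₀[` along a closed geodesic `r = 0` of length `2π`.  The points `(s + 2π, r)`
and `(s, ω r)` are identified (`ω = 1`: orientable case, `ω = -1`: non-orientable case). -/
structure IsFermiMetric (r₀ ω : ℝ) (a : ℝ → ℝ → ℝ) : Prop where
  width_pos : 0 < r₀
  orientation : ω = 1 ∨ ω = -1
  smooth : ContDiffOn ℝ (⊤ : ℕ∞) (fun z : ℝ × ℝ => a z.1 z.2) (Set.univ ×ˢ Set.Ioo (-r₀) r₀)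
  pos : ∀ s, ∀ r ∈ Set.Ioo (-r₀) r₀, 0 < a s r
  at_zero : ∀ s, a s 0 = 1
  deriv_at_zero : ∀ s, deriv (a s) 0 = 0
  twist : ∀ s, ∀ r ∈ Set.Ioo (-r₀) r₀, a (s + 2 * Real.pi) r = a s (ω * r)

/-- The Gauss curvature `-(∂²a/∂r²) / a` at the point of Fermi coordinates `(s, r)`. -/
def gaussCurvature (a : ℝ → ℝ → ℝ) (s r : ℝ) : ℝ := -(iteratedDeriv 2 (a s) r) / a s r

/-- The curvature `R(s)` along the geodesic. -/
def curv (a : ℝ → ℝ → ℝ) (s : ℝ) : ℝ := gaussCurvature a s 0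

/-- `M` is the matrix of the differential at the closed geodesic of the Poincaré map of the
geodesic flow: `(r(0), ρ(0)) ↦ (r(2π), ρ(2π))` for the linearized Hamiltonian system
`r' = 2 ρ`, `ρ' = -(R/2) r`. -/
def IsLinearizedPoincareMap (R : ℝ → ℝ) (M : Matrix (Fin 2) (Fin 2) ℝ) : Prop :=
  ∀ r ρ : ℝ → ℝ,
    (∀ s, HasDerivAt r (2 * ρ s) s) → (∀ s, HasDerivAt ρ (-(R s / 2) * r s) s) →
      ![r (2 * Real.pi), ρ (2 * Real.pi)] = M.mulVec ![r 0, ρ 0]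

/-- The characteristic multipliers (the complex eigenvalues of `M`, with multiplicity) are
`exp (i lam)` and `exp (-i lam)`. -/
def HasMultipliers (M : Matrix (Fin 2) (Fin 2) ℝ) (lam : ℝ) : Prop :=
  (M.map (fun t : ℝ => (t : ℂ))).charpoly.roots =
    {Complex.exp (Complex.I * lam), Complex.exp (-(Complex.I * lam))}

/-- The Diophantine condition on `lam / π`. -/
def IsDiophantine (lam : ℝ) : Prop :=
  ∃ τ μ : ℝ, 0 < τ ∧ 0 < μ ∧ ∀ (p : ℤ) (q : ℕ), (p, q) ≠ (0, 0) →
    μ / (|(p : ℝ)| + (q : ℝ)) ^ τ ≤ |(p : ℝ) - (q : ℝ) * (lam / Real.pi)|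

/-- `a₀` is the normalized complex Floquet solution of `y'' + R y = 0`, `β` is its continuous
argument, and `Λ` is the Floquet exponent: `|a₀|` and `β(s) - Λ s / (2π)` are `2π`-periodic. -/
structure IsFloquet (R : ℝ → ℝ) (Λ : ℝ) (a₀ : ℝ → ℂ) (β : ℝ → ℝ) : Prop where
  differentiable : Differentiable ℝ a₀
  ode : ∀ s, HasDerivAt (deriv a₀) (-((R s : ℂ) * a₀ s)) s
  init_pos : 0 < (a₀ 0).re ∧ (a₀ 0).im = 0
  wronskian : ((starRingEnd ℂ) (a₀ 0) * deriv a₀ 0).im = 1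
  arg_continuous : Continuous β
  arg_zero : β 0 = 0
  polar : ∀ s, a₀ s = (‖a₀ s‖ : ℂ) * Complex.exp (Complex.I * (β s : ℂ))
  norm_periodic : ∀ s, ‖a₀ (s + 2 * Real.pi)‖ = ‖a₀ s‖
  arg_add : ∀ s, β (s + 2 * Real.pi) = β s + Λ

/-- The `k`-th `L²(ℝ)`-normalized Hermite function, `H φ_k = (k + 1/2) φ_k` for
`H = -(1/2) ∂_x² + (1/2) x²`.  (`Polynomial.hermite` is the probabilists' polynomial.) -/
def hermiteFun (k : ℕ) (x : ℝ) : ℝ :=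
  (Real.sqrt ((k ! : ℝ) * Real.sqrt Real.pi))⁻¹ *
    Polynomial.aeval (Real.sqrt 2 * x) (Polynomial.hermite k) * Real.exp (-(x ^ 2) / 2)

/-- `E_0(k) = -λ/(4π) + (k/2)(ω₁ - λ/π)`, where `ω₁ = (ω - 1)/2`. -/
def energy (ω Λ : ℝ) (k : ℕ) : ℝ :=
  -(Λ / (4 * Real.pi)) + (1 / 2) * (k : ℝ) * ((1 / 2) * (ω - 1) - Λ / Real.pi)

/-- `α = log |a₀|`. -/
def logNorm (a₀ : ℝ → ℂ) (s : ℝ) : ℝ := Real.log ‖a₀ s‖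

/-- `w_k(s,x) = e^{-i s E_0(k)} e^{i α'(s) x²/2} e^{-i(1/2+k)β(s)} e^{-α(s)/2} φ_k(x e^{-α(s)})`. -/
def hermiteMode (ω Λ : ℝ) (a₀ : ℝ → ℂ) (β : ℝ → ℝ) (k : ℕ) (s x : ℝ) : ℂ :=
  Complex.exp (-(Complex.I * (s * energy ω Λ k : ℝ))) *
    Complex.exp (Complex.I * (deriv (logNorm a₀) s * x ^ 2 / 2 : ℝ)) *
    Complex.exp (-(Complex.I * ((1 / 2 + (k : ℝ)) * β s : ℝ))) *
    ((Real.exp (-(logNorm a₀ s) / 2) * hermiteFun k (x * Real.exp (-(logNorm a₀ s))) : ℝ) : ℂ)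

/-- `v ∈ C^∞([0,2π], 𝓢(ℝ))` (in the variables `(s, x)`), for a function defined for all `s ∈ ℝ`:
joint smoothness, and all Schwartz seminorms of all `∂_s^n v(s,·)` are bounded over `[0,2π]`.
With the twisted periodicity the same bounds hold on all compact `s`-intervals. -/
structure IsSmoothSchwartz (v : ℝ → ℝ → ℂ) : Prop where
  smooth : ContDiff ℝ (⊤ : ℕ∞) (fun z : ℝ × ℝ => v z.1 z.2)
  decay : ∀ n m k : ℕ, ∃ C : ℝ, ∀ s ∈ Set.Icc (0 : ℝ) (2 * Real.pi), ∀ x : ℝ,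
    |x| ^ k * ‖iteratedDeriv m (fun y => iteratedDeriv n (fun t => v t y) s) x‖ ≤ C

/-- The Taylor series at `η = 0` of `η ↦ f (η x)`, as a formal power series in `η`. -/
def taylorAt (f : ℝ → ℝ) (x : ℝ) : PowerSeries ℂ :=
  PowerSeries.mk fun n => ((iteratedDeriv n f 0 / (n ! : ℝ) * x ^ n : ℝ) : ℂ)

/-- The formal series `∑_{j < p} η^j f_j`. -/
def truncSeries (p : ℕ) (f : ℕ → ℂ) : PowerSeries ℂ :=
  PowerSeries.mk fun j => if j < p then f j else 0

/-- The source term `Q_p(s,x)`, a function of `s`, `x`, `(v_j)_{j<p}` and `(E_j)_{j<p}` only.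

Write `η = h^{1/2}` (the formal variable), `r = η x` and
`B = 1/a²`, `C = a⁻¹ ∂_s(a⁻¹)`, `D = a⁻¹ ∂_r a`, expanded in powers of `r = η x`.
With `u = δ h^{-1/4} e^{i s/h} v(s, r/√h)` and `E = (1 - λ h²)/(2h)`, the equation
`-Δ u = λ u - ε |u|² u`, multiplied by `h/2`, reads
`i ∂_s v + ½ ∂_x² v + i (B - 1) ∂_s v + ½ η² B ∂_s² v - ½ η⁻² (B - 1) v
    + ½ C (i v + η² ∂_s v) + ½ η D ∂_x v = E v + ½ ε δ² η |v|² v`.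
Here `η⁻² (B - 1) = R x² + O(η)`; `Q_p` collects the terms of the coefficient of `η^p`, moved to
the right-hand side, that do not contain `v_p` or `E_p`. -/
def source (a : ℝ → ℝ → ℝ) (ε δ : ℝ) (E : ℕ → ℂ) (v : ℕ → ℝ → ℝ → ℂ) (p : ℕ) (s x : ℝ) : ℂ :=
  let η : PowerSeries ℂ := PowerSeries.X
  let B := taylorAt (fun r => 1 / (a s r) ^ 2) x
  let C := taylorAt (fun r => 1 / a s r * deriv (fun t => 1 / a t r) s) x
  let D := taylorAt (fun r => deriv (a s) r / a s r) x
  -- `G = η⁻² (B - 1)`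
  let G : PowerSeries ℂ := PowerSeries.mk fun n => PowerSeries.coeff (n + 2) B
  let Et : PowerSeries ℂ := truncSeries p (fun j => if j = 0 then 0 else E j)
  let V := truncSeries p (fun j => v j s x)
  let Vbar := truncSeries p (fun j => (starRingEnd ℂ) (v j s x))
  let Vs := truncSeries p (fun j => deriv (fun t => v j t x) s)
  let Vss := truncSeries p (fun j => iteratedDeriv 2 (fun t => v j t x) s)
  let Vx := truncSeries p (fun j => deriv (fun y => v j s y) x)
  PowerSeries.coeff p
    (Et * V + ((1 / 2 * ε * δ ^ 2 : ℝ) : ℂ) • (η * (V * Vbar * V))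
      - (Complex.I • ((B - 1) * Vs) + (1 / 2 : ℂ) • (η ^ 2 * B * Vss) - (1 / 2 : ℂ) • (G * V)
          + (1 / 2 : ℂ) • (C * (Complex.I • V + η ^ 2 * Vs)) + (1 / 2 : ℂ) • (η * D * Vx)))

/-- `(E_p, v_p)` solves the `p`-th equation of the hierarchy, in the class of functions
`C^∞([0,2π], 𝓢(ℝ))` with `v_p(s+2π, x) = v_p(s, ω x)`; here `E_0 = E_0(k₀)`, `v_0 = w_{k₀}`
and the right-hand side of the equation is `0` for `p = 0`. -/
structure SolvesLevel (ω : ℝ) (a : ℝ → ℝ → ℝ) (ε δ Λ : ℝ) (a₀ : ℝ → ℂ) (β : ℝ → ℝ) (k₀ : ℕ)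
    (E : ℕ → ℂ) (v : ℕ → ℝ → ℝ → ℂ) (p : ℕ) : Prop where
  start : p = 0 → E 0 = (energy ω Λ k₀ : ℂ) ∧ v 0 = hermiteMode ω Λ a₀ β k₀
  smoothSchwartz : IsSmoothSchwartz (v p)
  twist : ∀ s x, v p (s + 2 * Real.pi) x = v p s (ω * x)
  equation : ∀ s x : ℝ,
    Complex.I * deriv (fun t => v p t x) s + 1 / 2 * iteratedDeriv 2 (fun y => v p s y) x
        - 1 / 2 * ((curv a s * x ^ 2 : ℝ) : ℂ) * v p s x - E 0 * v p s x
      = if p = 0 then 0 else E p * v 0 s x + source a ε δ E v p s x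

end

end WKB

/-!
# Quasimodes of all orders along a stable non-degenerate closed geodesic

Write `α = log |a₀|`. The substitution `v = e^{-isE₀} e^{iα'x²/2} e^{-α/2} u(s, x e^{-α})` turns the
operator `i ∂_s + ½ ∂_x² - ½ R x² - E₀` into `i ∂_s - e^{-2α} H`, where `H = -½ ∂_y² + ½ y²` is the
harmonic oscillator in `y = x e^{-α}` (`gauge_equation`); this is a consequence of
`α'' + α'² + R = e^{-4α}`, the real part of `a₀'' + R a₀ = 0` divided by `a₀`. The imaginary part shows
that `β' = e^{-2α}`. Hence, expanding `u = ∑ e^{-i(k+1/2)β(s)} c_k(s) φ_k(y)` in Hermite functions, the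
linear equation with right-hand side `f` decouples into `i c_k' = g_k`, where `g_k` is the `k`-th
coefficient of `f` up to the phase. The twisted periodicity of `v` means that
`c_k(s + 2π) = θ_k c_k(s)` with `θ_k = e^{i((k - k₀)Λ + π n_k)}` for integers `n_k` (`mode_multiplier`).

For `k ≠ k₀` the constant of integration is obtained on division by `θ_k - 1`, which by the Diophantine
condition is at least polynomially small in `k` (`small_divisors`); rapid decrease in `k` is therefore
preserved (`exists_primitive`). For `k = k₀` one has `θ_k = 1`, so `g_{k₀}` must have mean value zero,
and this is what the choice of `E_p` achieves, because `v₀ = w_{k₀}` is exactly the mode `k₀`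
(`exists_solvesLinear`). Applied to the source term, which depends on the earlier terms only and is
of the same class (`source_mem`, `source_twist`), this is the recursive step `SolvesLevel.extend`.

To pass between Schwartz functions and rapidly decreasing coefficients, all function classes are
defined as the largest space of functions satisfying a bound which is stable under the partial
derivatives (`jet`), so that no iterated derivative has to be estimated by hand. The Hermite expansion
rests on the ladder relations, on integration by parts, and on the completeness of the Hermite
functions (`hermiteSum_hermiteCoeff`).

A Floquet triple exists because a complex eigenvector of the Poincaré map for `e^{i lam}` is the initial
value of a quasi-periodic solution of `y'' + R y = 0`. Its Wronskian with the complex conjugate does not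
vanish, since otherwise the eigenvalue would be real and `lam / π` an integer, contrary to the
Diophantine condition (`exists_quasiperiodic`, `exists_isFloquet`). Conversely `e^{iΛ}` is an eigenvalue
of the Poincaré map for every normalized triple (`IsFloquet.multiplier`).
-/

namespace WKB

open Filter Topology MeasureTheory

/-! ### Spaces stable under derivations -/

/-- The largest submodule of `b` that is stable under the (partially defined) derivations `r i`,
each encoded as its graph.  It is built as the union of all stable submodules of `b`, so that an
element belongs to it as soon as a generating set containing it is stable up to linear
combinations; no iterated derivative is ever written down. -/
def jet {V ι : Type*} [AddCommGroup V] [Module ℂ V] (b : Submodule ℂ V)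
    (r : ι → Submodule ℂ (V × V)) : Submodule ℂ V where
  carrier := {F | ∃ P : Submodule ℂ V, F ∈ P ∧ P ≤ b ∧ ∀ i, ∀ G ∈ P, ∃ G' ∈ P, (G, G') ∈ r i}
  zero_mem' := ⟨⊥, by simp, bot_le, fun i G hG => ⟨0, by simp, by
    rw [Submodule.mem_bot] at hG; subst hG; exact (r i).zero_mem⟩⟩
  add_mem' := by
    rintro F G ⟨P, hF, hP, hP'⟩ ⟨Q, hG, hQ, hQ'⟩
    refine ⟨P ⊔ Q, Submodule.add_mem_sup hF hG, sup_le hP hQ, fun i K hK => ?_⟩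
    obtain ⟨p, hp, q, hq, rfl⟩ := Submodule.mem_sup.1 hK
    obtain ⟨p', hp', hpp⟩ := hP' i p hp
    obtain ⟨q', hq', hqq⟩ := hQ' i q hq
    exact ⟨p' + q', Submodule.add_mem_sup hp' hq', (r i).add_mem hpp hqq⟩
  smul_mem' := by
    rintro c F ⟨P, hF, hP⟩
    exact ⟨P, P.smul_mem c hF, hP⟩

section Jet

variable {V ι : Type*} [AddCommGroup V] [Module ℂ V] {b : Submodule ℂ V}
  {r : ι → Submodule ℂ (V × V)}

theorem jet_le : jet b r ≤ b := by
  rintro F ⟨P, hF, hP, -⟩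
  exact hP hF

theorem exists_jet_derivative {F : V} (hF : F ∈ jet b r) (i : ι) :
    ∃ G ∈ jet b r, (F, G) ∈ r i := by
  obtain ⟨P, hF, hP, hP'⟩ := hF
  obtain ⟨G, hG, h⟩ := hP' i F hF
  exact ⟨G, ⟨P, hG, hP, hP'⟩, h⟩

/-- Membership criterion for `jet`: a set of elements of `b` whose derivatives are linear
combinations of the set and of elements already known to lie in `jet b r`. -/
theorem subset_jet (S : Set V) (hb : ∀ F ∈ S, F ∈ b)
    (h : ∀ F ∈ S, ∀ i, ∃ G ∈ Submodule.span ℂ S ⊔ jet b r, (F, G) ∈ r i) :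
    ∀ F ∈ S, F ∈ jet b r := by
  intro F hF
  refine ⟨Submodule.span ℂ S ⊔ jet b r,
    Submodule.mem_sup_left (Submodule.subset_span hF),
    sup_le (Submodule.span_le.2 hb) jet_le, fun i K hK => ?_⟩
  obtain ⟨p, hp, q, hq, rfl⟩ := Submodule.mem_sup.1 hK
  obtain ⟨q', hq', hqq⟩ := exists_jet_derivative hq i
  suffices ∃ p' ∈ Submodule.span ℂ S ⊔ jet b r, (p, p') ∈ r i by
    obtain ⟨p', hp', hpp⟩ := this
    exact ⟨p' + q', add_mem hp' (Submodule.mem_sup_right hq'), (r i).add_mem hpp hqq⟩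
  clear hK
  induction hp using Submodule.span_induction with
  | mem x hx => exact h x hx i
  | zero => exact ⟨0, zero_mem _, (r i).zero_mem⟩
  | add x y _ _ hx hy =>
    obtain ⟨x', hx', hxx⟩ := hx
    obtain ⟨y', hy', hyy⟩ := hy
    exact ⟨x' + y', add_mem hx' hy', (r i).add_mem hxx hyy⟩
  | smul c x _ hx =>
    obtain ⟨x', hx', hxx⟩ := hx
    exact ⟨c • x', Submodule.smul_mem _ c hx', (r i).smul_mem c hxx⟩

end Jet

/-! ### Schwartz families and temperate families -/

/-- The graphs of the partial derivatives `∂_s` (`false`) and `∂_x` (`true`). -/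
def partials : Bool → Submodule ℂ ((ℝ → ℝ → ℂ) × (ℝ → ℝ → ℂ))
  | false =>
    { carrier := {p | ∀ s x, HasDerivAt (fun t => p.1 t x) (p.2 s x) s}
      zero_mem' := fun s _ => hasDerivAt_const s 0
      add_mem' := fun h h' s x => (h s x).add (h' s x)
      smul_mem' := fun c _ h s x => (h s x).const_smul c }
  | true =>
    { carrier := {p | ∀ s x, HasDerivAt (fun y => p.1 s y) (p.2 s x) x}
      zero_mem' := fun _ x => hasDerivAt_const x 0
      add_mem' := fun h h' s x => (h s x).add (h' s x)
      smul_mem' := fun c _ h s x => (h s x).const_smul c }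

/-- Continuous functions of `(s, x)` decaying rapidly in `x`, uniformly in `s`. -/
def rapidDecay : Submodule ℂ (ℝ → ℝ → ℂ) where
  carrier := {F | Continuous (fun z : ℝ × ℝ => F z.1 z.2) ∧
    ∀ k : ℕ, ∃ C : ℝ, ∀ s x, |x| ^ k * ‖F s x‖ ≤ C}
  zero_mem' := ⟨continuous_const, fun k => ⟨0, fun s x => by simp⟩⟩
  add_mem' := by
    rintro F G ⟨hF, hF'⟩ ⟨hG, hG'⟩
    refine ⟨hF.add hG, fun k => ?_⟩
    obtain ⟨C, hC⟩ := hF' k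
    obtain ⟨D, hD⟩ := hG' k
    refine ⟨C + D, fun s x => ?_⟩
    calc |x| ^ k * ‖(F + G) s x‖ ≤ |x| ^ k * (‖F s x‖ + ‖G s x‖) := by
          gcongr; exact norm_add_le _ _
      _ ≤ C + D := by rw [mul_add]; exact add_le_add (hC s x) (hD s x)
  smul_mem' := by
    rintro c F ⟨hF, hF'⟩
    refine ⟨hF.const_smul c, fun k => ?_⟩
    obtain ⟨C, hC⟩ := hF' k
    refine ⟨‖c‖ * C, fun s x => ?_⟩
    calc |x| ^ k * ‖(c • F) s x‖ = ‖c‖ * (|x| ^ k * ‖F s x‖) := by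
          simp only [Pi.smul_apply, smul_eq_mul, norm_mul]; ring
      _ ≤ ‖c‖ * C := by gcongr; exact hC s x

/-- Continuous functions of `(s, x)` of polynomial growth in `x`, uniformly in `s`. -/
def polyGrowth : Submodule ℂ (ℝ → ℝ → ℂ) where
  carrier := {F | Continuous (fun z : ℝ × ℝ => F z.1 z.2) ∧
    ∃ (C : ℝ) (k : ℕ), ∀ s x, ‖F s x‖ ≤ C * (1 + |x|) ^ k}
  zero_mem' := ⟨continuous_const, 0, 0, fun s x => by simp⟩
  add_mem' := by
    rintro F G ⟨hF, C, k, hC⟩ ⟨hG, D, l, hD⟩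
    refine ⟨hF.add hG, |C| + |D|, k + l, fun s x => ?_⟩
    have h1 : (1 : ℝ) ≤ 1 + |x| := by linarith [abs_nonneg x]
    calc ‖(F + G) s x‖ ≤ ‖F s x‖ + ‖G s x‖ := norm_add_le _ _
      _ ≤ C * (1 + |x|) ^ k + D * (1 + |x|) ^ l := add_le_add (hC s x) (hD s x)
      _ ≤ |C| * (1 + |x|) ^ (k + l) + |D| * (1 + |x|) ^ (k + l) := by
          gcongr ?_ * ?_ + ?_ * ?_
          · exact le_abs_self C
          · exact pow_le_pow_right₀ h1 (by omega)
          · exact le_abs_self D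
          · exact pow_le_pow_right₀ h1 (by omega)
      _ = _ := by ring
  smul_mem' := by
    rintro c F ⟨hF, C, k, hC⟩
    refine ⟨hF.const_smul c, ‖c‖ * C, k, fun s x => ?_⟩
    calc ‖(c • F) s x‖ = ‖c‖ * ‖F s x‖ := by simp
      _ ≤ ‖c‖ * (C * (1 + |x|) ^ k) := by gcongr; exact hC s x
      _ = _ := by ring

/-- Smooth functions of `(s, x)` all of whose partial derivatives decay rapidly in `x`, uniformly
in `s ∈ ℝ`.  Uniformity over all of `ℝ` costs nothing for twisted-periodic functions. -/
def schwartzFamily : Submodule ℂ (ℝ → ℝ → ℂ) := jet rapidDecay partials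

/-- Smooth functions of `(s, x)` all of whose partial derivatives grow polynomially in `x`,
uniformly in `s ∈ ℝ`: the multipliers of `schwartzFamily`. -/
def temperateFamily : Submodule ℂ (ℝ → ℝ → ℂ) := jet polyGrowth partials

/-- The partial derivative `∂_s`. -/
noncomputable def dS (F : ℝ → ℝ → ℂ) : ℝ → ℝ → ℂ := fun s x => deriv (fun t => F t x) s

/-- The partial derivative `∂_x`. -/
noncomputable def dX (F : ℝ → ℝ → ℂ) : ℝ → ℝ → ℂ := fun s x => deriv (fun y => F s y) x

section Partials

variable {b : Submodule ℂ (ℝ → ℝ → ℂ)} {F : ℝ → ℝ → ℂ}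

theorem dS_mem_jet (hF : F ∈ jet b partials) : dS F ∈ jet b partials := by
  obtain ⟨G, hG, h⟩ := exists_jet_derivative hF false
  have : dS F = G := by ext s x; exact (h s x).deriv
  rwa [this]

theorem dX_mem_jet (hF : F ∈ jet b partials) : dX F ∈ jet b partials := by
  obtain ⟨G, hG, h⟩ := exists_jet_derivative hF true
  have : dX F = G := by ext s x; exact (h s x).deriv
  rwa [this]

theorem hasDerivAt_dS (hF : F ∈ jet b partials) (s x : ℝ) :
    HasDerivAt (fun t => F t x) (dS F s x) s := by
  obtain ⟨G, hG, h⟩ := exists_jet_derivative hF false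
  exact (h s x).differentiableAt.hasDerivAt

theorem hasDerivAt_dX (hF : F ∈ jet b partials) (s x : ℝ) :
    HasDerivAt (fun y => F s y) (dX F s x) x := by
  obtain ⟨G, hG, h⟩ := exists_jet_derivative hF true
  exact (h s x).differentiableAt.hasDerivAt

/-- A form of `subset_jet` for functions of `(s, x)`, with explicit derivatives. -/
theorem subset_jet_partials (S : Set (ℝ → ℝ → ℂ)) (hb : ∀ F ∈ S, F ∈ b)
    (h : ∀ F ∈ S, ∃ G ∈ Submodule.span ℂ S ⊔ jet b partials,
      ∃ K ∈ Submodule.span ℂ S ⊔ jet b partials,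
        (∀ s x, HasDerivAt (fun t => F t x) (G s x) s) ∧
        ∀ s x, HasDerivAt (fun y => F s y) (K s x) x) :
    ∀ F ∈ S, F ∈ jet b partials := by
  refine subset_jet S hb fun F hF i => ?_
  obtain ⟨G, hG, K, hK, h1, h2⟩ := h F hF
  cases i
  · exact ⟨G, hG, h1⟩
  · exact ⟨K, hK, h2⟩

/-- Joint smoothness, from the continuity of all iterated partial derivatives. -/
theorem contDiff_of_mem_jet (hb : ∀ G ∈ b, Continuous (fun z : ℝ × ℝ => G z.1 z.2))
    (hF : F ∈ jet b partials) : ContDiff ℝ (⊤ : ℕ∞) (fun z : ℝ × ℝ => F z.1 z.2) := by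
  refine contDiff_infty.2 fun n => ?_
  induction n generalizing F with
  | zero => exact contDiff_zero.2 (hb F (jet_le hF))
  | succ n ih =>
    have hs := ih (dS_mem_jet hF)
    have hx := ih (dX_mem_jet hF)
    push_cast
    refine contDiff_succ_iff_hasFDerivAt.2 ⟨fun z =>
      ((1 : ℝ →L[ℝ] ℝ).smulRight (dS F z.1 z.2)).coprod
        ((1 : ℝ →L[ℝ] ℝ).smulRight (dX F z.1 z.2)), ?_, fun z => ?_⟩
    · refine contDiff_clm_apply_iff.2 fun y => ?_
      simp only [ContinuousLinearMap.coprod_apply, ContinuousLinearMap.smulRight_apply,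
        one_apply_eq_self]
      exact (contDiff_const.smul hs).add (contDiff_const.smul hx)
    · have cs := hb _ (jet_le (dS_mem_jet hF))
      have cx := hb _ (jet_le (dX_mem_jet hF))
      have := hasStrictFDerivAt_uncurry_coprod (𝕜 := ℝ) (u := z) (f := F)
        (f₁ := fun s x => (1 : ℝ →L[ℝ] ℝ).smulRight (dS F s x))
        (f₂ := fun s x => (1 : ℝ →L[ℝ] ℝ).smulRight (dX F s x))
        (Eventually.of_forall fun v => (hasDerivAt_dS hF v.1 v.2).hasFDerivAt)
        (Eventually.of_forall fun v => (hasDerivAt_dX hF v.1 v.2).hasFDerivAt)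
        (by
          refine Continuous.continuousAt ?_
          refine continuous_clm_apply.2 fun y => ?_
          simp only [Function.HasUncurry.uncurry, id, ContinuousLinearMap.smulRight_apply]
          exact continuous_const.smul cs)
        (by
          refine Continuous.continuousAt ?_
          refine continuous_clm_apply.2 fun y => ?_
          simp only [Function.HasUncurry.uncurry, id, ContinuousLinearMap.smulRight_apply]
          exact continuous_const.smul cx)
      exact this.hasFDerivAt

end Partials

theorem schwartzFamily_contDiff {F : ℝ → ℝ → ℂ} (hF : F ∈ schwartzFamily) :
    ContDiff ℝ (⊤ : ℕ∞) (fun z : ℝ × ℝ => F z.1 z.2) :=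
  contDiff_of_mem_jet (b := rapidDecay) (fun _ h => h.1) hF

theorem dS_mem_schwartzFamily {F : ℝ → ℝ → ℂ} (hF : F ∈ schwartzFamily) :
    dS F ∈ schwartzFamily := dS_mem_jet hF

theorem dX_mem_schwartzFamily {F : ℝ → ℝ → ℂ} (hF : F ∈ schwartzFamily) :
    dX F ∈ schwartzFamily := dX_mem_jet hF

theorem mul_mem_temperateFamily {g h : ℝ → ℝ → ℂ} (hg : g ∈ temperateFamily)
    (hh : h ∈ temperateFamily) : g * h ∈ temperateFamily := by
  refine subset_jet_partials {f | ∃ g ∈ temperateFamily, ∃ h ∈ temperateFamily,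
    f = g * h} ?_ ?_ _ ⟨g, hg, h, hh, rfl⟩
  · rintro _ ⟨g, hg, h, hh, rfl⟩
    obtain ⟨hgc, C, k, hC⟩ := jet_le hg
    obtain ⟨hhc, D, l, hD⟩ := jet_le hh
    refine ⟨hgc.mul hhc, C * D, k + l, fun s x => ?_⟩
    calc ‖g s x * h s x‖ = ‖g s x‖ * ‖h s x‖ := norm_mul _ _
      _ ≤ (C * (1 + |x|) ^ k) * (D * (1 + |x|) ^ l) :=
        mul_le_mul (hC s x) (hD s x) (norm_nonneg _) ((norm_nonneg _).trans (hC s x))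
      _ = _ := by ring
  · rintro _ ⟨g, hg, h, hh, rfl⟩
    have gen : ∀ g ∈ temperateFamily, ∀ h ∈ temperateFamily,
        g * h ∈ Submodule.span ℂ {f | ∃ g ∈ temperateFamily, ∃ h ∈ temperateFamily,
          f = g * h} ⊔ jet polyGrowth partials :=
      fun g hg F hF => Submodule.mem_sup_left (Submodule.subset_span ⟨g, hg, F, hF, rfl⟩)
    exact ⟨_, add_mem (gen _ (dS_mem_jet hg) h hh) (gen g hg _ (dS_mem_jet hh)), _,
      add_mem (gen _ (dX_mem_jet hg) h hh) (gen g hg _ (dX_mem_jet hh)),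
      fun s x => (hasDerivAt_dS hg s x).mul (hasDerivAt_dS hh s x),
      fun s x => (hasDerivAt_dX hg s x).mul (hasDerivAt_dX hh s x)⟩

/-- Schwartz families stay Schwartz when multiplied by a temperate family and rescaled in `x` by a
temperate function of `s` that is bounded away from zero. -/
theorem mul_comp_mem_schwartzFamily {g F : ℝ → ℝ → ℂ} (hg : g ∈ temperateFamily)
    (hF : F ∈ schwartzFamily) {κ κ' : ℝ → ℝ} {c : ℝ} (hc : 0 < c) (hκ : ∀ s, c ≤ κ s)
    (hκ' : ∀ s, HasDerivAt κ (κ' s) s)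
    (hT : (fun s _ => (κ s : ℂ)) ∈ temperateFamily)
    (hT' : (fun s x => ((κ' s * x : ℝ) : ℂ)) ∈ temperateFamily) :
    (fun s x => g s x * F s (x * κ s)) ∈ schwartzFamily := by
  have hκc : Continuous κ := continuous_iff_continuousAt.2 fun s => (hκ' s).continuousAt
  refine subset_jet_partials {f | ∃ g ∈ temperateFamily, ∃ F ∈ schwartzFamily,
    f = fun s x => g s x * F s (x * κ s)} ?_ ?_ _ ⟨g, hg, F, hF, rfl⟩
  · rintro _ ⟨g, hg, F, hF, rfl⟩
    obtain ⟨hgc, C, k, hC⟩ := jet_le hg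
    obtain ⟨hFc, hFd⟩ := jet_le hF
    refine ⟨hgc.mul (hFc.comp (continuous_fst.prodMk
      (continuous_snd.mul (hκc.comp continuous_fst)))), fun l => ?_⟩
    have hC0 : 0 ≤ C := by
      have := (norm_nonneg _).trans (hC 0 0)
      simpa using this
    obtain ⟨D₁, hD₁⟩ := hFd 0
    obtain ⟨D₂, hD₂⟩ := hFd (k + l)
    refine ⟨C * 2 ^ k * (D₁ + D₂ / c ^ (k + l)), fun s x => ?_⟩
    -- `|x|^l (1 + |x|)^k ≤ 2^k (1 + |x|^(k+l))`, and `|x| ≤ |x κ| / c`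
    have hx0 := abs_nonneg x
    have h1 : |x| ^ l * (1 + |x|) ^ k ≤ 2 ^ k * (1 + |x| ^ (k + l)) := by
      rcases le_total |x| 1 with h | h
      · calc |x| ^ l * (1 + |x|) ^ k ≤ 1 ^ l * (1 + 1) ^ k := by gcongr
          _ ≤ 2 ^ k * (1 + |x| ^ (k + l)) := by
            rw [one_pow, one_mul, one_add_one_eq_two]
            have : (0:ℝ) ≤ |x| ^ (k + l) := by positivity
            nlinarith [pow_pos (two_pos : (0:ℝ) < 2) k]
      · calc |x| ^ l * (1 + |x|) ^ k ≤ |x| ^ l * (|x| + |x|) ^ k := by gcongr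
          _ = 2 ^ k * |x| ^ (k + l) := by rw [← two_mul, mul_pow, pow_add]; ring
          _ ≤ _ := by gcongr; linarith
    have h2 : |x| ^ (k + l) * ‖F s (x * κ s)‖ ≤ D₂ / c ^ (k + l) := by
      rw [le_div_iff₀ (by positivity)]
      calc |x| ^ (k + l) * ‖F s (x * κ s)‖ * c ^ (k + l)
          = (|x| * c) ^ (k + l) * ‖F s (x * κ s)‖ := by rw [mul_pow]; ring
        _ ≤ |x * κ s| ^ (k + l) * ‖F s (x * κ s)‖ := by
          rw [abs_mul]
          gcongr
          exact (hκ s).trans (le_abs_self _)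
        _ ≤ D₂ := hD₂ s _
    have h3 : ‖F s (x * κ s)‖ ≤ D₁ := by simpa using hD₁ s (x * κ s)
    calc |x| ^ l * ‖g s x * F s (x * κ s)‖
        ≤ |x| ^ l * ((C * (1 + |x|) ^ k) * ‖F s (x * κ s)‖) := by
          rw [norm_mul]; gcongr; exact hC s x
      _ = C * (|x| ^ l * (1 + |x|) ^ k) * ‖F s (x * κ s)‖ := by ring
      _ ≤ C * (2 ^ k * (1 + |x| ^ (k + l))) * ‖F s (x * κ s)‖ := by gcongr
      _ = C * 2 ^ k * (‖F s (x * κ s)‖ + |x| ^ (k + l) * ‖F s (x * κ s)‖) := by ring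
      _ ≤ _ := by gcongr
  · rintro _ ⟨g, hg, F, hF, rfl⟩
    have gen : ∀ g ∈ temperateFamily, ∀ F ∈ schwartzFamily,
        (fun s x => g s x * F s (x * κ s)) ∈ Submodule.span ℂ {f | ∃ g ∈ temperateFamily,
          ∃ F ∈ schwartzFamily, f = fun s x => g s x * F s (x * κ s)} ⊔
            jet rapidDecay partials :=
      fun g hg F hF => Submodule.mem_sup_left (Submodule.subset_span ⟨g, hg, F, hF, rfl⟩)
    refine ⟨_, add_mem (gen _ (dS_mem_jet hg) F hF) (add_mem (gen g hg _ (dS_mem_jet hF))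
        (gen _ (mul_mem_temperateFamily hg hT') _ (dX_mem_jet hF))), _,
      add_mem (gen _ (dX_mem_jet hg) F hF) (gen _ (mul_mem_temperateFamily hg hT) _ (dX_mem_jet hF)),
      fun s x => ?_, fun s x => ?_⟩
    · have hFd : HasFDerivAt (fun z : ℝ × ℝ => F z.1 z.2)
          (fderiv ℝ (fun z : ℝ × ℝ => F z.1 z.2) (s, x * κ s)) (s, x * κ s) :=
        ((schwartzFamily_contDiff hF).differentiable (by simp) _).hasFDerivAt
      have e1 : fderiv ℝ (fun z : ℝ × ℝ => F z.1 z.2) (s, x * κ s) (1, 0) = dS F s (x * κ s) := by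
        have := hFd.comp_hasDerivAt s ((hasDerivAt_id s).prodMk (hasDerivAt_const s (x * κ s)))
        exact this.unique (hasDerivAt_dS hF s (x * κ s))
      have e2 : fderiv ℝ (fun z : ℝ × ℝ => F z.1 z.2) (s, x * κ s) (0, 1) = dX F s (x * κ s) := by
        have := hFd.comp_hasDerivAt (x * κ s)
          ((hasDerivAt_const (x * κ s) s).prodMk (hasDerivAt_id (x * κ s)))
        exact this.unique (hasDerivAt_dX hF s (x * κ s))
      have h := hFd.comp_hasDerivAt s ((hasDerivAt_id s).prodMk ((hκ' s).const_mul x))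
      have e3 : fderiv ℝ (fun z : ℝ × ℝ => F z.1 z.2) (s, x * κ s) (1, x * κ' s)
          = dS F s (x * κ s) + (κ' s * x : ℝ) * dX F s (x * κ s) := by
        have : ((1 : ℝ), x * κ' s) = (1, 0) + (x * κ' s) • ((0 : ℝ), (1 : ℝ)) := by simp
        rw [this, map_add, map_smul, e1, e2, mul_comm x (κ' s), Complex.real_smul]
      rw [e3] at h
      refine ((hasDerivAt_dS hg s x).mul h).congr_deriv ?_
      simp only [Function.comp, id, Pi.add_apply, Pi.mul_apply]
      ring
    · have h := (hasDerivAt_dX hF s (x * κ s)).scomp x ((hasDerivAt_id x).mul_const (κ s))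
      refine ((hasDerivAt_dX hg s x).mul h).congr_deriv ?_
      simp only [Function.comp, id, Pi.add_apply, Pi.mul_apply, one_mul, Complex.real_smul]
      ring

theorem const_mem_temperateFamily (c : ℂ) : (fun _ _ => c) ∈ temperateFamily := by
  refine subset_jet_partials {f | ∃ c, f = fun _ _ => c} ?_ ?_ _ ⟨c, rfl⟩
  · rintro _ ⟨c, rfl⟩
    exact ⟨continuous_const, ‖c‖, 0, fun s x => by simp⟩
  · rintro _ ⟨c, rfl⟩
    exact ⟨0, zero_mem _, 0, zero_mem _, fun s x => hasDerivAt_const _ _,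
      fun s x => hasDerivAt_const _ _⟩

theorem mul_mem_schwartzFamily {g F : ℝ → ℝ → ℂ} (hg : g ∈ temperateFamily)
    (hF : F ∈ schwartzFamily) : g * F ∈ schwartzFamily := by
  have := mul_comp_mem_schwartzFamily hg hF (κ := fun _ => 1) (κ' := fun _ => 0) one_pos
    (fun _ => le_rfl) (fun s => hasDerivAt_const _ _) (const_mem_temperateFamily _)
    (by simpa using const_mem_temperateFamily 0)
  simp only [mul_one] at this
  exact this

theorem snd_mem_temperateFamily : (fun _ x => (x : ℂ) : ℝ → ℝ → ℂ) ∈ temperateFamily := by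
  refine subset_jet_partials {(fun _ x => (x : ℂ) : ℝ → ℝ → ℂ)} ?_ ?_ _ rfl
  · rintro _ rfl
    refine ⟨by fun_prop, 1, 1, fun s x => ?_⟩
    simp
  · rintro _ rfl
    exact ⟨0, zero_mem _, fun _ _ => 1, Submodule.mem_sup_right (const_mem_temperateFamily 1),
      fun s x => hasDerivAt_const _ _, fun s x => (hasDerivAt_id x).ofReal_comp⟩

theorem mem_temperateFamily_of_schwartzFamily {F : ℝ → ℝ → ℂ} (hF : F ∈ schwartzFamily) :
    F ∈ temperateFamily := by
  refine subset_jet_partials schwartzFamily ?_ ?_ F hF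
  · rintro F hF
    obtain ⟨hc, hd⟩ := jet_le hF
    obtain ⟨C, hC⟩ := hd 0
    exact ⟨hc, C, 0, fun s x => by simpa using hC s x⟩
  · rintro F hF
    exact ⟨dS F, Submodule.mem_sup_left (Submodule.subset_span (dS_mem_jet hF)),
      dX F, Submodule.mem_sup_left (Submodule.subset_span (dX_mem_jet hF)),
      hasDerivAt_dS hF, hasDerivAt_dX hF⟩

theorem conj_mem_schwartzFamily {F : ℝ → ℝ → ℂ} (hF : F ∈ schwartzFamily) :
    (fun s x => (starRingEnd ℂ) (F s x)) ∈ schwartzFamily := by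
  refine subset_jet_partials {f | ∃ F ∈ schwartzFamily, f = fun s x => (starRingEnd ℂ) (F s x)}
    ?_ ?_ _ ⟨F, hF, rfl⟩
  · rintro _ ⟨F, hF, rfl⟩
    obtain ⟨hc, hd⟩ := jet_le hF
    exact ⟨Complex.continuous_conj.comp hc, by simpa using hd⟩
  · rintro _ ⟨F, hF, rfl⟩
    exact ⟨_, Submodule.mem_sup_left (Submodule.subset_span ⟨_, dS_mem_jet hF, rfl⟩),
      _, Submodule.mem_sup_left (Submodule.subset_span ⟨_, dX_mem_jet hF, rfl⟩),
      fun s x => (hasDerivAt_dS hF s x).star, fun s x => (hasDerivAt_dX hF s x).star⟩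

/-! ### Functions of `s` alone -/

theorem bounded_of_periodic {f : ℝ → ℂ} (hf : Continuous f) {T : ℝ} (hT : 0 < T)
    (hp : ∀ s, f (s + T) = f s) : ∃ C, ∀ s, ‖f s‖ ≤ C := by
  have hp' : Function.Periodic f T := hp
  obtain ⟨C, hC⟩ := (isCompact_Icc (a := 0) (b := T)).exists_bound_of_continuousOn hf.continuousOn
  refine ⟨C, fun s => ?_⟩
  obtain ⟨y, hy, e⟩ := hp'.exists_mem_Ico₀ hT s
  rw [e]
  exact hC y ⟨hy.1, hy.2.le⟩

/-- All derivatives of a smooth periodic function are periodic, hence bounded. -/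
theorem periodic_mem_temperateFamily {f : ℝ → ℂ} (hf : ContDiff ℝ (⊤ : ℕ∞) f) {T : ℝ} (hT : 0 < T)
    (hp : ∀ s, f (s + T) = f s) : (fun s _ => f s) ∈ temperateFamily := by
  refine subset_jet_partials {F | ∃ f : ℝ → ℂ, ContDiff ℝ (⊤ : ℕ∞) f ∧ (∀ s, f (s + T) = f s) ∧
    F = fun s _ => f s} ?_ ?_ _ ⟨f, hf, hp, rfl⟩
  · rintro _ ⟨f, hf, hp, rfl⟩
    obtain ⟨C, hC⟩ := bounded_of_periodic hf.continuous hT hp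
    exact ⟨hf.continuous.comp continuous_fst, C, 0, fun s x => by simpa using hC s⟩
  · rintro _ ⟨f, hf, hp, rfl⟩
    refine ⟨fun s _ => deriv f s, Submodule.mem_sup_left (Submodule.subset_span
      ⟨deriv f, (contDiff_infty_iff_deriv.1 hf).2, fun s => ?_, rfl⟩), 0, zero_mem _,
      fun s x => ((contDiff_infty_iff_deriv.1 hf).1 s).hasDerivAt, fun s x => hasDerivAt_const _ _⟩
    rw [← deriv_comp_add_const]
    exact congrArg (fun g => deriv g s) (funext hp)

/-! ### Comparison with `IsSmoothSchwartz` -/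

theorem iteratedDeriv_eq_dS (n : ℕ) (F : ℝ → ℝ → ℂ) (s x : ℝ) :
    iteratedDeriv n (fun t => F t x) s = dS^[n] F s x := by
  induction n generalizing F with
  | zero => rfl
  | succ n ih =>
    rw [iteratedDeriv_succ']
    exact ih (dS F)

theorem iteratedDeriv_eq_dX (n : ℕ) (F : ℝ → ℝ → ℂ) (s x : ℝ) :
    iteratedDeriv n (fun y => F s y) x = dX^[n] F s x := by
  induction n generalizing F with
  | zero => rfl
  | succ n ih =>
    rw [iteratedDeriv_succ']
    exact ih (dX F)

theorem isSmoothSchwartz_of_mem {F : ℝ → ℝ → ℂ} (hF : F ∈ schwartzFamily) :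
    IsSmoothSchwartz F := by
  refine ⟨schwartzFamily_contDiff hF, fun n m k => ?_⟩
  have hS : ∀ n, ∀ F ∈ schwartzFamily, dS^[n] F ∈ schwartzFamily := by
    intro n
    induction n with
    | zero => exact fun F hF => hF
    | succ n ih => exact fun F hF => ih _ (dS_mem_schwartzFamily hF)
  have hX : ∀ n, ∀ F ∈ schwartzFamily, dX^[n] F ∈ schwartzFamily := by
    intro n
    induction n with
    | zero => exact fun F hF => hF
    | succ n ih => exact fun F hF => ih _ (dX_mem_schwartzFamily hF)
  obtain ⟨C, hC⟩ := (jet_le (hX m _ (hS n F hF))).2 k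
  refine ⟨C, fun s _ x => ?_⟩
  simp_rw [iteratedDeriv_eq_dS n F, iteratedDeriv_eq_dX]
  exact hC s x

section Smooth

variable {F : ℝ → ℝ → ℂ}

theorem hasDerivAt_fst_fderiv
    (hF : ContDiff ℝ (⊤ : ℕ∞) (fun z : ℝ × ℝ => F z.1 z.2)) (s x : ℝ) :
    HasDerivAt (fun t => F t x) (fderiv ℝ (fun z : ℝ × ℝ => F z.1 z.2) (s, x) (1, 0)) s :=
  HasFDerivAt.comp_hasDerivAt (l := fun z : ℝ × ℝ => F z.1 z.2) s
    (hF.differentiable (by simp) (s, x)).hasFDerivAt ((hasDerivAt_id s).prodMk (hasDerivAt_const s x))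

theorem hasDerivAt_snd_fderiv
    (hF : ContDiff ℝ (⊤ : ℕ∞) (fun z : ℝ × ℝ => F z.1 z.2)) (s x : ℝ) :
    HasDerivAt (fun y => F s y) (fderiv ℝ (fun z : ℝ × ℝ => F z.1 z.2) (s, x) (0, 1)) x :=
  HasFDerivAt.comp_hasDerivAt (l := fun z : ℝ × ℝ => F z.1 z.2) x
    (hF.differentiable (by simp) (s, x)).hasFDerivAt ((hasDerivAt_const x s).prodMk (hasDerivAt_id x))

theorem contDiff_dS
    (hF : ContDiff ℝ (⊤ : ℕ∞) (fun z : ℝ × ℝ => F z.1 z.2)) :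
    ContDiff ℝ (⊤ : ℕ∞) (fun z : ℝ × ℝ => dS F z.1 z.2) := by
  have : (fun z : ℝ × ℝ => dS F z.1 z.2) =
      fun z => fderiv ℝ (fun z : ℝ × ℝ => F z.1 z.2) z (1, 0) := by
    ext z; exact (hasDerivAt_fst_fderiv hF z.1 z.2).deriv
  rw [this]
  exact (contDiff_infty_iff_fderiv.1 hF).2.clm_apply contDiff_const

theorem contDiff_dX
    (hF : ContDiff ℝ (⊤ : ℕ∞) (fun z : ℝ × ℝ => F z.1 z.2)) :
    ContDiff ℝ (⊤ : ℕ∞) (fun z : ℝ × ℝ => dX F z.1 z.2) := by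
  have : (fun z : ℝ × ℝ => dX F z.1 z.2) =
      fun z => fderiv ℝ (fun z : ℝ × ℝ => F z.1 z.2) z (0, 1) := by
    ext z; exact (hasDerivAt_snd_fderiv hF z.1 z.2).deriv
  rw [this]
  exact (contDiff_infty_iff_fderiv.1 hF).2.clm_apply contDiff_const

theorem dS_dX_comm
    (hF : ContDiff ℝ (⊤ : ℕ∞) (fun z : ℝ × ℝ => F z.1 z.2)) : dS (dX F) = dX (dS F) := by
  have e1 : (fun z : ℝ × ℝ => dX F z.1 z.2) =
      fun z => fderiv ℝ (fun z : ℝ × ℝ => F z.1 z.2) z (0, 1) := by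
    ext z; exact (hasDerivAt_snd_fderiv hF z.1 z.2).deriv
  have e2 : (fun z : ℝ × ℝ => dS F z.1 z.2) =
      fun z => fderiv ℝ (fun z : ℝ × ℝ => F z.1 z.2) z (1, 0) := by
    ext z; exact (hasDerivAt_fst_fderiv hF z.1 z.2).deriv
  ext s x
  have hd : DifferentiableAt ℝ (fderiv ℝ (fun z : ℝ × ℝ => F z.1 z.2)) (s, x) :=
    (contDiff_infty_iff_fderiv.1 hF).2.differentiable (by simp) _
  have h1 := (hasDerivAt_fst_fderiv (contDiff_dX hF) s x).deriv
  have h2 := (hasDerivAt_snd_fderiv (contDiff_dS hF) s x).deriv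
  rw [e1, fderiv_clm_apply hd (differentiableAt_const _)] at h1
  rw [e2, fderiv_clm_apply hd (differentiableAt_const _)] at h2
  have hsymm : IsSymmSndFDerivAt ℝ (fun z : ℝ × ℝ => F z.1 z.2) (s, x) :=
    hF.contDiffAt.isSymmSndFDerivAt (by
      rw [minSmoothness_of_isRCLikeNormedField]; exact WithTop.coe_le_coe.2 le_top)
  simp only [fderiv_fun_const, Pi.zero_apply, ContinuousLinearMap.comp_zero, zero_add,
    ContinuousLinearMap.flip_apply] at h1 h2
  change deriv (fun t => dX F t x) s = deriv (fun y => dS F s y) x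
  rw [h1, h2]
  exact hsymm _ _

theorem contDiff_iterate_dX
    (hF : ContDiff ℝ (⊤ : ℕ∞) (fun z : ℝ × ℝ => F z.1 z.2)) (n : ℕ) :
    ContDiff ℝ (⊤ : ℕ∞) (fun z : ℝ × ℝ => dX^[n] F z.1 z.2) := by
  induction n generalizing F with
  | zero => exact hF
  | succ n ih => exact ih (contDiff_dX hF)

theorem contDiff_iterate_dS
    (hF : ContDiff ℝ (⊤ : ℕ∞) (fun z : ℝ × ℝ => F z.1 z.2)) (n : ℕ) :
    ContDiff ℝ (⊤ : ℕ∞) (fun z : ℝ × ℝ => dS^[n] F z.1 z.2) := by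
  induction n generalizing F with
  | zero => exact hF
  | succ n ih => exact ih (contDiff_dS hF)

theorem dS_iterate_dX_comm
    (hF : ContDiff ℝ (⊤ : ℕ∞) (fun z : ℝ × ℝ => F z.1 z.2)) (n : ℕ) :
    dS (dX^[n] F) = dX^[n] (dS F) := by
  induction n generalizing F with
  | zero => rfl
  | succ n ih =>
    rw [Function.iterate_succ_apply, Function.iterate_succ_apply, ih (contDiff_dX hF),
      dS_dX_comm hF]

end Smooth

theorem dS_twist {F : ℝ → ℝ → ℂ} {T ω : ℝ} {c : ℂ} (h : ∀ s x, F (s + T) x = c * F s (ω * x))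
    (s x : ℝ) : dS F (s + T) x = c * dS F s (ω * x) := by
  unfold dS
  rw [← deriv_comp_add_const, ← deriv_const_mul_field]
  exact congrArg (fun g => deriv g s) (funext fun t => h t x)

theorem dX_twist {F : ℝ → ℝ → ℂ} {T ω : ℝ} {c : ℂ} (h : ∀ s x, F (s + T) x = c * F s (ω * x))
    (s x : ℝ) : dX F (s + T) x = (c * ω) * dX F s (ω * x) := by
  unfold dX
  have : (fun y => F (s + T) y) = fun y => c * F s (ω * y) := funext fun y => h s y
  rw [this, deriv_const_mul_field, deriv_comp_mul_left ω (fun y => F s y) x, Complex.real_smul,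
    mul_assoc]

/-- For twisted-periodic functions, the bounds of `IsSmoothSchwartz` over one period are bounds
over all of `ℝ`. -/
theorem mem_schwartzFamily_of_twist {F : ℝ → ℝ → ℂ} (hF : IsSmoothSchwartz F) {ω : ℝ}
    (hω : ω = 1 ∨ ω = -1) (ht : ∀ s x, F (s + 2 * Real.pi) x = F s (ω * x)) :
    F ∈ schwartzFamily := by
  have hω' : |ω| = 1 := by rcases hω with rfl | rfl <;> simp
  have hS : ∀ n, ∀ G : ℝ → ℝ → ℂ, (∃ c : ℂ, ‖c‖ = 1 ∧
      ∀ s x, G (s + 2 * Real.pi) x = c * G s (ω * x)) → ∃ c : ℂ, ‖c‖ = 1 ∧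
      ∀ s x, dS^[n] G (s + 2 * Real.pi) x = c * dS^[n] G s (ω * x) := by
    intro n
    induction n with
    | zero => exact fun G h => h
    | succ n ih =>
      rintro G ⟨c, hc, h⟩
      exact ih (dS G) ⟨c, hc, dS_twist h⟩
  have hX : ∀ n, ∀ G : ℝ → ℝ → ℂ, (∃ c : ℂ, ‖c‖ = 1 ∧
      ∀ s x, G (s + 2 * Real.pi) x = c * G s (ω * x)) → ∃ c : ℂ, ‖c‖ = 1 ∧
      ∀ s x, dX^[n] G (s + 2 * Real.pi) x = c * dX^[n] G s (ω * x) := by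
    intro n
    induction n with
    | zero => exact fun G h => h
    | succ n ih =>
      rintro G ⟨c, hc, h⟩
      refine ih (dX G) ⟨c * ω, by simp [hc, hω'], dX_twist h⟩
  refine subset_jet_partials {G | ∃ m n, G = dX^[m] (dS^[n] F)} ?_ ?_ _ ⟨0, 0, rfl⟩
  · rintro _ ⟨m, n, rfl⟩
    refine ⟨(contDiff_iterate_dX (contDiff_iterate_dS hF.smooth n) m).continuous, fun k => ?_⟩
    obtain ⟨C, hC⟩ := hF.decay n m k
    obtain ⟨c, hc, h⟩ := hX m _ (hS n F ⟨1, by simp, by simpa using ht⟩)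
    simp_rw [iteratedDeriv_eq_dS n F, iteratedDeriv_eq_dX] at hC
    refine ⟨C, fun s => ?_⟩
    have key : Function.Periodic
        (fun s => ∀ x : ℝ, |x| ^ k * ‖dX^[m] (dS^[n] F) s x‖ ≤ C) (2 * Real.pi) := by
      intro s
      simp only [h, norm_mul, hc, one_mul, eq_iff_iff]
      constructor
      · intro H x
        have := H (ω * x)
        have hωω : ω * (ω * x) = x := by rcases hω with rfl | rfl <;> simp
        rwa [hωω, abs_mul, hω', one_mul] at this
      · intro H x
        have := H (ω * x)
        rwa [abs_mul, hω', one_mul] at this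
    obtain ⟨t, ht, e⟩ := key.exists_mem_Ico₀ Real.two_pi_pos s
    have := hC t ⟨ht.1, ht.2.le⟩
    exact e.mpr this
  · rintro _ ⟨m, n, rfl⟩
    have hn := contDiff_iterate_dS hF.smooth n
    have hm := contDiff_iterate_dX hn m
    refine ⟨dX^[m] (dS^[n+1] F), Submodule.mem_sup_left (Submodule.subset_span ⟨m, n + 1, rfl⟩),
      dX^[m+1] (dS^[n] F), Submodule.mem_sup_left (Submodule.subset_span ⟨m + 1, n, rfl⟩), ?_, ?_⟩
    · intro s x
      rw [Function.iterate_succ_apply' dS, ← dS_iterate_dX_comm hn m]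
      exact (hasDerivAt_fst_fderiv hm s x).differentiableAt.hasDerivAt
    · intro s x
      rw [Function.iterate_succ_apply' dX]
      exact (hasDerivAt_snd_fderiv hm s x).differentiableAt.hasDerivAt

/-! ### Rapidly decaying functions of one variable -/

/-- Continuous functions `f` with `x ^ n * f x` bounded for every `n`. -/
def RapidFun {E : Type*} [NormedAddCommGroup E] (f : ℝ → E) : Prop :=
  Continuous f ∧ ∀ n : ℕ, ∃ C : ℝ, ∀ x, |x| ^ n * ‖f x‖ ≤ C

section RapidFun

variable {A : Type*} [NormedRing A] {f g : ℝ → A}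

theorem RapidFun.add (hf : RapidFun f) (hg : RapidFun g) : RapidFun (fun x => f x + g x) := by
  refine ⟨hf.1.add hg.1, fun n => ?_⟩
  obtain ⟨C, hC⟩ := hf.2 n
  obtain ⟨D, hD⟩ := hg.2 n
  refine ⟨C + D, fun x => ?_⟩
  calc |x| ^ n * ‖f x + g x‖ ≤ |x| ^ n * (‖f x‖ + ‖g x‖) := by gcongr; exact norm_add_le _ _
    _ ≤ C + D := by rw [mul_add]; exact add_le_add (hC x) (hD x)

theorem RapidFun.bounded_mul (hf : Continuous f) {C : ℝ} (hC : ∀ x, ‖f x‖ ≤ C)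
    (hg : RapidFun g) : RapidFun (fun x => f x * g x) := by
  refine ⟨hf.mul hg.1, fun n => ?_⟩
  obtain ⟨D, hD⟩ := hg.2 n
  refine ⟨C * D, fun x => ?_⟩
  have h0 : 0 ≤ C := (norm_nonneg _).trans (hC 0)
  calc |x| ^ n * ‖f x * g x‖ ≤ |x| ^ n * (C * ‖g x‖) := by
        gcongr; exact (norm_mul_le _ _).trans (by gcongr; exact hC x)
    _ = C * (|x| ^ n * ‖g x‖) := by ring
    _ ≤ C * D := by gcongr; exact hD x

theorem RapidFun.bounded (hf : RapidFun f) : ∃ C, ∀ x, ‖f x‖ ≤ C := by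
  simpa using hf.2 0

theorem RapidFun.mul (hf : RapidFun f) (hg : RapidFun g) : RapidFun (fun x => f x * g x) := by
  obtain ⟨C, hC⟩ := hf.bounded
  exact RapidFun.bounded_mul hf.1 hC hg

theorem RapidFun.const_mul (c : A) (hf : RapidFun f) : RapidFun (fun x => c * f x) :=
  RapidFun.bounded_mul continuous_const (fun _ => le_rfl) hf

end RapidFun

theorem RapidFun.id_mul {f : ℝ → ℝ} (hf : RapidFun f) : RapidFun (fun x => x * f x) := by
  refine ⟨continuous_id.mul hf.1, fun n => ?_⟩
  obtain ⟨C, hC⟩ := hf.2 (n + 1)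
  refine ⟨C, fun x => ?_⟩
  have := hC x
  rwa [norm_mul, Real.norm_eq_abs x, ← mul_assoc, ← pow_succ]

theorem RapidFun.ofReal {f : ℝ → ℝ} (hf : RapidFun f) : RapidFun (fun x => (f x : ℂ)) :=
  ⟨Complex.continuous_ofReal.comp hf.1, by simpa using hf.2⟩

theorem RapidFun.id_mul_complex {f : ℝ → ℂ} (hf : RapidFun f) :
    RapidFun (fun x => (x : ℂ) * f x) := by
  refine ⟨Complex.continuous_ofReal.mul hf.1, fun n => ?_⟩
  obtain ⟨C, hC⟩ := hf.2 (n + 1)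
  refine ⟨C, fun x => ?_⟩
  have := hC x
  rwa [norm_mul, Complex.norm_real, Real.norm_eq_abs x, ← mul_assoc, ← pow_succ]

theorem norm_le_of_decay {E : Type*} [NormedAddCommGroup E] {f : ℝ → E} {C D : ℝ}
    (hC : ∀ x, ‖f x‖ ≤ C) (hD : ∀ x, |x| ^ 2 * ‖f x‖ ≤ D) (x : ℝ) :
    ‖f x‖ ≤ (C + D) * (1 + x ^ 2)⁻¹ := by
  rw [← div_eq_mul_inv, le_div_iff₀ (by positivity)]
  have h1 := hC x
  have h2 := hD x
  rw [sq_abs] at h2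
  linarith

theorem RapidFun.integrable {E : Type*} [NormedAddCommGroup E] {f : ℝ → E}
    (hf : RapidFun f) : Integrable f := by
  obtain ⟨C, hC⟩ := hf.2 0
  obtain ⟨D, hD⟩ := hf.2 2
  refine (integrable_inv_one_add_sq.const_mul (C + D)).mono' hf.1.aestronglyMeasurable
    (ae_of_all _ fun x => norm_le_of_decay (by simpa using hC) hD x)

theorem RapidFun.tendsto_atBot {f : ℝ → ℝ} (hf : RapidFun f) : Tendsto f atBot (𝓝 0) := by
  obtain ⟨C, hC⟩ := hf.2 1
  have h : Tendsto (fun x : ℝ => C * |x|⁻¹) atBot (𝓝 (C * 0)) :=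
    (tendsto_inv_atTop_zero.comp tendsto_abs_atBot_atTop).const_mul C
  rw [mul_zero] at h
  refine squeeze_zero_norm' ?_ h
  filter_upwards [eventually_lt_atBot 0] with x hx
  rw [← div_eq_mul_inv, le_div_iff₀ (abs_pos.2 hx.ne), mul_comm]
  simpa using hC x

/-! ### Hermite functions -/

theorem rapidFun_gaussian : RapidFun (fun x : ℝ => Real.exp (-(x ^ 2) / 2)) := by
  refine ⟨by fun_prop, fun n => ?_⟩
  have even : ∀ (m : ℕ) (x : ℝ), (x ^ 2) ^ m * Real.exp (-(x ^ 2) / 2) ≤ 2 ^ m * m ! := by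
    intro m x
    have h := Real.pow_div_factorial_le_exp (x ^ 2 / 2) (by positivity) m
    rw [div_pow, div_div, div_le_iff₀ (by positivity)] at h
    calc (x ^ 2) ^ m * Real.exp (-(x ^ 2) / 2)
        ≤ Real.exp (x ^ 2 / 2) * (2 ^ m * m !) * Real.exp (-(x ^ 2) / 2) := by gcongr
      _ = (2 ^ m * m !) * (Real.exp (x ^ 2 / 2) * Real.exp (-(x ^ 2) / 2)) := by ring
      _ = 2 ^ m * m ! := by
        rw [← Real.exp_add, show x ^ 2 / 2 + -(x ^ 2) / 2 = 0 by ring, Real.exp_zero, mul_one]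
  refine ⟨1 + 2 ^ n * n !, fun x => ?_⟩
  have h1 : |x| ^ n ≤ 1 + (x ^ 2) ^ n := by
    rw [← sq_abs, ← pow_mul, mul_comm, pow_mul]
    nlinarith [sq_nonneg (|x| ^ n - 1), sq_nonneg (|x| ^ n)]
  have h0 := even 0 x
  rw [Real.norm_eq_abs, abs_of_pos (Real.exp_pos _)]
  calc |x| ^ n * Real.exp (-(x ^ 2) / 2)
      ≤ (1 + (x ^ 2) ^ n) * Real.exp (-(x ^ 2) / 2) := by gcongr
    _ = (x ^ 2) ^ 0 * Real.exp (-(x ^ 2) / 2) + (x ^ 2) ^ n * Real.exp (-(x ^ 2) / 2) := by ring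
    _ ≤ _ := add_le_add (by simpa using h0) (even n x)

theorem derivative_hermite (n : ℕ) : Polynomial.derivative (Polynomial.hermite (n + 1)) =
    ((n : Polynomial ℤ) + 1) * Polynomial.hermite n := by
  induction n with
  | zero => simp [Polynomial.hermite_succ]
  | succ n ih =>
    rw [Polynomial.hermite_succ (n + 1), Polynomial.derivative_sub, Polynomial.derivative_mul, ih,
      Polynomial.derivative_mul, Polynomial.hermite_succ n]
    simp
    ring

/-- `√(k/2)`, the matrix element of the ladder operators. -/
noncomputable def ladder (k : ℕ) : ℝ := Real.sqrt ((k : ℝ) / 2)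

theorem ladder_sq (k : ℕ) : ladder k * ladder k = (k : ℝ) / 2 :=
  Real.mul_self_sqrt (by positivity)

@[simp] theorem ladder_zero : ladder 0 = 0 := by simp [ladder]

theorem ladder_nonneg (k : ℕ) : 0 ≤ ladder k := Real.sqrt_nonneg _

theorem ladder_succ_pos (k : ℕ) : 0 < ladder (k + 1) := Real.sqrt_pos.2 (by positivity)

/-- The three-term recurrence together with the derivative, in raising form.  For `k = 0` the index
`k - 1` is `0`, but the term is multiplied by `ladder 0 = 0`. -/
theorem hermiteFun_succ (k : ℕ) (x : ℝ) :
    2 * ladder (k + 1) * hermiteFun (k + 1) x = 2 * x * hermiteFun k x -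
      2 * ladder k * hermiteFun (k - 1) x ∧
    HasDerivAt (hermiteFun k) (2 * ladder k * hermiteFun (k - 1) x - x * hermiteFun k x) x := by
  have h2 : Real.sqrt 2 * Real.sqrt 2 = 2 := Real.mul_self_sqrt (by norm_num)
  have h2' : Real.sqrt 2 ≠ 0 := by positivity
  have hN : ∀ k : ℕ, (Real.sqrt ((k + 1)! * Real.sqrt Real.pi))⁻¹ * Real.sqrt (k + 1) =
      (Real.sqrt (k ! * Real.sqrt Real.pi))⁻¹ := by
    intro k
    have : 0 < Real.sqrt Real.pi := Real.sqrt_pos.2 Real.pi_pos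
    rw [Nat.factorial_succ, Nat.cast_mul, mul_assoc, Real.sqrt_mul (by positivity), mul_inv]
    push_cast
    have : Real.sqrt ((k : ℝ) + 1) ≠ 0 := by positivity
    field_simp
  have hL : ∀ k : ℕ, ladder (k + 1) * Real.sqrt 2 = Real.sqrt (k + 1) := by
    intro k
    rw [ladder, ← Real.sqrt_mul (by positivity)]
    congr 1; push_cast; ring
  have hsq : ∀ k : ℕ, Real.sqrt ((k : ℝ) + 1) * Real.sqrt (k + 1) = k + 1 := fun k =>
    Real.mul_self_sqrt (by positivity)
  set e := Real.exp (-(x ^ 2) / 2) with he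
  set N : ℕ → ℝ := fun k => (Real.sqrt (k ! * Real.sqrt Real.pi))⁻¹ with hNdef
  set P : ℕ → ℝ := fun k => Polynomial.aeval (Real.sqrt 2 * x) (Polynomial.hermite k) with hP
  have hφ : ∀ k, hermiteFun k x = N k * P k * e := fun k => rfl
  -- the lowering relation for the polynomial factor
  have hlow : ∀ k : ℕ, N k * Polynomial.aeval (Real.sqrt 2 * x)
      (Polynomial.derivative (Polynomial.hermite k)) * e =
        Real.sqrt 2 * ladder k * hermiteFun (k - 1) x := by
    intro k
    cases k with
    | zero => simp
    | succ k =>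
      have h3 : Real.sqrt 2 * ladder (k + 1) = Real.sqrt (k + 1) := by rw [mul_comm, hL]
      have h4 := hsq k
      have h5 : N (k + 1) * Real.sqrt (k + 1) = N k := hN k
      rw [derivative_hermite, map_mul, Nat.add_sub_cancel, hφ, h3, ← h5]
      simp only [map_add, map_natCast, map_one]
      change N (k + 1) * (((k : ℝ) + 1) * P k) * e = _
      linear_combination (-(N (k + 1)) * P k * e) * h4
  constructor
  · have h1 : Real.sqrt (k + 1) * hermiteFun (k + 1) x = Real.sqrt 2 * x * hermiteFun k x -
        Real.sqrt 2 * ladder k * hermiteFun (k - 1) x := by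
      rw [← hlow k, hφ, hφ]
      have : P (k + 1) = Real.sqrt 2 * x * P k - Polynomial.aeval (Real.sqrt 2 * x)
          (Polynomial.derivative (Polynomial.hermite k)) := by
        simp only [hP, Polynomial.hermite_succ, map_sub, map_mul, Polynomial.aeval_X]
      rw [this]
      have h4 : N (k + 1) * Real.sqrt (k + 1) = N k := hN k
      linear_combination ((Real.sqrt 2 * x * P k - Polynomial.aeval (Real.sqrt 2 * x)
          (Polynomial.derivative (Polynomial.hermite k))) * e) * h4
    rw [← hL k] at h1
    have h5 := congrArg (fun t => Real.sqrt 2 * t) h1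
    linear_combination h5 + (-ladder (k + 1) * hermiteFun (k + 1) x + x * hermiteFun k x
      - ladder k * hermiteFun (k - 1) x) * h2
  · have hx : HasDerivAt (fun x : ℝ => Real.sqrt 2 * x) (Real.sqrt 2) x := by
      simpa using (hasDerivAt_id x).const_mul (Real.sqrt 2)
    have h1 := ((Polynomial.hermite k).hasDerivAt_aeval (Real.sqrt 2 * x)).comp x hx
    have h3 : HasDerivAt (fun x : ℝ => Real.exp (-(x ^ 2) / 2)) (e * (-x)) x := by
      have : HasDerivAt (fun x : ℝ => -(x ^ 2) / 2) (-x) x := by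
        have := ((hasDerivAt_pow 2 x).neg).div_const 2
        refine this.congr_deriv ?_
        simp
        ring
      exact this.exp
    have h4 := ((h1.const_mul (N k)).mul h3)
    refine h4.congr_deriv ?_
    rw [hφ k]
    simp only [Function.comp]
    have h5 := hlow k
    linear_combination (Real.sqrt 2) * h5 + (ladder k * hermiteFun (k - 1) x) * h2

theorem mul_hermiteFun (k : ℕ) (x : ℝ) :
    x * hermiteFun k x = ladder (k + 1) * hermiteFun (k + 1) x + ladder k * hermiteFun (k - 1) x := by
  linarith [(hermiteFun_succ k x).1]

theorem hasDerivAt_hermiteFun (k : ℕ) (x : ℝ) : HasDerivAt (hermiteFun k)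
    (ladder k * hermiteFun (k - 1) x - ladder (k + 1) * hermiteFun (k + 1) x) x := by
  refine (hermiteFun_succ k x).2.congr_deriv ?_
  linarith [(hermiteFun_succ k x).1]

theorem rapidFun_hermiteFun (k : ℕ) : RapidFun (hermiteFun k) := by
  have key : ∀ k, RapidFun (hermiteFun k) ∧ RapidFun (hermiteFun (k + 1)) := by
    intro k
    have step : ∀ k, RapidFun (hermiteFun k) → RapidFun (fun x => ladder k * hermiteFun (k - 1) x) →
        RapidFun (hermiteFun (k + 1)) := by
      intro k h1 h2
      have h3 := ((h1.id_mul).add (h2.const_mul (-1))).const_mul (ladder (k + 1))⁻¹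
      have : hermiteFun (k + 1) = fun x => (ladder (k + 1))⁻¹ *
          (x * hermiteFun k x + (-1) * (ladder k * hermiteFun (k - 1) x)) := by
        ext x
        have := (ladder_succ_pos k).ne'
        rw [mul_hermiteFun]
        field_simp
        ring
      rwa [this]
    induction k with
    | zero =>
      have h0 : RapidFun (hermiteFun 0) := by
        have := rapidFun_gaussian.const_mul (Real.sqrt (Real.sqrt Real.pi))⁻¹
        unfold hermiteFun
        simpa using this
      refine ⟨h0, step 0 h0 ?_⟩
      simpa using h0.const_mul 0
    | succ k ih => exact ⟨ih.2, step (k + 1) ih.2 (ih.1.const_mul _)⟩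
  exact (key k).1

theorem continuous_hermiteFun (k : ℕ) : Continuous (hermiteFun k) := (rapidFun_hermiteFun k).1

theorem integral_hermiteFun_zero_sq : ∫ x, hermiteFun 0 x * hermiteFun 0 x = 1 := by
  have h : ∀ x, hermiteFun 0 x * hermiteFun 0 x = (Real.sqrt Real.pi)⁻¹ * Real.exp (-1 * x ^ 2) := by
    intro x
    have : (Real.sqrt (Real.sqrt Real.pi))⁻¹ * (Real.sqrt (Real.sqrt Real.pi))⁻¹ =
        (Real.sqrt Real.pi)⁻¹ := by
      rw [← mul_inv, Real.mul_self_sqrt (Real.sqrt_nonneg _)]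
    have e : Real.exp (-(x ^ 2) / 2) * Real.exp (-(x ^ 2) / 2) = Real.exp (-1 * x ^ 2) := by
      rw [← Real.exp_add]; congr 1; ring
    simp only [hermiteFun, Nat.factorial_zero, Nat.cast_one, one_mul, Polynomial.hermite_zero,
      map_one, mul_one]
    rw [← this, ← e]; ring
  simp_rw [h]
  rw [integral_const_mul, integral_gaussian, div_one]
  exact inv_mul_cancel₀ (Real.sqrt_pos.2 Real.pi_pos).ne'

/-- The raising and lowering operators `y ∓ d/dy` are adjoint to each other. -/
theorem ladder_integral (j k : ℕ) :
    ladder (j + 1) * ∫ x, hermiteFun (j + 1) x * hermiteFun k x =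
      ladder k * ∫ x, hermiteFun j x * hermiteFun (k - 1) x := by
  have I : ∀ j k, Integrable (fun x => hermiteFun j x * hermiteFun k x) := fun j k =>
    ((rapidFun_hermiteFun j).mul (rapidFun_hermiteFun k)).integrable
  have hX : ∀ j k, Integrable (fun x => x * hermiteFun j x * hermiteFun k x) := fun j k =>
    ((rapidFun_hermiteFun j).id_mul.mul (rapidFun_hermiteFun k)).integrable
  have hd : ∀ j x, HasDerivAt (hermiteFun j)
      (x * hermiteFun j x - 2 * ladder (j + 1) * hermiteFun (j + 1) x) x := fun j x => by
    refine (hasDerivAt_hermiteFun j x).congr_deriv ?_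
    rw [mul_hermiteFun]; ring
  have hd' : ∀ j x, HasDerivAt (hermiteFun j)
      (2 * ladder j * hermiteFun (j - 1) x - x * hermiteFun j x) x := fun j x => by
    refine (hasDerivAt_hermiteFun j x).congr_deriv ?_
    rw [mul_hermiteFun]; ring
  have e1 : (hermiteFun j * fun x => 2 * ladder k * hermiteFun (k - 1) x - x * hermiteFun k x) =
      fun x => 2 * ladder k * (hermiteFun j x * hermiteFun (k - 1) x)
        - x * hermiteFun j x * hermiteFun k x := by
    ext x; simp only [Pi.mul_apply]; ring
  have e2 : ((fun x => x * hermiteFun j x - 2 * ladder (j + 1) * hermiteFun (j + 1) x) *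
      hermiteFun k) = fun x => x * hermiteFun j x * hermiteFun k x -
        2 * ladder (j + 1) * (hermiteFun (j + 1) x * hermiteFun k x) := by
    ext x; simp only [Pi.mul_apply]; ring
  have i1 : Integrable (hermiteFun j * fun x => 2 * ladder k * hermiteFun (k - 1) x -
      x * hermiteFun k x) := by
    rw [e1]; exact ((I j (k - 1)).const_mul _).sub (hX j k)
  have i2 : Integrable ((fun x => x * hermiteFun j x - 2 * ladder (j + 1) * hermiteFun (j + 1) x) *
      hermiteFun k) := by
    rw [e2]; exact (hX j k).sub ((I (j + 1) k).const_mul _)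
  have h := integral_mul_deriv_eq_deriv_mul_of_integrable (fun x _ => hd j x) (fun x _ => hd' k x)
    i1 i2 (I j k)
  have h1 : ∫ x, hermiteFun j x * (2 * ladder k * hermiteFun (k - 1) x - x * hermiteFun k x) =
      2 * ladder k * (∫ x, hermiteFun j x * hermiteFun (k - 1) x)
        - ∫ x, x * hermiteFun j x * hermiteFun k x := by
    rw [← integral_const_mul, ← integral_sub ((I j (k - 1)).const_mul _) (hX j k)]
    exact congrArg (fun f => ∫ x, f x) e1
  have h2 : ∫ x, (x * hermiteFun j x - 2 * ladder (j + 1) * hermiteFun (j + 1) x) * hermiteFun k x =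
      (∫ x, x * hermiteFun j x * hermiteFun k x) -
        2 * ladder (j + 1) * ∫ x, hermiteFun (j + 1) x * hermiteFun k x := by
    rw [← integral_const_mul, ← integral_sub (hX j k) ((I (j + 1) k).const_mul _)]
    exact congrArg (fun f => ∫ x, f x) e2
  rw [h1, h2] at h
  linarith

theorem integral_hermiteFun_mul (j k : ℕ) :
    ∫ x, hermiteFun j x * hermiteFun k x = if j = k then 1 else 0 := by
  induction j generalizing k with
  | zero =>
    cases k with
    | zero => simpa using integral_hermiteFun_zero_sq
    | succ k =>
      have h := ladder_integral k 0
      rw [ladder_zero, zero_mul] at h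
      have := (mul_eq_zero.1 h).resolve_left (ladder_succ_pos k).ne'
      simpa [mul_comm] using this
  | succ j ih =>
    have h := ladder_integral j k
    rw [ih] at h
    cases k with
    | zero =>
      rw [ladder_zero, zero_mul] at h
      simpa using (mul_eq_zero.1 h).resolve_left (ladder_succ_pos j).ne'
    | succ k =>
      rw [Nat.add_sub_cancel] at h
      by_cases hjk : j = k
      · subst hjk
        simpa using mul_left_cancel₀ (ladder_succ_pos j).ne' h
      · simp only [hjk, if_false, mul_zero] at h
        simpa [hjk] using (mul_eq_zero.1 h).resolve_left (ladder_succ_pos j).ne'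

/-- From `φ_k(x)² = ∫_{-∞}^x 2 φ_k φ_k'` and the `L²` norms of `φ_k` and `φ_k'`. -/
theorem hermiteFun_sq_le (k : ℕ) (x : ℝ) : hermiteFun k x ^ 2 ≤ 2 * k + 2 := by
  set d : ℝ → ℝ := fun x => ladder k * hermiteFun (k - 1) x - ladder (k + 1) * hermiteFun (k + 1) x
  have I : ∀ j k, Integrable (fun x => hermiteFun j x * hermiteFun k x) := fun j k =>
    ((rapidFun_hermiteFun j).mul (rapidFun_hermiteFun k)).integrable
  have hr : RapidFun d := by
    have := ((rapidFun_hermiteFun (k - 1)).const_mul (ladder k)).add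
      ((rapidFun_hermiteFun (k + 1)).const_mul (-ladder (k + 1)))
    have e : d = fun x => ladder k * hermiteFun (k - 1) x +
        -ladder (k + 1) * hermiteFun (k + 1) x := by ext x; simp only [d]; ring
    rwa [e]
  have hsq : RapidFun (fun x => hermiteFun k x ^ 2) := by
    simpa [sq] using (rapidFun_hermiteFun k).mul (rapidFun_hermiteFun k)
  have hder : ∀ x, HasDerivAt (fun x => hermiteFun k x ^ 2) (2 * (hermiteFun k x * d x)) x := by
    intro x
    refine ((hasDerivAt_hermiteFun k x).pow 2).congr_deriv ?_
    simp only [d]; push_cast; ring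
  have hint : Integrable (fun x => 2 * (hermiteFun k x * d x)) :=
    ((rapidFun_hermiteFun k).mul hr).integrable.const_mul 2
  have h := integral_Iic_of_hasDerivAt_of_tendsto' (a := x) (fun x _ => hder x)
    hint.integrableOn hsq.tendsto_atBot
  rw [sub_zero] at h
  set B : ℝ → ℝ := fun x => hermiteFun k x * hermiteFun k x +
    ((k : ℝ) * (hermiteFun (k - 1) x * hermiteFun (k - 1) x) +
      ((k : ℝ) + 1) * (hermiteFun (k + 1) x * hermiteFun (k + 1) x))
  have hB : Integrable B := (I k k).add (((I (k - 1) (k - 1)).const_mul _).add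
    ((I (k + 1) (k + 1)).const_mul _))
  have hle : ∀ x, 2 * (hermiteFun k x * d x) ≤ B x := by
    intro x
    have h1 := ladder_sq k
    have h2 := ladder_sq (k + 1)
    push_cast at h2
    have h3 : d x ^ 2 ≤ (k : ℝ) * (hermiteFun (k - 1) x * hermiteFun (k - 1) x) +
        ((k : ℝ) + 1) * (hermiteFun (k + 1) x * hermiteFun (k + 1) x) := by
      have h4 : (k : ℝ) = 2 * (ladder k * ladder k) := by linarith
      have h5 : (k : ℝ) + 1 = 2 * (ladder (k + 1) * ladder (k + 1)) := by linarith
      simp only [d]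
      rw [h5, h4]
      nlinarith [sq_nonneg (ladder k * hermiteFun (k - 1) x + ladder (k + 1) * hermiteFun (k + 1) x)]
    have h6 := sq_nonneg (hermiteFun k x - d x)
    simp only [B]
    nlinarith
  have hB0 : ∀ x, 0 ≤ B x := fun x => by
    simp only [B]
    have := mul_self_nonneg (hermiteFun k x)
    have := mul_self_nonneg (hermiteFun (k - 1) x)
    have := mul_self_nonneg (hermiteFun (k + 1) x)
    positivity
  calc hermiteFun k x ^ 2 = ∫ y in Set.Iic x, 2 * (hermiteFun k y * d y) := h.symm
    _ ≤ ∫ y in Set.Iic x, B y := setIntegral_mono hint.integrableOn hB.integrableOn hle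
    _ ≤ ∫ y, B y := setIntegral_le_integral hB (ae_of_all _ hB0)
    _ = 2 * k + 2 := by
      have i1 := (I (k - 1) (k - 1)).const_mul (k : ℝ)
      have i2 := (I (k + 1) (k + 1)).const_mul ((k : ℝ) + 1)
      have i3 : Integrable (fun x => (k : ℝ) * (hermiteFun (k - 1) x * hermiteFun (k - 1) x) +
        ((k : ℝ) + 1) * (hermiteFun (k + 1) x * hermiteFun (k + 1) x)) := i1.add i2
      simp only [B]
      rw [integral_add (I k k) i3, integral_add i1 i2, integral_const_mul,
        integral_const_mul]
      simp only [integral_hermiteFun_mul, if_true]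
      ring

theorem abs_hermiteFun_le (k : ℕ) (x : ℝ) : |hermiteFun k x| ≤ 2 * ((k : ℝ) + 1) := by
  have h := hermiteFun_sq_le k x
  have hk : (0 : ℝ) ≤ k := k.cast_nonneg
  refine abs_le_of_sq_le_sq ?_ (by positivity)
  nlinarith

theorem hermiteFun_neg (k : ℕ) (x : ℝ) : hermiteFun k (-x) = (-1) ^ k * hermiteFun k x := by
  have key : ∀ k, hermiteFun k (-x) = (-1) ^ k * hermiteFun k x ∧
      hermiteFun (k + 1) (-x) = (-1) ^ (k + 1) * hermiteFun (k + 1) x := by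
    intro k
    have step : ∀ k, hermiteFun k (-x) = (-1) ^ k * hermiteFun k x →
        ladder k * hermiteFun (k - 1) (-x) = (-1) ^ (k + 1) * (ladder k * hermiteFun (k - 1) x) →
        hermiteFun (k + 1) (-x) = (-1) ^ (k + 1) * hermiteFun (k + 1) x := by
      intro k h1 h2
      have h3 := mul_hermiteFun k x
      have h4 := mul_hermiteFun k (-x)
      refine mul_left_cancel₀ (ladder_succ_pos k).ne' ?_
      rw [h1] at h4
      linear_combination -h4 + (-1) ^ (k + 1) * h3 - h2
    induction k with
    | zero =>
      have h0 : hermiteFun 0 (-x) = (-1) ^ 0 * hermiteFun 0 x := by simp [hermiteFun]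
      exact ⟨h0, step 0 h0 (by simp)⟩
    | succ k ih =>
      refine ⟨ih.2, step (k + 1) ih.2 ?_⟩
      rw [Nat.add_sub_cancel, ih.1]; ring
  exact (key k).1

/-! ### Completeness of the Hermite functions -/

/-- A bounded continuous function orthogonal to all Hermite functions vanishes: all moments of
`D * exp (-x² / 2)` are zero, so its Fourier transform vanishes. -/
theorem eq_zero_of_orthogonal {D : ℝ → ℂ} (hD : Continuous D) {C : ℝ} (hC : ∀ x, ‖D x‖ ≤ C)
    (h : ∀ k, ∫ x, D x * (hermiteFun k x : ℂ) = 0) : D = 0 := by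
  have hrap : ∀ n k, RapidFun (fun x : ℝ => (x : ℂ) ^ n * (hermiteFun k x : ℂ)) := by
    intro n k
    induction n with
    | zero => simpa using (rapidFun_hermiteFun k).ofReal
    | succ n ih =>
      have := ih.id_mul_complex
      refine (by ext x; ring : (fun x : ℝ => (x : ℂ) ^ (n + 1) * (hermiteFun k x : ℂ)) =
        fun x : ℝ => (x : ℂ) * ((x : ℂ) ^ n * (hermiteFun k x : ℂ))) ▸ this
  have hint : ∀ n k, Integrable (fun x : ℝ => D x * ((x : ℂ) ^ n * (hermiteFun k x : ℂ))) :=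
    fun n k => (RapidFun.bounded_mul hD hC (hrap n k)).integrable
  -- all moments vanish, by the three-term recurrence
  have hmom : ∀ n k, ∫ x : ℝ, D x * ((x : ℂ) ^ n * (hermiteFun k x : ℂ)) = 0 := by
    intro n
    induction n with
    | zero => simpa using h
    | succ n ih =>
      intro k
      have e : ∀ x : ℝ, D x * ((x : ℂ) ^ (n + 1) * (hermiteFun k x : ℂ)) =
          (ladder (k + 1) : ℂ) * (D x * ((x : ℂ) ^ n * (hermiteFun (k + 1) x : ℂ))) +
          (ladder k : ℂ) * (D x * ((x : ℂ) ^ n * (hermiteFun (k - 1) x : ℂ))) := by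
        intro x
        have := mul_hermiteFun k x
        have : (x : ℂ) * hermiteFun k x = ladder (k + 1) * hermiteFun (k + 1) x +
          ladder k * hermiteFun (k - 1) x := by exact_mod_cast this
        linear_combination (D x * (x : ℂ) ^ n) * this
      simp_rw [e]
      rw [integral_add ((hint _ _).const_mul _) ((hint _ _).const_mul _), integral_const_mul,
        integral_const_mul, ih, ih]
      simp
  set f : ℝ → ℂ := fun x => D x * (hermiteFun 0 x : ℂ) with hf
  have hfc : Continuous f := hD.mul (Complex.continuous_ofReal.comp (continuous_hermiteFun 0))
  have hfi : Integrable f := by simpa using hint 0 0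
  have hφ0 : ∀ x, hermiteFun 0 x = (Real.sqrt (Real.sqrt Real.pi))⁻¹ * Real.exp (-(x ^ 2) / 2) := by
    intro x; simp [hermiteFun]
  have hφpos : ∀ x, 0 < hermiteFun 0 x := fun x => by
    rw [hφ0]
    have := Real.pi_pos
    positivity
  have hexp : ∀ c : ℝ, Integrable (fun x => hermiteFun 0 x * Real.exp (c * x)) := by
    intro c
    have h1 := integrable_exp_neg_mul_sq (b := 1 / 2) (by norm_num)
    have h2 := ((h1.comp_sub_right c).const_mul
      ((Real.sqrt (Real.sqrt Real.pi))⁻¹ * Real.exp (c ^ 2 / 2)))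
    refine h2.congr (ae_of_all _ fun x => ?_)
    simp only
    rw [hφ0, mul_assoc, mul_assoc, ← Real.exp_add, ← Real.exp_add]
    congr 2
    ring
  -- the exponential series may be integrated term by term against `D φ_0`
  have hF : FourierTransform.fourier f = 0 := by
    ext w
    rw [Real.fourier_real_eq_integral_exp_smul]
    have hs : ∀ v : ℝ, HasSum (fun n : ℕ => ((((-2 * Real.pi * w : ℝ) : ℂ) * Complex.I) ^ n / (n ! : ℂ)) *
        (D v * ((v : ℂ) ^ n * (hermiteFun 0 v : ℂ))))
        (Complex.exp (((-2 * Real.pi * v * w : ℝ) : ℂ) * Complex.I) • f v) := by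
      intro v
      have := (NormedSpace.expSeries_div_hasSum_exp (((-2 * Real.pi * v * w : ℝ) : ℂ) * Complex.I)).mul_right (f v)
      rw [← Complex.exp_eq_exp_ℂ] at this
      refine this.congr_fun ?_
      intro n
      simp only [hf]
      push_cast
      ring
    have hsum := hasSum_integral_of_dominated_convergence (μ := volume)
      (fun (n : ℕ) (v : ℝ) => (|2 * Real.pi * w| * |v|) ^ n / (n ! : ℝ) * (C * hermiteFun 0 v))
      (F := fun (n : ℕ) (v : ℝ) => ((((-2 * Real.pi * w : ℝ) : ℂ) * Complex.I) ^ n / (n ! : ℂ)) *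
        (D v * ((v : ℂ) ^ n * (hermiteFun 0 v : ℂ))))
      (f := fun v : ℝ => Complex.exp (((-2 * Real.pi * v * w : ℝ) : ℂ) * Complex.I) • f v)
      (fun n => ((hint n 0).const_mul _).aestronglyMeasurable)
      (fun n => ae_of_all _ fun v => ?_)
      (ae_of_all _ fun v => (Real.summable_pow_div_factorial _).mul_right _) ?_
      (ae_of_all _ hs)
    · have h0 : ∀ n : ℕ, ∫ v : ℝ, ((((-2 * Real.pi * w : ℝ) : ℂ) * Complex.I) ^ n / (n ! : ℂ)) *
          (D v * ((v : ℂ) ^ n * (hermiteFun 0 v : ℂ))) = 0 := by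
        intro n
        rw [integral_const_mul, hmom n 0, mul_zero]
      simp_rw [h0] at hsum
      exact hsum.unique hasSum_zero
    · have e : ‖(((-2 * Real.pi * w : ℝ) : ℂ) * Complex.I)‖ = |2 * Real.pi * w| := by
        rw [norm_mul, Complex.norm_I, mul_one, Complex.norm_real, Real.norm_eq_abs,
          show -2 * Real.pi * w = -(2 * Real.pi * w) by ring, abs_neg]
      simp only [norm_mul, norm_div, norm_pow, RCLike.norm_natCast, Complex.norm_real,
        Real.norm_eq_abs] at e ⊢
      rw [e, abs_of_pos (hφpos v), mul_pow]
      have h1 := hC v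
      calc |2 * Real.pi * w| ^ n / (n ! : ℝ) * (‖D v‖ * (|v| ^ n * hermiteFun 0 v))
          ≤ |2 * Real.pi * w| ^ n / (n ! : ℝ) * (C * (|v| ^ n * hermiteFun 0 v)) := by
            have := (hφpos v).le
            gcongr
        _ = _ := by ring
    · have e : ∀ v : ℝ, ∑' n : ℕ, (|2 * Real.pi * w| * |v|) ^ n / (n ! : ℝ) * (C * hermiteFun 0 v)
          = Real.exp (|2 * Real.pi * w| * |v|) * (C * hermiteFun 0 v) := by
        intro v
        rw [tsum_mul_right, Real.exp_eq_exp_ℝ, NormedSpace.exp_eq_tsum_div]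
      simp_rw [e]
      set c := |2 * Real.pi * w|
      have hc : 0 ≤ c := abs_nonneg _
      have C0 : 0 ≤ C := (norm_nonneg _).trans (hC 0)
      have hb := ((hexp c).add (hexp (-c))).const_mul C
      refine hb.mono' ?_ (ae_of_all _ fun v => ?_)
      · refine Continuous.aestronglyMeasurable ?_
        have := continuous_hermiteFun 0
        fun_prop
      · have h1 : Real.exp (c * |v|) ≤ Real.exp (c * v) + Real.exp (-c * v) := by
          rcases abs_cases v with ⟨h, _⟩ | ⟨h, _⟩ <;> rw [h]
          · linarith [Real.exp_pos (-c * v)]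
          · rw [mul_neg, ← neg_mul]; linarith [Real.exp_pos (c * v)]
        have h2 := (hφpos v).le
        rw [Real.norm_eq_abs, abs_of_nonneg (by positivity)]
        calc Real.exp (c * |v|) * (C * hermiteFun 0 v)
            ≤ (Real.exp (c * v) + Real.exp (-c * v)) * (C * hermiteFun 0 v) := by gcongr
          _ = _ := by simp only [Pi.add_apply]; ring
  have hinv := Continuous.fourierInv_fourier_eq hfc hfi (by rw [hF]; exact integrable_zero _ _ _)
  rw [hF] at hinv
  have hf0 : f = 0 := by
    rw [← hinv]
    ext w
    rw [Real.fourierInv_eq']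
    simp
  ext x
  have := congrFun hf0 x
  simp only [hf, Pi.zero_apply, mul_eq_zero, Complex.ofReal_eq_zero] at this
  exact this.resolve_right (hφpos x).ne'

/-! ### Rapidly decreasing sequences of functions of `s` -/

/-- The graph of termwise differentiation of sequences of functions of `s`. -/
def seqDeriv : Unit → Submodule ℂ ((ℕ → ℝ → ℂ) × (ℕ → ℝ → ℂ)) := fun _ =>
  { carrier := {p | ∀ k s, HasDerivAt (p.1 k) (p.2 k s) s}
    zero_mem' := fun _ s => hasDerivAt_const s 0
    add_mem' := fun h h' k s => (h k s).add (h' k s)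
    smul_mem' := fun c _ h k s => (h k s).const_smul c }

/-- Sequences of functions of `s` decreasing rapidly in the index, uniformly in `s`. -/
def rapidBound : Submodule ℂ (ℕ → ℝ → ℂ) where
  carrier := {b | ∀ N : ℕ, ∃ C : ℝ, ∀ (k : ℕ) (s : ℝ), ((k : ℝ) + 1) ^ N * ‖b k s‖ ≤ C}
  zero_mem' := fun N => ⟨0, fun k s => by simp⟩
  add_mem' := by
    intro b c hb hc N
    obtain ⟨C, hC⟩ := hb N
    obtain ⟨D, hD⟩ := hc N
    refine ⟨C + D, fun k s => ?_⟩
    calc ((k : ℝ) + 1) ^ N * ‖(b + c) k s‖ ≤ ((k : ℝ) + 1) ^ N * (‖b k s‖ + ‖c k s‖) := by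
          gcongr; exact norm_add_le _ _
      _ ≤ C + D := by rw [mul_add]; exact add_le_add (hC k s) (hD k s)
  smul_mem' := by
    intro c b hb N
    obtain ⟨C, hC⟩ := hb N
    refine ⟨‖c‖ * C, fun k s => ?_⟩
    calc ((k : ℝ) + 1) ^ N * ‖(c • b) k s‖ = ‖c‖ * (((k : ℝ) + 1) ^ N * ‖b k s‖) := by
          simp only [Pi.smul_apply, smul_eq_mul, norm_mul]; ring
      _ ≤ ‖c‖ * C := by gcongr; exact hC k s

/-- Sequences of smooth functions of `s`, rapidly decreasing in the index together with all their
derivatives, uniformly in `s ∈ ℝ`. -/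
def rapidSeq : Submodule ℂ (ℕ → ℝ → ℂ) := jet rapidBound seqDeriv

theorem rapidSeq_bound {b : ℕ → ℝ → ℂ} (hb : b ∈ rapidSeq) (N : ℕ) :
    ∃ C : ℝ, ∀ (k : ℕ) (s : ℝ), ((k : ℝ) + 1) ^ N * ‖b k s‖ ≤ C := jet_le hb N

theorem rapidSeq_deriv {b : ℕ → ℝ → ℂ} (hb : b ∈ rapidSeq) :
    ∃ b' ∈ rapidSeq, ∀ k s, HasDerivAt (b k) (b' k s) s := exists_jet_derivative hb ()

theorem subset_rapidSeq (S : Set (ℕ → ℝ → ℂ)) (hb : ∀ F ∈ S, F ∈ rapidBound)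
    (h : ∀ F ∈ S, ∃ G ∈ Submodule.span ℂ S ⊔ rapidSeq, ∀ k s, HasDerivAt (F k) (G k s) s) :
    ∀ F ∈ S, F ∈ rapidSeq :=
  subset_jet S hb fun F hF _ => h F hF

/-- A reindexing that divides the index by at most two, together with a weight of polynomial growth. -/
theorem reindex_mem_rapidSeq {b : ℕ → ℝ → ℂ} (hb : b ∈ rapidSeq) {m : ℕ → ℂ} {C : ℝ} {M : ℕ}
    (hm : ∀ k, ‖m k‖ ≤ C * ((k : ℝ) + 1) ^ M) {σ : ℕ → ℕ}
    (hσ : ∀ k : ℕ, (k : ℝ) + 1 ≤ 2 * ((σ k : ℝ) + 1)) :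
    (fun k s => m k * b (σ k) s) ∈ rapidSeq := by
  refine subset_rapidSeq {c | ∃ b ∈ rapidSeq, c = fun k s => m k * b (σ k) s} ?_ ?_ _ ⟨b, hb, rfl⟩
  · rintro _ ⟨b, hb, rfl⟩ N
    obtain ⟨D, hD⟩ := rapidSeq_bound hb (N + M)
    refine ⟨C * 2 ^ (N + M) * D, fun k s => ?_⟩
    have hC : 0 ≤ C := by
      have := (norm_nonneg _).trans (hm 0)
      simpa using this
    calc ((k : ℝ) + 1) ^ N * ‖m k * b (σ k) s‖
        ≤ ((k : ℝ) + 1) ^ N * ((C * ((k : ℝ) + 1) ^ M) * ‖b (σ k) s‖) := by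
          rw [norm_mul]; gcongr; exact hm k
      _ = C * (((k : ℝ) + 1) ^ (N + M) * ‖b (σ k) s‖) := by ring
      _ ≤ C * ((2 * ((σ k : ℝ) + 1)) ^ (N + M) * ‖b (σ k) s‖) := by gcongr; exact hσ k
      _ = C * 2 ^ (N + M) * (((σ k : ℝ) + 1) ^ (N + M) * ‖b (σ k) s‖) := by
          rw [mul_pow]; ring
      _ ≤ C * 2 ^ (N + M) * D := by gcongr; exact hD _ _
  · rintro _ ⟨b, hb, rfl⟩
    obtain ⟨b', hb', h⟩ := rapidSeq_deriv hb
    exact ⟨_, Submodule.mem_sup_left (Submodule.subset_span ⟨b', hb', rfl⟩),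
      fun k s => (h (σ k) s).const_mul _⟩

theorem weight_mem_rapidSeq {b : ℕ → ℝ → ℂ} (hb : b ∈ rapidSeq) {m : ℕ → ℂ} {C : ℝ} {M : ℕ}
    (hm : ∀ k, ‖m k‖ ≤ C * ((k : ℝ) + 1) ^ M) : (fun k s => m k * b k s) ∈ rapidSeq :=
  reindex_mem_rapidSeq hb hm (σ := id) fun k => by
    simp only [id]; linarith [(k.cast_nonneg : (0 : ℝ) ≤ k)]

theorem temperate_mul_mem_rapidSeq {b : ℕ → ℝ → ℂ} (hb : b ∈ rapidSeq) {f : ℝ → ℂ}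
    (hf : (fun s _ => f s) ∈ temperateFamily) : (fun k s => f s * b k s) ∈ rapidSeq := by
  refine subset_rapidSeq {c | ∃ f : ℝ → ℂ, (fun s _ => f s) ∈ temperateFamily ∧ ∃ b ∈ rapidSeq,
    c = fun k s => f s * b k s} ?_ ?_ _ ⟨f, hf, b, hb, rfl⟩
  · rintro _ ⟨f, hf, b, hb, rfl⟩ N
    obtain ⟨D, hD⟩ := rapidSeq_bound hb N
    obtain ⟨-, C, M, hC⟩ := jet_le hf
    have hC' : ∀ s, ‖f s‖ ≤ C := fun s => by simpa using hC s 0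
    refine ⟨C * D, fun k s => ?_⟩
    have h0 : 0 ≤ C := (norm_nonneg _).trans (hC' 0)
    calc ((k : ℝ) + 1) ^ N * ‖f s * b k s‖ ≤ ((k : ℝ) + 1) ^ N * (C * ‖b k s‖) := by
          rw [norm_mul]; gcongr; exact hC' s
      _ = C * (((k : ℝ) + 1) ^ N * ‖b k s‖) := by ring
      _ ≤ C * D := by gcongr; exact hD k s
  · rintro _ ⟨f, hf, b, hb, rfl⟩
    obtain ⟨b', hb', h⟩ := rapidSeq_deriv hb
    refine ⟨_, add_mem (Submodule.mem_sup_left (Submodule.subset_span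
      ⟨deriv f, dS_mem_jet hf, b, hb, rfl⟩))
      (Submodule.mem_sup_left (Submodule.subset_span ⟨f, hf, b', hb', rfl⟩)),
      fun k s => (hasDerivAt_dS hf s 0).mul (h k s)⟩

/-- Multiplication by the phases `e^{i σ (k + 1/2) β(s)}`. -/
theorem phase_mul_mem_rapidSeq {b : ℕ → ℝ → ℂ} (hb : b ∈ rapidSeq) {β β' : ℝ → ℝ}
    (hβ : ∀ s, HasDerivAt β (β' s) s) (hβ' : (fun s _ => (β' s : ℂ)) ∈ temperateFamily) (σ : ℝ) :
    (fun (k : ℕ) s => Complex.exp (Complex.I * (σ * ((1 / 2 + (k : ℝ)) * β s) : ℝ)) * b k s)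
      ∈ rapidSeq := by
  refine subset_rapidSeq {c | ∃ b ∈ rapidSeq, c = fun (k : ℕ) s =>
    Complex.exp (Complex.I * (σ * ((1 / 2 + (k : ℝ)) * β s) : ℝ)) * b k s} ?_ ?_ _ ⟨b, hb, rfl⟩
  · rintro _ ⟨b, hb, rfl⟩ N
    obtain ⟨D, hD⟩ := rapidSeq_bound hb N
    refine ⟨D, fun k s => ?_⟩
    rw [norm_mul, mul_comm Complex.I, Complex.norm_exp_ofReal_mul_I, one_mul]
    exact hD k s
  · rintro _ ⟨b, hb, rfl⟩
    obtain ⟨b', hb', h⟩ := rapidSeq_deriv hb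
    have h1 := weight_mem_rapidSeq (temperate_mul_mem_rapidSeq hb hβ')
      (m := fun k : ℕ => Complex.I * (σ * (1 / 2 + (k : ℝ)) : ℝ)) (C := |σ|) (M := 1) (fun k => by
        rw [norm_mul, Complex.norm_I, one_mul, Complex.norm_real, Real.norm_eq_abs, abs_mul, pow_one,
          abs_of_nonneg (by positivity : (0 : ℝ) ≤ 1 / 2 + k)]
        refine mul_le_mul_of_nonneg_left ?_ (abs_nonneg σ)
        linarith [(k.cast_nonneg : (0 : ℝ) ≤ k)])
    refine ⟨_, Submodule.mem_sup_left (Submodule.subset_span ⟨_, add_mem h1 hb', rfl⟩),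
      fun k s => ?_⟩
    have h2 : HasDerivAt (fun s => Complex.exp (Complex.I * (σ * ((1 / 2 + (k : ℝ)) * β s) : ℝ)))
        _ s := (((((hβ s).const_mul (1 / 2 + (k : ℝ))).const_mul σ).ofReal_comp).const_mul
          Complex.I).cexp
    refine (h2.mul (h k s)).congr_deriv ?_
    simp only [Pi.add_apply]
    push_cast
    ring

theorem single_mem_rapidSeq (k₀ : ℕ) : (fun k (_ : ℝ) => if k = k₀ then (1 : ℂ) else 0) ∈ rapidSeq := by
  refine subset_rapidSeq {fun k (_ : ℝ) => if k = k₀ then (1 : ℂ) else 0} ?_ ?_ _ rfl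
  · rintro _ rfl N
    refine ⟨((k₀ : ℝ) + 1) ^ N, fun k s => ?_⟩
    by_cases h : k = k₀
    · simp [h]
    · simp only [h, if_false, norm_zero, mul_zero]; positivity
  · rintro _ rfl
    exact ⟨0, zero_mem _, fun k s => hasDerivAt_const _ _⟩

/-! ### Hermite series -/

/-- The Hermite series `∑ b_k(s) φ_k(y)`. -/
noncomputable def hermiteSum (b : ℕ → ℝ → ℂ) : ℝ → ℝ → ℂ :=
  fun s y => ∑' k, b k s * (hermiteFun k y : ℂ)

/-- The coefficient sequence of `∑ b_k √(k/2) φ_{k-1}`. -/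
noncomputable def lowerSeq (b : ℕ → ℝ → ℂ) : ℕ → ℝ → ℂ := fun k s => (ladder (k + 1) : ℂ) * b (k + 1) s

/-- The coefficient sequence of `∑ b_k √((k+1)/2) φ_{k+1}`; its entry at `0` vanishes since
`ladder 0 = 0`. -/
noncomputable def raiseSeq (b : ℕ → ℝ → ℂ) : ℕ → ℝ → ℂ := fun k s => (ladder k : ℂ) * b (k - 1) s

theorem ladder_le (k : ℕ) : ladder k ≤ (k : ℝ) + 1 := by
  have hk : (0 : ℝ) ≤ k := k.cast_nonneg
  refine Real.sqrt_le_iff.2 ⟨by positivity, ?_⟩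
  nlinarith

theorem lowerSeq_mem {b : ℕ → ℝ → ℂ} (hb : b ∈ rapidSeq) : lowerSeq b ∈ rapidSeq := by
  refine reindex_mem_rapidSeq hb (m := fun k => (ladder (k + 1) : ℂ)) (σ := fun k => k + 1)
    (C := 2) (M := 1) (fun k => ?_) fun k => ?_
  · rw [Complex.norm_real, Real.norm_eq_abs, abs_of_nonneg (ladder_nonneg _)]
    have := ladder_le (k + 1)
    have hk : (0 : ℝ) ≤ k := k.cast_nonneg
    push_cast at this
    linarith
  · have hk : (0 : ℝ) ≤ k := k.cast_nonneg
    push_cast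
    linarith

theorem raiseSeq_mem {b : ℕ → ℝ → ℂ} (hb : b ∈ rapidSeq) : raiseSeq b ∈ rapidSeq := by
  refine reindex_mem_rapidSeq hb (m := fun k => (ladder k : ℂ)) (σ := fun k => k - 1)
    (C := 1) (M := 1) (fun k => ?_) fun k => ?_
  · rw [Complex.norm_real, Real.norm_eq_abs, abs_of_nonneg (ladder_nonneg _)]
    simpa using ladder_le k
  · cases k with
    | zero => simp
    | succ k =>
      have hk : (0 : ℝ) ≤ k := k.cast_nonneg
      rw [Nat.add_sub_cancel]
      push_cast
      linarith

theorem summable_inv_sq : Summable (fun k : ℕ => (1 : ℝ) / ((k : ℝ) + 1) ^ 2) := by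
  have := (summable_nat_add_iff (f := fun k : ℕ => (1 : ℝ) / (k : ℝ) ^ 2) 1).2
    (Real.summable_one_div_nat_pow.2 one_lt_two)
  simpa using this

theorem hermite_term_bound {b : ℕ → ℝ → ℂ} (hb : b ∈ rapidSeq) :
    ∃ C, ∀ k s y, ‖b k s * (hermiteFun k y : ℂ)‖ ≤ C * (1 / ((k : ℝ) + 1) ^ 2) := by
  obtain ⟨C, hC⟩ := rapidSeq_bound hb 3
  refine ⟨2 * C, fun k s y => ?_⟩
  rw [mul_one_div, le_div_iff₀ (by positivity), norm_mul, Complex.norm_real, Real.norm_eq_abs]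
  calc ‖b k s‖ * |hermiteFun k y| * ((k : ℝ) + 1) ^ 2
      ≤ ‖b k s‖ * (2 * ((k : ℝ) + 1)) * ((k : ℝ) + 1) ^ 2 := by
        gcongr; exact abs_hermiteFun_le k y
    _ = 2 * (((k : ℝ) + 1) ^ 3 * ‖b k s‖) := by ring
    _ ≤ 2 * C := by gcongr; exact hC k s

theorem summable_hermite {b : ℕ → ℝ → ℂ} (hb : b ∈ rapidSeq) (s y : ℝ) :
    Summable (fun k => b k s * (hermiteFun k y : ℂ)) := by
  obtain ⟨C, hC⟩ := hermite_term_bound hb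
  exact Summable.of_norm_bounded (summable_inv_sq.mul_left C) fun k => hC k s y

theorem hermiteSum_bound {b : ℕ → ℝ → ℂ} (hb : b ∈ rapidSeq) :
    ∃ C, ∀ s y, ‖hermiteSum b s y‖ ≤ C := by
  obtain ⟨C, hC⟩ := hermite_term_bound hb
  exact ⟨_, fun s y => tsum_of_norm_bounded (summable_inv_sq.mul_left C).hasSum fun k => hC k s y⟩

theorem hermiteSum_continuous {b : ℕ → ℝ → ℂ} (hb : b ∈ rapidSeq) :
    Continuous (fun z : ℝ × ℝ => hermiteSum b z.1 z.2) := by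
  obtain ⟨C, hC⟩ := hermite_term_bound hb
  obtain ⟨b', -, h⟩ := rapidSeq_deriv hb
  refine continuous_tsum (fun k => ?_) (summable_inv_sq.mul_left C) fun k z => hC k z.1 z.2
  have h1 : Continuous (b k) := continuous_iff_continuousAt.2 fun s => (h k s).continuousAt
  exact (h1.comp continuous_fst).mul
    (Complex.continuous_ofReal.comp ((continuous_hermiteFun k).comp continuous_snd))

theorem hermiteSum_add {b c : ℕ → ℝ → ℂ} (hb : b ∈ rapidSeq) (hc : c ∈ rapidSeq) (s y : ℝ) :
    hermiteSum (b + c) s y = hermiteSum b s y + hermiteSum c s y := by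
  unfold hermiteSum
  rw [← (summable_hermite hb s y).tsum_add (summable_hermite hc s y)]
  simp only [Pi.add_apply, add_mul]

theorem hermiteSum_smul {b : ℕ → ℝ → ℂ} (z : ℂ) (s y : ℝ) :
    hermiteSum (z • b) s y = z * hermiteSum b s y := by
  unfold hermiteSum
  rw [← tsum_mul_left]
  simp only [Pi.smul_apply, smul_eq_mul, mul_assoc]

theorem hasSum_lower {b : ℕ → ℝ → ℂ} (hb : b ∈ rapidSeq) (s y : ℝ) :
    HasSum (fun k => b k s * ((ladder k * hermiteFun (k - 1) y : ℝ) : ℂ))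
      (hermiteSum (lowerSeq b) s y) := by
  have h := (summable_hermite (lowerSeq_mem hb) s y).hasSum
  rw [← hasSum_nat_add_iff' 1]
  simp only [Finset.range_one, Finset.sum_singleton, ladder_zero, zero_mul, Complex.ofReal_zero,
    mul_zero, sub_zero, Nat.add_sub_cancel]
  refine h.congr_fun ?_
  intro k
  simp only [lowerSeq]
  push_cast
  ring

theorem hasSum_raise {b : ℕ → ℝ → ℂ} (hb : b ∈ rapidSeq) (s y : ℝ) :
    HasSum (fun k => b k s * ((ladder (k + 1) * hermiteFun (k + 1) y : ℝ) : ℂ))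
      (hermiteSum (raiseSeq b) s y) := by
  have h := (summable_hermite (raiseSeq_mem hb) s y).hasSum
  rw [← hasSum_nat_add_iff' 1] at h
  simp only [Finset.range_one, Finset.sum_singleton, raiseSeq, ladder_zero, zero_mul,
    Complex.ofReal_zero, sub_zero, Nat.add_sub_cancel] at h
  refine h.congr_fun ?_
  intro k
  push_cast
  ring

theorem mul_hermiteSum {b : ℕ → ℝ → ℂ} (hb : b ∈ rapidSeq) (s y : ℝ) :
    (y : ℂ) * hermiteSum b s y = hermiteSum (lowerSeq b + raiseSeq b) s y := by
  rw [hermiteSum_add (lowerSeq_mem hb) (raiseSeq_mem hb)]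
  refine (((summable_hermite hb s y).hasSum.mul_left (y : ℂ)).congr_fun ?_).unique
    ((hasSum_lower hb s y).add (hasSum_raise hb s y))
  intro k
  have : (y : ℂ) * hermiteFun k y = ladder (k + 1) * hermiteFun (k + 1) y +
    ladder k * hermiteFun (k - 1) y := by exact_mod_cast mul_hermiteFun k y
  push_cast
  linear_combination (-b k s) * this

theorem hasDerivAt_hermiteSum_s {b b' : ℕ → ℝ → ℂ} (hb : b ∈ rapidSeq) (hb' : b' ∈ rapidSeq)
    (h : ∀ k s, HasDerivAt (b k) (b' k s) s) (s y : ℝ) :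
    HasDerivAt (fun t => hermiteSum b t y) (hermiteSum b' s y) s := by
  obtain ⟨C, hC⟩ := hermite_term_bound hb'
  exact hasDerivAt_tsum (summable_inv_sq.mul_left C) (fun k t => (h k t).mul_const _)
    (fun k t => hC k t y) (summable_hermite hb s y) s

theorem hasDerivAt_hermiteSum_y {b : ℕ → ℝ → ℂ} (hb : b ∈ rapidSeq) (s y : ℝ) :
    HasDerivAt (fun z => hermiteSum b s z)
      (hermiteSum (lowerSeq b + (-1 : ℂ) • raiseSeq b) s y) y := by
  obtain ⟨C, hC⟩ := rapidSeq_bound hb 4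
  have hsum : hermiteSum (lowerSeq b + (-1 : ℂ) • raiseSeq b) s y = ∑' k, b k s *
      ((ladder k * hermiteFun (k - 1) y - ladder (k + 1) * hermiteFun (k + 1) y : ℝ) : ℂ) := by
    rw [hermiteSum_add (lowerSeq_mem hb) (rapidSeq.smul_mem _ (raiseSeq_mem hb)), hermiteSum_smul]
    refine (((hasSum_lower hb s y).add ((hasSum_raise hb s y).mul_left (-1))).congr_fun ?_).tsum_eq.symm
    intro k
    push_cast
    ring
  rw [hsum]
  refine hasDerivAt_tsum (u := fun k : ℕ => 10 * C * (1 / ((k : ℝ) + 1) ^ 2))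
    (summable_inv_sq.mul_left _)
    (fun k z => ((hasDerivAt_hermiteFun k z).ofReal_comp).const_mul _) (fun k z => ?_)
    (summable_hermite hb s y) y
  have hk : (0 : ℝ) ≤ k := k.cast_nonneg
  have h1 : |ladder k * hermiteFun (k - 1) z - ladder (k + 1) * hermiteFun (k + 1) z| ≤
      10 * ((k : ℝ) + 1) ^ 2 := by
    have a1 := abs_hermiteFun_le (k - 1) z
    have a2 := abs_hermiteFun_le (k + 1) z
    have a3 : ((k - 1 : ℕ) : ℝ) ≤ k := by exact_mod_cast Nat.sub_le k 1
    push_cast at a2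
    have l1 := ladder_le k
    have l2 := ladder_le (k + 1)
    push_cast at l2
    calc |ladder k * hermiteFun (k - 1) z - ladder (k + 1) * hermiteFun (k + 1) z|
        ≤ ladder k * |hermiteFun (k - 1) z| + ladder (k + 1) * |hermiteFun (k + 1) z| := by
          refine (abs_sub _ _).trans ?_
          rw [abs_mul, abs_mul, abs_of_nonneg (ladder_nonneg _), abs_of_nonneg (ladder_nonneg _)]
      _ ≤ ((k : ℝ) + 1) * (2 * ((k : ℝ) + 1)) + ((k : ℝ) + 1 + 1) * (2 * ((k : ℝ) + 1 + 1)) := by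
          gcongr
          · linarith
      _ ≤ _ := by nlinarith
  rw [mul_one_div, le_div_iff₀ (by positivity), norm_mul, Complex.norm_real, Real.norm_eq_abs]
  calc ‖b k s‖ * |ladder k * hermiteFun (k - 1) z - ladder (k + 1) * hermiteFun (k + 1) z| *
        ((k : ℝ) + 1) ^ 2 ≤ ‖b k s‖ * (10 * ((k : ℝ) + 1) ^ 2) * ((k : ℝ) + 1) ^ 2 := by gcongr
    _ = 10 * (((k : ℝ) + 1) ^ 4 * ‖b k s‖) := by ring
    _ ≤ 10 * C := by gcongr; exact hC k s

theorem hermiteSum_mem {b : ℕ → ℝ → ℂ} (hb : b ∈ rapidSeq) : hermiteSum b ∈ schwartzFamily := by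
  refine subset_jet_partials {F | ∃ b ∈ rapidSeq, F = hermiteSum b} ?_ ?_ _ ⟨b, hb, rfl⟩
  · rintro _ ⟨b, hb, rfl⟩
    refine ⟨hermiteSum_continuous hb, fun n => ?_⟩
    -- `y ^ n` times a Hermite series is a Hermite series, hence bounded
    induction n generalizing b with
    | zero => simpa using hermiteSum_bound hb
    | succ n ih =>
      obtain ⟨C, hC⟩ := ih _ (add_mem (lowerSeq_mem hb) (raiseSeq_mem hb))
      refine ⟨C, fun s y => ?_⟩
      have := hC s y
      rwa [← mul_hermiteSum hb, norm_mul, Complex.norm_real, Real.norm_eq_abs, ← mul_assoc,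
        ← pow_succ] at this
  · rintro _ ⟨b, hb, rfl⟩
    obtain ⟨b', hb', h⟩ := rapidSeq_deriv hb
    exact ⟨_, Submodule.mem_sup_left (Submodule.subset_span ⟨b', hb', rfl⟩), _,
      Submodule.mem_sup_left (Submodule.subset_span ⟨_, add_mem (lowerSeq_mem hb)
        (rapidSeq.smul_mem (-1) (raiseSeq_mem hb)), rfl⟩),
      hasDerivAt_hermiteSum_s hb hb' h, hasDerivAt_hermiteSum_y hb⟩

theorem dX_hermiteSum {b : ℕ → ℝ → ℂ} (hb : b ∈ rapidSeq) :
    dX (hermiteSum b) = hermiteSum (lowerSeq b + (-1 : ℂ) • raiseSeq b) := by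
  ext s y
  exact (hasDerivAt_hermiteSum_y hb s y).deriv

/-- The harmonic oscillator `-½ ∂² + ½ y²` acts on Hermite series by `k + 1/2`. -/
theorem oscillator_hermiteSum {b : ℕ → ℝ → ℂ} (hb : b ∈ rapidSeq) (s y : ℝ) :
    -(1 / 2) * dX (dX (hermiteSum b)) s y + 1 / 2 * (y : ℂ) ^ 2 * hermiteSum b s y =
      hermiteSum (fun k s => ((1 / 2 + (k : ℝ) : ℝ) : ℂ) * b k s) s y := by
  have hD := add_mem (lowerSeq_mem hb) (rapidSeq.smul_mem (-1 : ℂ) (raiseSeq_mem hb))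
  have hX := add_mem (lowerSeq_mem hb) (raiseSeq_mem hb)
  have hDD := add_mem (lowerSeq_mem hD) (rapidSeq.smul_mem (-1 : ℂ) (raiseSeq_mem hD))
  have hXX := add_mem (lowerSeq_mem hX) (raiseSeq_mem hX)
  rw [dX_hermiteSum hb, dX_hermiteSum hD, mul_assoc, sq, mul_assoc, mul_hermiteSum hb,
    mul_hermiteSum hX, ← hermiteSum_smul, ← hermiteSum_smul, ← hermiteSum_add
    (rapidSeq.smul_mem _ hDD) (rapidSeq.smul_mem _ hXX)]
  congr 1
  ext k t
  have h1 : (ladder k : ℂ) * ladder k = (k : ℂ) / 2 := by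
    have := ladder_sq k
    rw [← Complex.ofReal_mul, this]; push_cast; rfl
  have h2 : (ladder (k + 1) : ℂ) * ladder (k + 1) = ((k : ℂ) + 1) / 2 := by
    have := ladder_sq (k + 1)
    rw [← Complex.ofReal_mul, this]; push_cast; rfl
  cases k with
  | zero =>
    simp only [Pi.add_apply, Pi.smul_apply, smul_eq_mul, lowerSeq, raiseSeq, ladder_zero,
      Nat.add_sub_cancel, Complex.ofReal_zero]
    push_cast at h2 ⊢
    linear_combination (b 0 t) * h2
  | succ k =>
    simp only [Pi.add_apply, Pi.smul_apply, smul_eq_mul, lowerSeq, raiseSeq,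
      Nat.add_sub_cancel]
    push_cast at h1 h2 ⊢
    linear_combination (b (k + 1) t) * (h1 + h2)

/-! ### Hermite coefficients -/

/-- The coefficient sequence `F_k(s) = ∫ F(s, y) φ_k(y) dy`. -/
noncomputable def hermiteCoeff (F : ℝ → ℝ → ℂ) : ℕ → ℝ → ℂ :=
  fun k s => ∫ y, F s y * (hermiteFun k y : ℂ)

theorem rapidFun_of_mem {F : ℝ → ℝ → ℂ} (hF : F ∈ schwartzFamily) (s : ℝ) : RapidFun (F s) := by
  obtain ⟨hc, hd⟩ := jet_le hF
  refine ⟨hc.comp (continuous_const.prodMk continuous_id), fun n => ?_⟩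
  obtain ⟨C, hC⟩ := hd n
  exact ⟨C, hC s⟩

theorem schwartzFamily_bound {F : ℝ → ℝ → ℂ} (hF : F ∈ schwartzFamily) :
    ∃ C, ∀ s y, ‖F s y‖ ≤ C * (1 + y ^ 2)⁻¹ := by
  obtain ⟨hc, hd⟩ := jet_le hF
  obtain ⟨C, hC⟩ := hd 0
  obtain ⟨D, hD⟩ := hd 2
  exact ⟨C + D, fun s y => norm_le_of_decay (fun y => by simpa using hC s y) (hD s) y⟩

theorem integrable_mul_hermiteFun {F : ℝ → ℝ → ℂ} (hF : F ∈ schwartzFamily) (k : ℕ) (s : ℝ) :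
    Integrable (fun y => F s y * (hermiteFun k y : ℂ)) :=
  ((rapidFun_of_mem hF s).mul (rapidFun_hermiteFun k).ofReal).integrable

theorem hasDerivAt_hermiteCoeff {F : ℝ → ℝ → ℂ} (hF : F ∈ schwartzFamily) (k : ℕ) (s : ℝ) :
    HasDerivAt (hermiteCoeff F k) (hermiteCoeff (dS F) k s) s := by
  obtain ⟨C, hC⟩ := schwartzFamily_bound (dS_mem_schwartzFamily hF)
  have := hasDerivAt_integral_of_dominated_loc_of_deriv_le (μ := volume) (s := Set.univ)
    (F := fun s y => F s y * (hermiteFun k y : ℂ))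
    (F' := fun s y => dS F s y * (hermiteFun k y : ℂ)) (x₀ := s)
    (bound := fun y => C * (1 + y ^ 2)⁻¹ * (2 * ((k : ℝ) + 1))) univ_mem
    (Eventually.of_forall fun t => (integrable_mul_hermiteFun hF k t).aestronglyMeasurable)
    (integrable_mul_hermiteFun hF k s)
    (integrable_mul_hermiteFun (dS_mem_schwartzFamily hF) k s).aestronglyMeasurable
    (ae_of_all _ fun y t _ => by
      rw [norm_mul, Complex.norm_real, Real.norm_eq_abs]
      exact mul_le_mul (hC t y) (abs_hermiteFun_le k y) (abs_nonneg _)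
        ((norm_nonneg _).trans (hC t y)))
    ((integrable_inv_one_add_sq.const_mul C).mul_const _)
    (ae_of_all _ fun y t _ => (hasDerivAt_dS hF t y).mul_const _)
  exact this.2

/-- Integration by parts, twice: the harmonic oscillator multiplies the `k`-th coefficient by
`k + 1/2`. -/
theorem hermiteCoeff_oscillator {F : ℝ → ℝ → ℂ} (hF : F ∈ schwartzFamily) (k : ℕ) (s : ℝ) :
    hermiteCoeff (fun s y => -(1 / 2) * dX (dX F) s y + 1 / 2 * (y : ℂ) ^ 2 * F s y) k s =
      ((1 / 2 + (k : ℝ) : ℝ) : ℂ) * hermiteCoeff F k s := by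
  set g : ℝ → ℂ := fun y => (hermiteFun k y : ℂ)
  set d : ℝ → ℂ := fun y => ((ladder k * hermiteFun (k - 1) y -
    ladder (k + 1) * hermiteFun (k + 1) y : ℝ) : ℂ)
  set e : ℝ → ℂ := fun y => ((y : ℂ) ^ 2 - 2 * k - 1) * g y
  have hgr : RapidFun g := (rapidFun_hermiteFun k).ofReal
  have hdr : RapidFun d := by
    have := (((rapidFun_hermiteFun (k - 1)).const_mul (ladder k)).add
      ((rapidFun_hermiteFun (k + 1)).const_mul (-ladder (k + 1)))).ofReal
    have h : d = fun x => ((ladder k * hermiteFun (k - 1) x +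
        -ladder (k + 1) * hermiteFun (k + 1) x : ℝ) : ℂ) := by
      ext x; simp only [d]; congr 1; ring
    rwa [h]
  have her : RapidFun e := by
    have := hgr.id_mul_complex.id_mul_complex.add (hgr.const_mul (-2 * (k : ℂ) - 1))
    have h : e = fun x : ℝ => (x : ℂ) * ((x : ℂ) * g x) + (-2 * k - 1) * g x := by
      ext x; simp only [e]; ring
    rwa [h]
  have hg : ∀ y, HasDerivAt g (d y) y := fun y => (hasDerivAt_hermiteFun k y).ofReal_comp
  have hd : ∀ y, HasDerivAt d (e y) y := by
    intro y
    have h1 : (fun y => ladder k * hermiteFun (k - 1) y - ladder (k + 1) * hermiteFun (k + 1) y) =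
        fun y => y * hermiteFun k y - 2 * (ladder (k + 1) * hermiteFun (k + 1) y) := by
      ext y; rw [mul_hermiteFun]; ring
    have h2 := ((hasDerivAt_id y).mul (hasDerivAt_hermiteFun k y)).sub
      (((hermiteFun_succ (k + 1) y).2.const_mul (ladder (k + 1))).const_mul 2)
    have h3 : HasDerivAt (fun y => ladder k * hermiteFun (k - 1) y -
        ladder (k + 1) * hermiteFun (k + 1) y) ((y ^ 2 - 2 * k - 1) * hermiteFun k y) y := by
      rw [h1]
      refine h2.congr_deriv ?_
      have h4 := ladder_sq (k + 1)
      have h5 := mul_hermiteFun k y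
      push_cast at h4
      simp only [id, Nat.add_sub_cancel]
      linear_combination (-4 * hermiteFun k y) * h4 + (-y) * h5
    refine h3.ofReal_comp.congr_deriv ?_
    simp only [e, g]
    push_cast
    ring
  have hF1 := dX_mem_schwartzFamily hF
  have hF2 := dX_mem_schwartzFamily hF1
  have r0 := rapidFun_of_mem hF s
  have r1 := rapidFun_of_mem hF1 s
  have r2 := rapidFun_of_mem hF2 s
  have i1 := integral_mul_deriv_eq_deriv_mul_of_integrable (fun y _ => hasDerivAt_dX hF s y)
    (fun y _ => hd y) (r0.mul her).integrable (r1.mul hdr).integrable (r0.mul hdr).integrable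
  have i2 := integral_mul_deriv_eq_deriv_mul_of_integrable (fun y _ => hasDerivAt_dX hF1 s y)
    (fun y _ => hg y) (r1.mul hdr).integrable (r2.mul hgr).integrable (r1.mul hgr).integrable
  have i3 : ∫ y, F s y * e y = ∫ y, dX (dX F) s y * g y := by rw [i1, i2, neg_neg]
  have j1 : Integrable (fun y : ℝ => F s y * ((y : ℂ) * ((y : ℂ) * g y))) :=
    (r0.mul hgr.id_mul_complex.id_mul_complex).integrable
  have j2 : Integrable (fun y => dX (dX F) s y * g y) := (r2.mul hgr).integrable
  have j3 : Integrable (fun y => F s y * g y) := (r0.mul hgr).integrable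
  have k1 : ∫ y, F s y * e y = (∫ y : ℝ, F s y * ((y : ℂ) * ((y : ℂ) * g y))) -
      (2 * k + 1) * ∫ y, F s y * g y := by
    rw [← integral_const_mul, ← integral_sub j1 (j3.const_mul _)]
    refine integral_congr_ae (ae_of_all _ fun y => ?_)
    simp only [e]; ring
  have k2 : hermiteCoeff (fun s y => -(1 / 2) * dX (dX F) s y + 1 / 2 * (y : ℂ) ^ 2 * F s y) k s =
      -(1 / 2) * (∫ y, dX (dX F) s y * g y) +
        1 / 2 * ∫ y : ℝ, F s y * ((y : ℂ) * ((y : ℂ) * g y)) := by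
    rw [← integral_const_mul, ← integral_const_mul,
      ← integral_add (j2.const_mul _) (j1.const_mul _)]
    refine integral_congr_ae (ae_of_all _ fun y => ?_)
    simp only [g]; ring
  have k3 : hermiteCoeff F k s = ∫ y, F s y * g y := rfl
  rw [k2, k3]
  push_cast
  linear_combination (1 / 2 : ℂ) * i3 - (1 / 2 : ℂ) * k1

theorem oscillator_mem {F : ℝ → ℝ → ℂ} (hF : F ∈ schwartzFamily) :
    (fun s y => -(1 / 2) * dX (dX F) s y + 1 / 2 * (y : ℂ) ^ 2 * F s y) ∈ schwartzFamily := by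
  have h1 := mul_mem_schwartzFamily snd_mem_temperateFamily
    (mul_mem_schwartzFamily snd_mem_temperateFamily hF)
  have h2 := add_mem (schwartzFamily.smul_mem (-(1 / 2) : ℂ)
    (dX_mem_schwartzFamily (dX_mem_schwartzFamily hF))) (schwartzFamily.smul_mem (1 / 2 : ℂ) h1)
  convert h2 using 1
  ext s y
  simp only [Pi.add_apply, Pi.smul_apply, Pi.mul_apply, smul_eq_mul]
  ring

/-- The coefficients decrease rapidly: by `hermiteCoeff_oscillator`, each application of the harmonic
oscillator to `F` gains a factor `(k + 1/2)⁻¹`. -/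
theorem hermiteCoeff_mem {F : ℝ → ℝ → ℂ} (hF : F ∈ schwartzFamily) : hermiteCoeff F ∈ rapidSeq := by
  refine subset_rapidSeq {b | ∃ F ∈ schwartzFamily, b = hermiteCoeff F} ?_ ?_ _ ⟨F, hF, rfl⟩
  · rintro _ ⟨F, hF, rfl⟩ N
    have key : ∀ N : ℕ, ∀ F ∈ schwartzFamily, ∃ C : ℝ, ∀ (k : ℕ) (s : ℝ),
        (1 / 2 + (k : ℝ)) ^ N * ‖hermiteCoeff F k s‖ ≤ C * (2 * ((k : ℝ) + 1)) := by
      intro N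
      induction N with
      | zero =>
        intro F hF
        obtain ⟨C, hC⟩ := schwartzFamily_bound hF
        refine ⟨∫ y, C * (1 + y ^ 2)⁻¹, fun k s => ?_⟩
        rw [pow_zero, one_mul, ← integral_mul_const]
        refine norm_integral_le_of_norm_le ((integrable_inv_one_add_sq.const_mul C).mul_const _)
          (ae_of_all _ fun y => ?_)
        rw [norm_mul, Complex.norm_real, Real.norm_eq_abs]
        exact mul_le_mul (hC s y) (abs_hermiteFun_le k y) (abs_nonneg _)
          ((norm_nonneg _).trans (hC s y))
      | succ N ih =>
        intro F hF
        obtain ⟨C, hC⟩ := ih _ (oscillator_mem hF)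
        refine ⟨C, fun k s => ?_⟩
        have := hC k s
        rwa [hermiteCoeff_oscillator hF, norm_mul, Complex.norm_real, Real.norm_eq_abs,
          abs_of_nonneg (by positivity : (0 : ℝ) ≤ 1 / 2 + k), ← mul_assoc, ← pow_succ] at this
    obtain ⟨C, hC⟩ := key (N + 1) F hF
    refine ⟨C * 2 * 2 ^ (N + 1), fun k s => ?_⟩
    have hk : (0 : ℝ) ≤ k := k.cast_nonneg
    have h0 := hC k s
    have h1 : ((k : ℝ) + 1) * (((k : ℝ) + 1) ^ N * ‖hermiteCoeff F k s‖) ≤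
        ((k : ℝ) + 1) * (C * 2 * 2 ^ (N + 1)) := by
      calc ((k : ℝ) + 1) * (((k : ℝ) + 1) ^ N * ‖hermiteCoeff F k s‖)
          = ((k : ℝ) + 1) ^ (N + 1) * ‖hermiteCoeff F k s‖ := by ring
        _ ≤ (2 * (1 / 2 + (k : ℝ))) ^ (N + 1) * ‖hermiteCoeff F k s‖ := by gcongr; linarith
        _ = 2 ^ (N + 1) * ((1 / 2 + (k : ℝ)) ^ (N + 1) * ‖hermiteCoeff F k s‖) := by
            rw [mul_pow]; ring
        _ ≤ 2 ^ (N + 1) * (C * (2 * ((k : ℝ) + 1))) := by gcongr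
        _ = _ := by ring
    exact le_of_mul_le_mul_left h1 (by positivity)
  · rintro _ ⟨F, hF, rfl⟩
    exact ⟨_, Submodule.mem_sup_left (Submodule.subset_span
      ⟨dS F, dS_mem_schwartzFamily hF, rfl⟩), hasDerivAt_hermiteCoeff hF⟩

/-- Pointwise Hermite expansion of Schwartz families: the difference of the two sides is orthogonal to
all Hermite functions. -/
theorem hermiteSum_hermiteCoeff {F : ℝ → ℝ → ℂ} (hF : F ∈ schwartzFamily) :
    hermiteSum (hermiteCoeff F) = F := by
  have hb := hermiteCoeff_mem hF
  have hG := hermiteSum_mem hb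
  have hD := sub_mem hF hG
  funext s
  have hr := rapidFun_of_mem hD s
  obtain ⟨C, hC⟩ := hr.bounded
  have h0 := eq_zero_of_orthogonal hr.1 hC fun j => ?_
  · funext y
    have := congrFun h0 y
    simp only [Pi.sub_apply, Pi.zero_apply, sub_eq_zero] at this
    exact this.symm
  · have e : ∀ y, (F - hermiteSum (hermiteCoeff F)) s y * (hermiteFun j y : ℂ) =
        F s y * (hermiteFun j y : ℂ) - hermiteSum (hermiteCoeff F) s y * (hermiteFun j y : ℂ) :=
      fun y => sub_mul _ _ _
    simp_rw [e]
    rw [integral_sub (integrable_mul_hermiteFun hF j s) (integrable_mul_hermiteFun hG j s)]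
    obtain ⟨K, hK⟩ := hermite_term_bound hb
    have hint := hasSum_integral_of_dominated_convergence (μ := volume)
      (F := fun k y => hermiteCoeff F k s * (hermiteFun k y : ℂ) * (hermiteFun j y : ℂ))
      (f := fun y => hermiteSum (hermiteCoeff F) s y * (hermiteFun j y : ℂ))
      (fun (k : ℕ) y => K * (1 / ((k : ℝ) + 1) ^ 2) * ‖(hermiteFun j y : ℂ)‖)
      (fun k => by
        have := continuous_hermiteFun k
        have := continuous_hermiteFun j
        exact Continuous.aestronglyMeasurable (by fun_prop))
      (fun k => ae_of_all _ fun y => by rw [norm_mul]; gcongr; exact hK k s y)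
      (ae_of_all _ fun y => (summable_inv_sq.mul_left K).mul_right _)
      (by
        simp_rw [tsum_mul_right]
        exact (rapidFun_hermiteFun j).ofReal.integrable.norm.const_mul _)
      (ae_of_all _ fun y => (summable_hermite hb s y).hasSum.mul_right _)
    have horth : ∀ k, ∫ y, hermiteCoeff F k s * (hermiteFun k y : ℂ) * (hermiteFun j y : ℂ) =
        if k = j then hermiteCoeff F j s else 0 := by
      intro k
      simp_rw [mul_assoc]
      rw [integral_const_mul]
      have : ∫ y, (hermiteFun k y : ℂ) * (hermiteFun j y : ℂ) = if k = j then 1 else 0 := by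
        have h := integral_hermiteFun_mul k j
        have h2 : ∫ y, (hermiteFun k y : ℂ) * (hermiteFun j y : ℂ) =
            ((∫ y, hermiteFun k y * hermiteFun j y : ℝ) : ℂ) := by
          rw [← integral_complex_ofReal]
          simp
        rw [h2, h]
        split_ifs <;> simp
      rw [this]
      split_ifs with hkj
      · rw [hkj, mul_one]
      · rw [mul_zero]
    simp_rw [horth] at hint
    rw [hint.unique (hasSum_ite_eq j _), hermiteCoeff, sub_self]

/-! ### Taylor coefficients of the metric -/

section Taylor

variable {r₀ : ℝ} {f : ℝ → ℝ → ℝ}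

/-- Joint smoothness of `f` at all points `(s, r)` with `|r| < r₀`. -/
def SmoothStrip (r₀ : ℝ) (f : ℝ → ℝ → ℝ) : Prop :=
  ∀ s, ∀ r ∈ Set.Ioo (-r₀) r₀, ContDiffAt ℝ (⊤ : ℕ∞) (fun z : ℝ × ℝ => f z.1 z.2) (s, r)

/-- `f (s + 2π, r) = σ f (s, ω r)` for `|r| < r₀`. -/
def TwistStrip (r₀ ω σ : ℝ) (f : ℝ → ℝ → ℝ) : Prop :=
  ∀ s, ∀ r ∈ Set.Ioo (-r₀) r₀, f (s + 2 * Real.pi) r = σ * f s (ω * r)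

theorem strip_mem_nhds {s r : ℝ} (hr : r ∈ Set.Ioo (-r₀) r₀) :
    ∀ᶠ z : ℝ × ℝ in 𝓝 (s, r), z.2 ∈ Set.Ioo (-r₀) r₀ :=
  continuous_snd.continuousAt.eventually (isOpen_Ioo.mem_nhds hr)

theorem SmoothStrip.hasDerivAt_fst (hf : SmoothStrip r₀ f) {s r : ℝ} (hr : r ∈ Set.Ioo (-r₀) r₀) :
    HasDerivAt (fun t => f t r) (fderiv ℝ (fun z : ℝ × ℝ => f z.1 z.2) (s, r) (1, 0)) s :=
  HasFDerivAt.comp_hasDerivAt (l := fun z : ℝ × ℝ => f z.1 z.2) s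
    ((hf s r hr).differentiableAt (by simp)).hasFDerivAt
    ((hasDerivAt_id s).prodMk (hasDerivAt_const s r))

theorem SmoothStrip.hasDerivAt_snd (hf : SmoothStrip r₀ f) {s r : ℝ} (hr : r ∈ Set.Ioo (-r₀) r₀) :
    HasDerivAt (f s) (fderiv ℝ (fun z : ℝ × ℝ => f z.1 z.2) (s, r) (0, 1)) r :=
  HasFDerivAt.comp_hasDerivAt (l := fun z : ℝ × ℝ => f z.1 z.2) r
    ((hf s r hr).differentiableAt (by simp)).hasFDerivAt
    ((hasDerivAt_const r s).prodMk (hasDerivAt_id r))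

theorem SmoothStrip.deriv_fst (hf : SmoothStrip r₀ f) :
    SmoothStrip r₀ (fun s r => deriv (fun t => f t r) s) := by
  intro s r hr
  have h := ((hf s r hr).fderiv_right (m := (⊤ : ℕ∞)) (by simp)).clm_apply
    (contDiffAt_const (c := ((1 : ℝ), (0 : ℝ))))
  refine h.congr_of_eventuallyEq ?_
  filter_upwards [strip_mem_nhds hr] with z hz
  exact (hf.hasDerivAt_fst hz).deriv

theorem SmoothStrip.deriv_snd (hf : SmoothStrip r₀ f) :
    SmoothStrip r₀ (fun s r => deriv (f s) r) := by
  intro s r hr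
  have h := ((hf s r hr).fderiv_right (m := (⊤ : ℕ∞)) (by simp)).clm_apply
    (contDiffAt_const (c := ((0 : ℝ), (1 : ℝ))))
  refine h.congr_of_eventuallyEq ?_
  filter_upwards [strip_mem_nhds hr] with z hz
  exact (hf.hasDerivAt_snd hz).deriv

theorem TwistStrip.deriv_fst {ω σ : ℝ} (hf : TwistStrip r₀ ω σ f) :
    TwistStrip r₀ ω σ (fun s r => deriv (fun t => f t r) s) := by
  intro s r hr
  simp only
  rw [← deriv_comp_add_const, ← deriv_const_mul_field]
  exact congrArg (fun g => deriv g s) (funext fun t => hf t r hr)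

theorem TwistStrip.deriv_snd {ω σ : ℝ} (hf : TwistStrip r₀ ω σ f) :
    TwistStrip r₀ ω (σ * ω) (fun s r => deriv (f s) r) := by
  intro s r hr
  have : f (s + 2 * Real.pi) =ᶠ[𝓝 r] fun r => σ * f s (ω * r) := by
    filter_upwards [isOpen_Ioo.mem_nhds hr] with y hy using hf s y hy
  simp only
  rw [this.deriv_eq, deriv_const_mul_field, deriv_comp_mul_left ω (f s) r, smul_eq_mul, mul_assoc]

theorem smoothStrip_iteratedDeriv (hf : SmoothStrip r₀ f) (n : ℕ) :
    SmoothStrip r₀ (fun s r => iteratedDeriv n (f s) r) := by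
  induction n generalizing f with
  | zero => exact hf
  | succ n ih =>
    simp only [iteratedDeriv_succ']
    exact ih hf.deriv_snd

theorem twistStrip_iteratedDeriv {ω σ : ℝ} (hf : TwistStrip r₀ ω σ f) (n : ℕ) :
    TwistStrip r₀ ω (σ * ω ^ n) (fun s r => iteratedDeriv n (f s) r) := by
  induction n generalizing f σ with
  | zero => simpa using hf
  | succ n ih =>
    simp only [iteratedDeriv_succ']
    have := ih hf.deriv_snd
    rwa [mul_assoc, ← pow_succ'] at this

theorem contDiff_iteratedDeriv_zero (hr₀ : 0 < r₀) (hf : SmoothStrip r₀ f) (n : ℕ) :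
    ContDiff ℝ (⊤ : ℕ∞) (fun s => iteratedDeriv n (f s) 0) := by
  refine contDiff_iff_contDiffAt.2 fun s => ?_
  exact ContDiffAt.comp (g := fun z : ℝ × ℝ => iteratedDeriv n (f z.1) z.2) (f := fun s => (s, (0 : ℝ)))
    s (smoothStrip_iteratedDeriv hf n s 0 ⟨by simpa using hr₀, hr₀⟩)
    (contDiffAt_id.prodMk contDiffAt_const)

theorem iteratedDeriv_zero_twist (hr₀ : 0 < r₀) {ω σ : ℝ} (hf : TwistStrip r₀ ω σ f) (n : ℕ)
    (s : ℝ) : iteratedDeriv n (f (s + 2 * Real.pi)) 0 = σ * ω ^ n * iteratedDeriv n (f s) 0 := by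
  have := twistStrip_iteratedDeriv hf n s 0 ⟨by simpa using hr₀, hr₀⟩
  simpa using this

/-- The Taylor coefficients are `4π`-periodic in `s`, also in the twisted case. -/
theorem taylorAt_mem (hr₀ : 0 < r₀) (hf : SmoothStrip r₀ f) {ω σ : ℝ}
    (hω : ω = 1 ∨ ω = -1) (hσ : σ = 1 ∨ σ = -1) (ht : TwistStrip r₀ ω σ f) (n : ℕ) :
    (fun s x => PowerSeries.coeff n (taylorAt (f s) x)) ∈ temperateFamily := by
  have h1 : (fun s _ => ((iteratedDeriv n (f s) 0 / (n ! : ℝ) : ℝ) : ℂ)) ∈ temperateFamily := by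
    refine periodic_mem_temperateFamily (T := 2 * Real.pi + 2 * Real.pi) ?_
      (by have := Real.pi_pos; positivity) fun s => ?_
    · exact Complex.ofRealCLM.contDiff.comp ((contDiff_iteratedDeriv_zero hr₀ hf n).div_const _)
    · rw [← add_assoc, iteratedDeriv_zero_twist hr₀ ht, iteratedDeriv_zero_twist hr₀ ht, ← mul_assoc]
      have : σ * ω ^ n * (σ * ω ^ n) = 1 := by
        have h2 : ω ^ n * ω ^ n = 1 := by
          rw [← mul_pow]; rcases hω with rfl | rfl <;> simp
        have h3 : σ * σ = 1 := by rcases hσ with rfl | rfl <;> simp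
        linear_combination σ * σ * h2 + h3
      rw [this, one_mul]
  have h2 : ∀ n : ℕ, (fun _ x => (x : ℂ) ^ n : ℝ → ℝ → ℂ) ∈ temperateFamily := by
    intro n
    induction n with
    | zero => simpa using const_mem_temperateFamily 1
    | succ n ih =>
      have := mul_mem_temperateFamily ih snd_mem_temperateFamily
      simp only [pow_succ]
      exact this
  have h3 := mul_mem_temperateFamily h1 (h2 n)
  convert h3 using 1
  ext s x
  simp [taylorAt]

theorem taylorAt_twist (hr₀ : 0 < r₀) {ω σ : ℝ} (ht : TwistStrip r₀ ω σ f) (s x : ℝ) :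
    taylorAt (f (s + 2 * Real.pi)) x = (σ : ℂ) • taylorAt (f s) (ω * x) := by
  ext n
  simp only [taylorAt, PowerSeries.coeff_mk, iteratedDeriv_zero_twist hr₀ ht, map_smul, smul_eq_mul]
  push_cast
  ring

end Taylor

section Metric

variable {r₀ ω : ℝ} {a : ℝ → ℝ → ℝ}

theorem smoothStrip_metric (ha : IsFermiMetric r₀ ω a) : SmoothStrip r₀ a := fun s _ hr =>
  ha.smooth.contDiffAt ((isOpen_univ.prod isOpen_Ioo).mem_nhds ⟨Set.mem_univ s, hr⟩)

theorem twistStrip_metric (ha : IsFermiMetric r₀ ω a) : TwistStrip r₀ ω 1 a := fun s r hr => by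
  rw [one_mul]; exact ha.twist s r hr

theorem smoothStrip_inv (ha : IsFermiMetric r₀ ω a) : SmoothStrip r₀ (fun s r => 1 / a s r) :=
  fun s r hr => contDiffAt_const.div (smoothStrip_metric ha s r hr) (ha.pos s r hr).ne'

theorem twistStrip_inv (ha : IsFermiMetric r₀ ω a) : TwistStrip r₀ ω 1 (fun s r => 1 / a s r) :=
  fun s r hr => by simp only [ha.twist s r hr, one_mul]

/-- The coefficient `B = a⁻²`. -/
theorem coeffB (ha : IsFermiMetric r₀ ω a) :
    SmoothStrip r₀ (fun s r => 1 / a s r ^ 2) ∧ TwistStrip r₀ ω 1 (fun s r => 1 / a s r ^ 2) :=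
  ⟨fun s r hr => contDiffAt_const.div ((smoothStrip_metric ha s r hr).pow 2)
    (pow_ne_zero 2 (ha.pos s r hr).ne'), fun s r hr => by simp only [ha.twist s r hr, one_mul]⟩

/-- The coefficient `C = a⁻¹ ∂_s(a⁻¹)`. -/
theorem coeffC (ha : IsFermiMetric r₀ ω a) :
    SmoothStrip r₀ (fun s r => 1 / a s r * deriv (fun t => 1 / a t r) s) ∧
      TwistStrip r₀ ω 1 (fun s r => 1 / a s r * deriv (fun t => 1 / a t r) s) :=
  ⟨fun s r hr => (smoothStrip_inv ha s r hr).mul ((smoothStrip_inv ha).deriv_fst s r hr),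
    fun s r hr => by
      have h1 := twistStrip_inv ha s r hr
      have h2 := (twistStrip_inv ha).deriv_fst s r hr
      simp only at h1 h2 ⊢
      rw [h1, h2]; ring⟩

/-- The coefficient `D = a⁻¹ ∂_r a`; the derivative in `r` brings in the sign `ω`. -/
theorem coeffD (ha : IsFermiMetric r₀ ω a) :
    SmoothStrip r₀ (fun s r => deriv (a s) r / a s r) ∧
      TwistStrip r₀ ω ω (fun s r => deriv (a s) r / a s r) :=
  ⟨fun s r hr => ((smoothStrip_metric ha).deriv_snd s r hr).div (smoothStrip_metric ha s r hr)
    (ha.pos s r hr).ne', fun s r hr => by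
      have h2 := (twistStrip_metric ha).deriv_snd s r hr
      simp only at h2 ⊢
      rw [ha.twist s r hr, h2]; ring⟩

theorem contDiff_curv (ha : IsFermiMetric r₀ ω a) : ContDiff ℝ (⊤ : ℕ∞) (curv a) := by
  have : curv a = fun s => -iteratedDeriv 2 (a s) 0 := by
    ext s; simp [curv, gaussCurvature, ha.at_zero]
  rw [this]
  exact (contDiff_iteratedDeriv_zero ha.width_pos (smoothStrip_metric ha) 2).neg

theorem curv_periodic (ha : IsFermiMetric r₀ ω a) (s : ℝ) :
    curv a (s + 2 * Real.pi) = curv a s := by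
  simp only [curv, gaussCurvature, ha.at_zero]
  rw [iteratedDeriv_zero_twist ha.width_pos (twistStrip_metric ha)]
  rcases ha.orientation with rfl | rfl <;> simp

end Metric

/-! ### The source term -/

/-- All coefficients of the family `A` of power series belong to `W`. -/
def CoeffsIn (W : Submodule ℂ (ℝ → ℝ → ℂ)) (A : ℝ → ℝ → PowerSeries ℂ) : Prop :=
  ∀ n, (fun s x => PowerSeries.coeff n (A s x)) ∈ W

theorem truncSeries_congr {p : ℕ} {f g : ℕ → ℂ} (h : ∀ j < p, f j = g j) :
    truncSeries p f = truncSeries p g := by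
  ext n
  simp only [truncSeries, PowerSeries.coeff_mk]
  split_ifs with hn
  · exact h n hn
  · rfl

section CoeffsIn

variable {W : Submodule ℂ (ℝ → ℝ → ℂ)} {A V : ℝ → ℝ → PowerSeries ℂ}

theorem CoeffsIn.add (hA : CoeffsIn W A) (hV : CoeffsIn W V) :
    CoeffsIn W (fun s x => A s x + V s x) := fun n => by
  convert add_mem (hA n) (hV n) using 1
  ext s x
  simp

theorem CoeffsIn.sub (hA : CoeffsIn W A) (hV : CoeffsIn W V) :
    CoeffsIn W (fun s x => A s x - V s x) := fun n => by
  convert sub_mem (hA n) (hV n) using 1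
  ext s x
  simp

theorem CoeffsIn.smul (hA : CoeffsIn W A) (c : ℂ) : CoeffsIn W (fun s x => c • A s x) := fun n => by
  convert W.smul_mem c (hA n) using 1
  ext s x
  simp

theorem CoeffsIn.mul (hA : CoeffsIn temperateFamily A) (hV : CoeffsIn schwartzFamily V) :
    CoeffsIn schwartzFamily (fun s x => A s x * V s x) := fun n => by
  have := Submodule.sum_mem schwartzFamily (t := Finset.HasAntidiagonal.antidiagonal n)
    (f := fun p => (fun s x => PowerSeries.coeff p.1 (A s x)) *
      fun s x => PowerSeries.coeff p.2 (V s x))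
    fun p _ => mul_mem_schwartzFamily (hA p.1) (hV p.2)
  convert this using 1
  ext s x
  simp [PowerSeries.coeff_mul, Finset.sum_apply]

theorem CoeffsIn.temperate (hV : CoeffsIn schwartzFamily V) : CoeffsIn temperateFamily V :=
  fun n => mem_temperateFamily_of_schwartzFamily (hV n)

theorem coeffsIn_const (p : PowerSeries ℂ) : CoeffsIn temperateFamily (fun _ _ => p) :=
  fun _ => const_mem_temperateFamily _

theorem CoeffsIn.mul_temperate (hA : CoeffsIn temperateFamily A) (hV : CoeffsIn temperateFamily V) :
    CoeffsIn temperateFamily (fun s x => A s x * V s x) := fun n => by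
  have := Submodule.sum_mem temperateFamily (t := Finset.HasAntidiagonal.antidiagonal n)
    (f := fun p => (fun s x => PowerSeries.coeff p.1 (A s x)) *
      fun s x => PowerSeries.coeff p.2 (V s x))
    fun p _ => mul_mem_temperateFamily (hA p.1) (hV p.2)
  convert this using 1
  ext s x
  simp [PowerSeries.coeff_mul, Finset.sum_apply]

theorem coeffsIn_truncSeries {p : ℕ} {f : ℕ → ℝ → ℝ → ℂ} (hf : ∀ j < p, f j ∈ W) :
    CoeffsIn W (fun s x => truncSeries p (fun j => f j s x)) := fun n => by
  simp only [truncSeries, PowerSeries.coeff_mk]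
  by_cases h : n < p
  · simpa only [h, if_true] using hf n h
  · simp only [h, if_false]; exact W.zero_mem

end CoeffsIn

theorem source_mem {r₀ ω : ℝ} {a : ℝ → ℝ → ℝ} (ha : IsFermiMetric r₀ ω a) (ε δ : ℝ) (E : ℕ → ℂ)
    {v : ℕ → ℝ → ℝ → ℂ} {p : ℕ} (hv : ∀ j < p, v j ∈ schwartzFamily) :
    source a ε δ E v p ∈ schwartzFamily := by
  have hω := ha.orientation
  have hB : CoeffsIn temperateFamily (fun s x => taylorAt (fun r => 1 / a s r ^ 2) x) := fun n =>
    taylorAt_mem ha.width_pos (coeffB ha).1 hω (Or.inl rfl) (coeffB ha).2 n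
  have hC : CoeffsIn temperateFamily
      (fun s x => taylorAt (fun r => 1 / a s r * deriv (fun t => 1 / a t r) s) x) := fun n =>
    taylorAt_mem ha.width_pos (coeffC ha).1 hω (Or.inl rfl) (coeffC ha).2 n
  have hD : CoeffsIn temperateFamily (fun s x => taylorAt (fun r => deriv (a s) r / a s r) x) :=
    fun n => taylorAt_mem ha.width_pos (coeffD ha).1 hω hω (coeffD ha).2 n
  have hG : CoeffsIn temperateFamily (fun s x => (PowerSeries.mk fun n =>
      PowerSeries.coeff (n + 2) (taylorAt (fun r => 1 / a s r ^ 2) x) : PowerSeries ℂ)) := by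
    intro n
    simp only [PowerSeries.coeff_mk]
    exact hB (n + 2)
  have hV := coeffsIn_truncSeries hv
  have hVbar := coeffsIn_truncSeries (p := p) (f := fun j s x => (starRingEnd ℂ) (v j s x))
    fun j hj => conj_mem_schwartzFamily (hv j hj)
  have hVs := coeffsIn_truncSeries fun j hj => dS_mem_schwartzFamily (hv j hj)
  have hVss := coeffsIn_truncSeries fun j hj =>
    dS_mem_schwartzFamily (dS_mem_schwartzFamily (hv j hj))
  have hVx := coeffsIn_truncSeries fun j hj => dX_mem_schwartzFamily (hv j hj)
  have hη := coeffsIn_const PowerSeries.X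
  have hη2 := coeffsIn_const (PowerSeries.X ^ 2)
  have hE := coeffsIn_const (truncSeries p (fun j => if j = 0 then 0 else E j))
  have h1 := hE.mul hV
  have h2 := (hη.mul ((hV.temperate.mul hVbar).temperate.mul hV)).smul
    ((1 / 2 * ε * δ ^ 2 : ℝ) : ℂ)
  have h3 : CoeffsIn temperateFamily (fun s x => taylorAt (fun r => 1 / a s r ^ 2) x - 1) :=
    hB.sub (coeffsIn_const 1)
  have h4 := (h3.mul hVs).smul Complex.I
  have h5 := ((hη2.mul_temperate hB).mul hVss).smul (1 / 2)
  have h6 := (hG.mul hV).smul (1 / 2)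
  have h7 := (hC.mul ((hV.smul Complex.I).add (hη2.mul hVs))).smul (1 / 2)
  have h8 := ((hη.mul_temperate hD).mul hVx).smul (1 / 2)
  have := ((h1.add h2).sub ((((h4.add h5).sub h6).add h7).add h8)) p
  convert this using 1
  ext s x
  simp only [source, iteratedDeriv_succ, iteratedDeriv_zero]
  rfl

/-- The signs `ω` produced by `D` and by `∂_x v_j` cancel. -/
theorem source_twist {r₀ ω : ℝ} {a : ℝ → ℝ → ℝ} (ha : IsFermiMetric r₀ ω a) (ε δ : ℝ) (E : ℕ → ℂ)
    {v : ℕ → ℝ → ℝ → ℂ} {p : ℕ} (ht : ∀ j < p, ∀ s x, v j (s + 2 * Real.pi) x = v j s (ω * x))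
    (s x : ℝ) : source a ε δ E v p (s + 2 * Real.pi) x = source a ε δ E v p s (ω * x) := by
  have hB := taylorAt_twist ha.width_pos (coeffB ha).2 s x
  have hC := taylorAt_twist ha.width_pos (coeffC ha).2 s x
  have hD := taylorAt_twist ha.width_pos (coeffD ha).2 s x
  rw [Complex.ofReal_one, one_smul] at hB hC
  have ht' : ∀ j < p, ∀ s x, v j (s + 2 * Real.pi) x = (1 : ℂ) * v j s (ω * x) := fun j hj s x => by
    rw [one_mul, ht j hj]
  have hV : truncSeries p (fun j => v j (s + 2 * Real.pi) x) =
      truncSeries p (fun j => v j s (ω * x)) := truncSeries_congr fun j hj => ht j hj s x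
  have hVbar : truncSeries p (fun j => (starRingEnd ℂ) (v j (s + 2 * Real.pi) x)) =
      truncSeries p (fun j => (starRingEnd ℂ) (v j s (ω * x))) :=
    truncSeries_congr fun j hj => by rw [ht j hj s x]
  have hVs : truncSeries p (fun j => deriv (fun t => v j t x) (s + 2 * Real.pi)) =
      truncSeries p (fun j => deriv (fun t => v j t (ω * x)) s) :=
    truncSeries_congr fun j hj => by
      have := dS_twist (ht' j hj) s x
      rwa [one_mul] at this
  have hVss : truncSeries p (fun j => iteratedDeriv 2 (fun t => v j t x) (s + 2 * Real.pi)) =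
      truncSeries p (fun j => iteratedDeriv 2 (fun t => v j t (ω * x)) s) :=
    truncSeries_congr fun j hj => by
      have := dS_twist (dS_twist (ht' j hj)) s x
      rw [one_mul] at this
      simp only [iteratedDeriv_succ, iteratedDeriv_zero]
      exact this
  have hVx : truncSeries p (fun j => deriv (fun y => v j (s + 2 * Real.pi) y) x) =
      (ω : ℂ) • truncSeries p (fun j => deriv (fun y => v j s y) (ω * x)) := by
    rw [truncSeries_congr (g := fun j => (ω : ℂ) * deriv (fun y => v j s y) (ω * x)) fun j hj => by
      have := dX_twist (ht' j hj) s x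
      rwa [one_mul] at this]
    ext n
    simp [truncSeries]
  simp only [source]
  rw [hB, hC, hD, hV, hVbar, hVs, hVss, hVx]
  have hωω : (ω : ℂ) * ω = 1 := by rcases ha.orientation with rfl | rfl <;> simp
  simp only [mul_smul_comm, smul_mul_assoc, smul_smul, hωω, mul_one]

/-- The source term depends only on the entries of index `< p`. -/
theorem source_congr {a : ℝ → ℝ → ℝ} {ε δ : ℝ} {E E' : ℕ → ℂ} {v v' : ℕ → ℝ → ℝ → ℂ} {p : ℕ}
    (h : ∀ j < p, E' j = E j ∧ v' j = v j) : source a ε δ E' v' p = source a ε δ E v p := by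
  ext s x
  simp only [source]
  rw [truncSeries_congr (f := fun j => if j = 0 then 0 else E' j) fun j hj => by rw [(h j hj).1],
    truncSeries_congr (f := fun j => v' j s x) fun j hj => by rw [(h j hj).2],
    truncSeries_congr (f := fun j => (starRingEnd ℂ) (v' j s x)) fun j hj => by rw [(h j hj).2],
    truncSeries_congr (f := fun j => deriv (fun t => v' j t x) s) fun j hj => by rw [(h j hj).2],
    truncSeries_congr (f := fun j => iteratedDeriv 2 (fun t => v' j t x) s) fun j hj => by
      rw [(h j hj).2],
    truncSeries_congr (f := fun j => deriv (fun y => v' j s y) x) fun j hj => by rw [(h j hj).2]]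

/-! ### Floquet solutions -/

section Wronskian

variable {R : ℝ → ℝ} {a₀ : ℝ → ℂ}

/-- `a₀` solves `y'' + R y = 0` and has Wronskian `Im (conj a₀ · a₀') = 1` at `0`. -/
structure IsWronskianSol (R : ℝ → ℝ) (a₀ : ℝ → ℂ) : Prop where
  differentiable : Differentiable ℝ a₀
  ode : ∀ s, HasDerivAt (deriv a₀) (-((R s : ℂ) * a₀ s)) s
  wronskian : ((starRingEnd ℂ) (a₀ 0) * deriv a₀ 0).im = 1

theorem IsFloquet.isWronskianSol {Λ : ℝ} {β : ℝ → ℝ} (h : IsFloquet R Λ a₀ β) :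
    IsWronskianSol R a₀ := ⟨h.differentiable, h.ode, h.wronskian⟩

theorem hasDerivAt_re {f : ℝ → ℂ} {f' : ℂ} {s : ℝ} (h : HasDerivAt f f' s) :
    HasDerivAt (fun s => (f s).re) f'.re s :=
  Complex.reCLM.hasFDerivAt.comp_hasDerivAt s h

theorem hasDerivAt_im {f : ℝ → ℂ} {f' : ℂ} {s : ℝ} (h : HasDerivAt f f' s) :
    HasDerivAt (fun s => (f s).im) f'.im s :=
  Complex.imCLM.hasFDerivAt.comp_hasDerivAt s h

/-- The Wronskian of `a₀` and its complex conjugate is constant. -/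
theorem wronskian_const (hd : Differentiable ℝ a₀)
    (ho : ∀ s, HasDerivAt (deriv a₀) (-((R s : ℂ) * a₀ s)) s) (s : ℝ) :
    ((starRingEnd ℂ) (a₀ s) * deriv a₀ s).im = ((starRingEnd ℂ) (a₀ 0) * deriv a₀ 0).im := by
  have h : ∀ s, HasDerivAt (fun s => ((starRingEnd ℂ) (a₀ s) * deriv a₀ s).im) 0 s := by
    intro s
    have h1 : HasDerivAt (fun s => (starRingEnd ℂ) (a₀ s)) ((starRingEnd ℂ) (deriv a₀ s)) s :=
      (hd s).hasDerivAt.star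
    refine (hasDerivAt_im (h1.mul (ho s))).congr_deriv ?_
    simp only [Complex.add_im, Complex.mul_im, Complex.conj_re, Complex.conj_im, Complex.neg_im,
      Complex.neg_re, Complex.mul_re, Complex.ofReal_re, Complex.ofReal_im]
    ring
  exact is_const_of_deriv_eq_zero (fun s => (h s).differentiableAt) (fun s => (h s).deriv) s 0

theorem IsWronskianSol.wronskian_eq (h : IsWronskianSol R a₀) (s : ℝ) :
    (a₀ s).re * (deriv a₀ s).im - (a₀ s).im * (deriv a₀ s).re = 1 := by
  have := wronskian_const h.differentiable h.ode s
  rw [h.wronskian] at this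
  simp only [Complex.mul_im, Complex.conj_re, Complex.conj_im] at this
  linarith

theorem IsWronskianSol.ne_zero (h : IsWronskianSol R a₀) (s : ℝ) : a₀ s ≠ 0 := by
  intro h0
  have := h.wronskian_eq s
  simp [h0] at this

theorem IsWronskianSol.contDiff (h : IsWronskianSol R a₀) (hR : ContDiff ℝ (⊤ : ℕ∞) R) :
    ContDiff ℝ (⊤ : ℕ∞) a₀ ∧ ContDiff ℝ (⊤ : ℕ∞) (deriv a₀) := by
  have key : ∀ n : ℕ, ContDiff ℝ n a₀ ∧ ContDiff ℝ n (deriv a₀) := by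
    intro n
    induction n with
    | zero =>
      refine ⟨contDiff_zero.2 h.differentiable.continuous, contDiff_zero.2 ?_⟩
      exact continuous_iff_continuousAt.2 fun s => (h.ode s).continuousAt
    | succ n ih =>
      push_cast
      refine ⟨contDiff_succ_iff_deriv.2 ⟨h.differentiable, by simp, ih.2⟩,
        contDiff_succ_iff_deriv.2 ⟨fun s => (h.ode s).differentiableAt, by simp, ?_⟩⟩
      have : deriv (deriv a₀) = fun s => -((R s : ℂ) * a₀ s) := funext fun s => (h.ode s).deriv
      rw [this]
      exact (((Complex.ofRealCLM.contDiff.comp hR).of_le (by exact_mod_cast le_top)).mul ih.1).neg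
  exact ⟨contDiff_infty.2 fun n => (key n).1, contDiff_infty.2 fun n => (key n).2⟩

theorem exp_logNorm (h : IsWronskianSol R a₀) (s : ℝ) : Real.exp (logNorm a₀ s) = ‖a₀ s‖ :=
  Real.exp_log (norm_pos_iff.2 (h.ne_zero s))

/-- `α = log |a₀|` and its first two derivatives; `α'' + α'² + R = e^{-4α}` is the real part of
`a₀'' + R a₀ = 0` divided by `a₀`. -/
theorem hasDerivAt_logNorm (h : IsWronskianSol R a₀) (s : ℝ) :
    HasDerivAt (logNorm a₀) (((a₀ s).re * (deriv a₀ s).re + (a₀ s).im * (deriv a₀ s).im) *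
      Real.exp (-2 * logNorm a₀ s)) s := by
  have hx := hasDerivAt_re (h.differentiable s).hasDerivAt
  have hy := hasDerivAt_im (h.differentiable s).hasDerivAt
  have e1 : logNorm a₀ = fun s => 1 / 2 * Real.log ((a₀ s).re ^ 2 + (a₀ s).im ^ 2) := by
    ext s
    rw [logNorm, Complex.norm_def, Real.log_sqrt (Complex.normSq_nonneg _), Complex.normSq_apply]
    ring_nf
  have hN : 0 < (a₀ s).re ^ 2 + (a₀ s).im ^ 2 := by
    have := Complex.normSq_pos.2 (h.ne_zero s)
    rw [Complex.normSq_apply] at this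
    linarith
  have e2 : Real.exp (-2 * logNorm a₀ s) = ((a₀ s).re ^ 2 + (a₀ s).im ^ 2)⁻¹ := by
    rw [e1]
    simp only
    rw [show -2 * (1 / 2 * Real.log ((a₀ s).re ^ 2 + (a₀ s).im ^ 2)) =
      -Real.log ((a₀ s).re ^ 2 + (a₀ s).im ^ 2) by ring, Real.exp_neg, Real.exp_log hN]
  rw [e2, e1]
  refine ((((hx.pow 2).add (hy.pow 2)).log hN.ne').const_mul (1 / 2)).congr_deriv ?_
  simp only [Pi.add_apply, Pi.pow_apply]
  field_simp
  push_cast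
  ring

theorem hasDerivAt_deriv_logNorm (h : IsWronskianSol R a₀) (s : ℝ) :
    HasDerivAt (deriv (logNorm a₀))
      (Real.exp (-4 * logNorm a₀ s) - deriv (logNorm a₀) s ^ 2 - R s) s := by
  have e : deriv (logNorm a₀) = fun s =>
      ((a₀ s).re * (deriv a₀ s).re + (a₀ s).im * (deriv a₀ s).im) *
        Real.exp (-2 * logNorm a₀ s) := funext fun s => (hasDerivAt_logNorm h s).deriv
  have hx := hasDerivAt_re (h.differentiable s).hasDerivAt
  have hy := hasDerivAt_im (h.differentiable s).hasDerivAt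
  have hx' := hasDerivAt_re (h.ode s)
  have hy' := hasDerivAt_im (h.ode s)
  have hE := ((hasDerivAt_logNorm h s).const_mul (-2)).exp
  have h1 := ((hx.mul hx').add (hy.mul hy')).mul hE
  rw [e]
  refine h1.congr_deriv ?_
  have hw := h.wronskian_eq s
  have hN : Real.exp (-2 * logNorm a₀ s) * ((a₀ s).re ^ 2 + (a₀ s).im ^ 2) = 1 := by
    have h2 : (a₀ s).re ^ 2 + (a₀ s).im ^ 2 = Real.exp (2 * logNorm a₀ s) := by
      rw [two_mul, Real.exp_add, exp_logNorm h, ← sq, Complex.sq_norm, Complex.normSq_apply]; ring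
    rw [h2, ← Real.exp_add]; simp
  have h4 : Real.exp (-4 * logNorm a₀ s) = Real.exp (-2 * logNorm a₀ s) ^ 2 := by
    rw [← Real.exp_nat_mul]; congr 1; push_cast; ring
  rw [h4]
  set x := (a₀ s).re
  set y := (a₀ s).im
  set p := (deriv a₀ s).re
  set q := (deriv a₀ s).im
  set N := Real.exp (-2 * logNorm a₀ s)
  simp only [Pi.add_apply, Pi.mul_apply, Complex.neg_re, Complex.neg_im, Complex.mul_re,
    Complex.mul_im, Complex.ofReal_re, Complex.ofReal_im]
  -- `(x p + y q)² + (x q - y p)² = (x² + y²) (p² + q²)`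
  have hw2 : (x * q - y * p) ^ 2 = 1 := by rw [hw]; ring
  linear_combination (-R s - N * (p ^ 2 + q ^ 2)) * hN + N ^ 2 * hw2

theorem contDiff_logNorm (h : IsWronskianSol R a₀) (hR : ContDiff ℝ (⊤ : ℕ∞) R) :
    ContDiff ℝ (⊤ : ℕ∞) (logNorm a₀) :=
  ContDiff.log ((h.contDiff hR).1.norm ℝ h.ne_zero) fun s => (norm_pos_iff.2 (h.ne_zero s)).ne'

/-- The polar form of `a₀`, with argument the primitive of `e^{-2α} = |a₀|⁻²`. -/
theorem polar_integral (h : IsWronskianSol R a₀) (h0 : 0 < (a₀ 0).re ∧ (a₀ 0).im = 0) (s : ℝ) :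
    a₀ s = (‖a₀ s‖ : ℂ) *
      Complex.exp (Complex.I * ((∫ t in (0 : ℝ)..s, Real.exp (-2 * logNorm a₀ t) : ℝ) : ℂ)) := by
  set B : ℝ → ℝ := fun s => ∫ t in (0 : ℝ)..s, Real.exp (-2 * logNorm a₀ t) with hB
  have hαc : Continuous (logNorm a₀) :=
    continuous_iff_continuousAt.2 fun s => (hasDerivAt_logNorm h s).continuousAt
  have hBd : ∀ s, HasDerivAt B (Real.exp (-2 * logNorm a₀ s)) s := fun s =>
    (by fun_prop : Continuous fun t => Real.exp (-2 * logNorm a₀ t)).integral_hasStrictDerivAt 0 s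
      |>.hasDerivAt
  set H : ℝ → ℂ := fun s => a₀ s * Complex.exp (-((logNorm a₀ s : ℂ) + Complex.I * (B s : ℂ)))
    with hH
  have hHd : ∀ s, HasDerivAt H 0 s := by
    intro s
    have h1 := (((hasDerivAt_logNorm h s).ofReal_comp).add
      (((hBd s).ofReal_comp).const_mul Complex.I)).neg.cexp
    refine ((h.differentiable s).hasDerivAt.mul h1).congr_deriv ?_
    have hN : (Real.exp (-2 * logNorm a₀ s) : ℂ) * (a₀ s * (starRingEnd ℂ) (a₀ s)) = 1 := by
      rw [Complex.mul_conj, Complex.normSq_eq_norm_sq, ← exp_logNorm h, ← Complex.ofReal_mul,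
        ← Real.exp_nat_mul, ← Real.exp_add]
      push_cast
      simp
    have hc : ((starRingEnd ℂ) (a₀ s) * deriv a₀ s) =
        (((a₀ s).re * (deriv a₀ s).re + (a₀ s).im * (deriv a₀ s).im : ℝ) : ℂ) + Complex.I := by
      have hw := h.wronskian_eq s
      apply Complex.ext
      · simp
      · simp only [Complex.mul_im, Complex.conj_re, Complex.conj_im, Complex.add_im,
          Complex.ofReal_im, Complex.I_im, zero_add]
        linarith
    simp only [Pi.add_apply, Pi.neg_apply]
    push_cast at hN hc ⊢
    set e := Complex.exp (-2 * (logNorm a₀ s : ℂ))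
    set X := Complex.exp (-((logNorm a₀ s : ℂ) + Complex.I * (B s : ℂ)))
    linear_combination (-(deriv a₀ s * X)) * hN + X * a₀ s * e * hc
  have hc : H s = H 0 :=
    is_const_of_deriv_eq_zero (fun s => (hHd s).differentiableAt) (fun s => (hHd s).deriv) s 0
  have hre : a₀ 0 = ((a₀ 0).re : ℂ) := Complex.ext rfl (by simp [h0.2])
  have h1 : H 0 = 1 := by
    have : ‖a₀ 0‖ = (a₀ 0).re := by
      conv_lhs => rw [hre]
      rw [Complex.norm_real, Real.norm_of_nonneg h0.1.le]
    simp only [hH, hB, intervalIntegral.integral_same, Complex.ofReal_zero, mul_zero, add_zero]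
    rw [← Complex.ofReal_neg, ← Complex.ofReal_exp, Real.exp_neg, exp_logNorm h, this, hre]
    rw [Complex.ofReal_re, ← Complex.ofReal_mul, mul_inv_cancel₀ h0.1.ne', Complex.ofReal_one]
  rw [h1] at hc
  simp only [hH] at hc
  have h2 : Complex.exp (-((logNorm a₀ s : ℂ) + Complex.I * (B s : ℂ))) *
      ((‖a₀ s‖ : ℂ) * Complex.exp (Complex.I * (B s : ℂ))) = 1 := by
    rw [← exp_logNorm h, Complex.ofReal_exp, ← Complex.exp_add, ← Complex.exp_add]
    simp
  calc a₀ s = a₀ s * (Complex.exp (-((logNorm a₀ s : ℂ) + Complex.I * (B s : ℂ))) *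
      ((‖a₀ s‖ : ℂ) * Complex.exp (Complex.I * (B s : ℂ)))) := by rw [h2, mul_one]
    _ = _ := by rw [← mul_assoc, hc, one_mul]

end Wronskian

/-- Two continuous arguments of the same function that agree at `0` agree everywhere. -/
theorem arg_unique {f g : ℝ → ℝ} (hf : Continuous f) (hg : Continuous g) (h0 : f 0 = g 0)
    (h : ∀ s, Complex.exp (Complex.I * (f s : ℂ)) = Complex.exp (Complex.I * (g s : ℂ))) :
    f = g := by
  have hcos : ∀ s, Complex.exp (Complex.I * ((f s - g s : ℝ) : ℂ)) = 1 := by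
    intro s
    push_cast
    rw [mul_sub, Complex.exp_sub, h, div_self (Complex.exp_ne_zero _)]
  have hint : ∀ s, ∃ n : ℤ, f s - g s = n * (2 * Real.pi) := by
    intro s
    obtain ⟨n, hn⟩ := Complex.exp_eq_one_iff.1 (hcos s)
    refine ⟨n, ?_⟩
    have : Complex.I * ((f s - g s : ℝ) : ℂ) = Complex.I * ((n * (2 * Real.pi) : ℝ) : ℂ) := by
      rw [hn]; push_cast; ring
    exact_mod_cast mul_left_cancel₀ Complex.I_ne_zero this
  have hpi : ∀ c : ℝ, c = Real.pi ∨ c = -Real.pi → c ∉ Set.range (fun s => f s - g s) := by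
    rintro c hc ⟨s, hs⟩
    have h1 := congrArg Complex.re (hcos s)
    simp only at hs
    rw [hs, mul_comm, Complex.exp_ofReal_mul_I_re, Complex.one_re] at h1
    rcases hc with rfl | rfl
    · rw [Real.cos_pi] at h1; norm_num at h1
    · rw [Real.cos_neg, Real.cos_pi] at h1; norm_num at h1
  have hcont : Continuous (fun s => f s - g s) := hf.sub hg
  have hpos := Real.pi_pos
  ext s
  obtain ⟨n, hn⟩ := hint s
  rcases lt_trichotomy n 0 with h1 | h1 | h1
  · have : (n : ℝ) ≤ -1 := by exact_mod_cast (by omega : n ≤ -1)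
    exact absurd (mem_range_of_exists_le_of_exists_ge hcont ⟨s, by rw [hn]; nlinarith⟩
      ⟨0, by rw [h0]; linarith⟩) (hpi (-Real.pi) (Or.inr rfl))
  · rw [h1] at hn; simp at hn; linarith
  · have : (1 : ℝ) ≤ n := by exact_mod_cast h1
    exact absurd (mem_range_of_exists_le_of_exists_ge hcont ⟨0, by rw [h0]; linarith⟩
      ⟨s, by rw [hn]; nlinarith⟩) (hpi Real.pi (Or.inl rfl))

section Floquet

variable {R : ℝ → ℝ} {Λ : ℝ} {a₀ : ℝ → ℂ} {β : ℝ → ℝ}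

theorem IsFloquet.hasDerivAt_arg (h : IsFloquet R Λ a₀ β) (s : ℝ) :
    HasDerivAt β (Real.exp (-2 * logNorm a₀ s)) s := by
  have hW := h.isWronskianSol
  have hαc : Continuous (logNorm a₀) :=
    continuous_iff_continuousAt.2 fun s => (hasDerivAt_logNorm hW s).continuousAt
  have hBd : ∀ s, HasDerivAt (fun s => ∫ t in (0 : ℝ)..s, Real.exp (-2 * logNorm a₀ t))
      (Real.exp (-2 * logNorm a₀ s)) s := fun s =>
    (by fun_prop : Continuous fun t => Real.exp (-2 * logNorm a₀ t)).integral_hasStrictDerivAt 0 s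
      |>.hasDerivAt
  have : β = fun s => ∫ t in (0 : ℝ)..s, Real.exp (-2 * logNorm a₀ t) := by
    refine arg_unique h.arg_continuous
      (continuous_iff_continuousAt.2 fun s => (hBd s).continuousAt) (by simp [h.arg_zero])
      fun s => ?_
    have h2 : (‖a₀ s‖ : ℂ) ≠ 0 := by simpa using hW.ne_zero s
    have cancel : ∀ z w : ℂ, a₀ s = (‖a₀ s‖ : ℂ) * z → a₀ s = (‖a₀ s‖ : ℂ) * w → z = w :=
      fun z w hz hw => mul_left_cancel₀ h2 (hz.symm.trans hw)
    exact cancel _ _ (h.polar s) (polar_integral hW h.init_pos s)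
  rw [this]
  exact hBd s

theorem IsFloquet.logNorm_periodic (h : IsFloquet R Λ a₀ β) (s : ℝ) :
    logNorm a₀ (s + 2 * Real.pi) = logNorm a₀ s := by
  rw [logNorm, logNorm, h.norm_periodic]

theorem IsFloquet.monodromy (h : IsFloquet R Λ a₀ β) (s : ℝ) :
    a₀ (s + 2 * Real.pi) = Complex.exp (Complex.I * Λ) * a₀ s := by
  rw [h.polar (s + 2 * Real.pi), h.norm_periodic, h.arg_add]
  conv_rhs => rw [h.polar s]
  push_cast
  rw [mul_add, Complex.exp_add]
  ring

theorem exists_int_of_exp_I_mul_eq {x y : ℝ}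
    (h : Complex.exp (Complex.I * x) = Complex.exp (Complex.I * y)) :
    ∃ m : ℤ, x = y + 2 * Real.pi * m := by
  obtain ⟨m, hm⟩ := Complex.exp_eq_exp_iff_exists_int.1 h
  refine ⟨m, ?_⟩
  have : Complex.I * (x : ℂ) = Complex.I * ((y + 2 * Real.pi * m : ℝ) : ℂ) := by
    rw [hm]; push_cast; ring
  exact_mod_cast mul_left_cancel₀ Complex.I_ne_zero this

/-- The two multipliers are the eigenvalues of `M`. -/
theorem mem_multipliers_iff {M : Matrix (Fin 2) (Fin 2) ℝ} {lam : ℝ} (h : HasMultipliers M lam)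
    (z : ℂ) : (z = Complex.exp (Complex.I * lam) ∨ z = Complex.exp (-(Complex.I * lam))) ↔
      ∃ ξ : Fin 2 → ℂ, ξ ≠ 0 ∧ (M.map (fun t : ℝ => (t : ℂ))).mulVec ξ = z • ξ := by
  have h1 : z ∈ (M.map (fun t : ℝ => (t : ℂ))).charpoly.roots ↔
      (z = Complex.exp (Complex.I * lam) ∨ z = Complex.exp (-(Complex.I * lam))) := by
    rw [show (M.map (fun t : ℝ => (t : ℂ))).charpoly.roots = _ from h]
    simp
  rw [← h1, Polynomial.mem_roots (Matrix.charpoly_monic _).ne_zero, Polynomial.IsRoot.def,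
    Matrix.eval_charpoly, ← Matrix.exists_mulVec_eq_zero_iff]
  refine exists_congr fun ξ => and_congr_right fun _ => ?_
  rw [Matrix.sub_mulVec, sub_eq_zero, Matrix.scalar_apply, ← Matrix.smul_one_eq_diagonal,
    Matrix.smul_mulVec, Matrix.one_mulVec]
  exact eq_comm

/-- The Floquet multiplier `e^{iΛ}` is one of the eigenvalues `e^{±i lam}` of the linearized
Poincaré map, since `(a₀, a₀' / 2)` is a complex solution of its defining system. -/
theorem IsFloquet.multiplier (h : IsFloquet R Λ a₀ β) {M : Matrix (Fin 2) (Fin 2) ℝ}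
    (hM : IsLinearizedPoincareMap R M) {lam : ℝ} (hlam : HasMultipliers M lam) :
    Complex.exp (Complex.I * Λ) = Complex.exp (Complex.I * lam) ∨
      Complex.exp (Complex.I * Λ) = Complex.exp (-(Complex.I * lam)) := by
  have hW := h.isWronskianSol
  rw [mem_multipliers_iff hlam]
  refine ⟨![a₀ 0, deriv a₀ 0 / 2], fun h0 => hW.ne_zero 0 (congrFun h0 0), ?_⟩
  have hd : ∀ s, HasDerivAt a₀ (deriv a₀ s) s := fun s => (h.differentiable s).hasDerivAt
  have hre := hM (fun s => (a₀ s).re) (fun s => (deriv a₀ s).re / 2)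
    (fun s => (hasDerivAt_re (hd s)).congr_deriv (by ring))
    (fun s => ((hasDerivAt_re (h.ode s)).div_const 2).congr_deriv (by simp; ring))
  have him := hM (fun s => (a₀ s).im) (fun s => (deriv a₀ s).im / 2)
    (fun s => (hasDerivAt_im (hd s)).congr_deriv (by ring))
    (fun s => ((hasDerivAt_im (h.ode s)).div_const 2).congr_deriv (by simp; ring))
  have m0 := h.monodromy 0
  have m1 : deriv a₀ (2 * Real.pi) = Complex.exp (Complex.I * Λ) * deriv a₀ 0 := by
    have : deriv (fun s => a₀ (s + 2 * Real.pi)) 0 =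
        deriv (fun s => Complex.exp (Complex.I * Λ) * a₀ s) 0 :=
      congrArg (fun f => deriv f 0) (funext h.monodromy)
    rwa [deriv_comp_add_const, deriv_const_mul_field, zero_add] at this
  rw [zero_add] at m0
  have hre0 := congrFun hre 0
  have hre1 := congrFun hre 1
  have him0 := congrFun him 0
  have him1 := congrFun him 1
  simp only [Matrix.mulVec, dotProduct, Fin.sum_univ_two, Matrix.cons_val_zero, Matrix.cons_val_one]
    at hre0 hre1 him0 him1
  ext i
  fin_cases i
  · simp only [Matrix.mulVec, dotProduct, Fin.sum_univ_two, Matrix.cons_val_zero,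
      Matrix.cons_val_one, Matrix.map_apply, Pi.smul_apply, smul_eq_mul, Fin.zero_eta]
    rw [← m0]
    apply Complex.ext
    · rw [hre0]; simp
    · rw [him0]; simp
  · simp only [Matrix.mulVec, dotProduct, Fin.sum_univ_two, Matrix.cons_val_zero,
      Matrix.cons_val_one, Matrix.map_apply, Pi.smul_apply, smul_eq_mul, Fin.mk_one]
    have m2 : Complex.exp (Complex.I * Λ) * (deriv a₀ 0 / 2) = deriv a₀ (2 * Real.pi) / 2 := by
      rw [m1]; ring
    rw [m2]
    apply Complex.ext
    · simp only [Complex.div_ofNat_re]; rw [hre1]; simp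
    · simp only [Complex.div_ofNat_im]; rw [him1]; simp

end Floquet

/-! ### Small divisors -/

/-- The Diophantine condition in the form in which it is used: `|e^{iΘ} - 1|` is comparable to the
distance of `Θ` to `2πℤ`, and for `Θ = qΛ + πn` this distance is `π |p - |q| lam / π|` for some integer
`p`. -/
theorem small_divisors {lam Λ : ℝ} (hd : IsDiophantine lam)
    (hΛ : Complex.exp (Complex.I * Λ) = Complex.exp (Complex.I * lam) ∨
      Complex.exp (Complex.I * Λ) = Complex.exp (-(Complex.I * lam))) :
    ∃ c : ℝ, 0 < c ∧ ∃ m : ℕ, ∀ q n : ℤ, q ≠ 0 →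
      c ≤ (|(q : ℝ)| + 1) ^ m * ‖Complex.exp (Complex.I * ((q * Λ + Real.pi * n : ℝ) : ℂ)) - 1‖ := by
  have hpi := Real.pi_pos
  obtain ⟨σ, hσ, l, hl⟩ : ∃ σ : ℤ, (σ = 1 ∨ σ = -1) ∧ ∃ l : ℤ, Λ = σ * lam + 2 * Real.pi * l := by
    rcases hΛ with h | h
    · obtain ⟨l, hl⟩ := exists_int_of_exp_I_mul_eq h
      exact ⟨1, Or.inl rfl, l, by simpa using hl⟩
    · obtain ⟨l, hl⟩ := exists_int_of_exp_I_mul_eq (y := -lam) (h.trans (by push_cast; ring_nf))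
      exact ⟨-1, Or.inr rfl, l, by simpa using hl⟩
  obtain ⟨τ, μ, hτ, hμ, H⟩ := hd
  set K : ℝ := 1 + |lam| / Real.pi with hK
  have hK1 : 1 ≤ K := by
    have : 0 ≤ |lam| / Real.pi := by positivity
    rw [hK]
    linarith
  set m : ℕ := ⌈τ⌉₊
  refine ⟨2 * μ / K ^ m, by positivity, m, fun q n hq => ?_⟩
  set Θ : ℝ := q * Λ + Real.pi * n with hΘ
  set N : ℤ := round (Θ / (2 * Real.pi)) with hN
  set ψ : ℝ := Θ - 2 * Real.pi * N with hψ
  have hψpi : |ψ| ≤ Real.pi := by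
    have h1 := abs_sub_round (Θ / (2 * Real.pi))
    have h2 : ψ = (2 * Real.pi) * (Θ / (2 * Real.pi) - N) := by rw [hψ]; field_simp
    rw [h2, abs_mul, abs_of_pos (by positivity)]
    rw [← hN] at h1
    nlinarith
  have hexp : Complex.exp (Complex.I * (Θ : ℂ)) = Complex.exp (Complex.I * (ψ : ℂ)) := by
    refine Complex.exp_eq_exp_iff_exists_int.2 ⟨N, ?_⟩
    rw [hψ]; push_cast; ring
  have hnorm : 2 / Real.pi * |ψ| ≤ ‖Complex.exp (Complex.I * (Θ : ℂ)) - 1‖ := by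
    rw [hexp, Complex.norm_exp_I_mul_ofReal_sub_one, Real.norm_eq_abs, abs_mul, abs_two]
    have h1 := Real.mul_abs_le_abs_sin (x := ψ / 2) (by rw [abs_div, abs_two]; linarith)
    rw [abs_div, abs_two] at h1
    calc 2 / Real.pi * |ψ| = 2 * (2 / Real.pi * (|ψ| / 2)) := by ring
      _ ≤ 2 * |Real.sin (ψ / 2)| := by gcongr
  -- `ψ / π` is, up to sign, of the form `p - |q| lam / π`
  obtain ⟨ρ, hρ, hρq⟩ : ∃ ρ : ℤ, (ρ = 1 ∨ ρ = -1) ∧ σ * q = -ρ * (q.natAbs : ℤ) := by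
    rcases hσ with rfl | rfl <;> rcases Int.natAbs_eq q with h | h
    · exact ⟨-1, Or.inr rfl, by rw [neg_neg, one_mul, one_mul]; exact h⟩
    · exact ⟨1, Or.inl rfl, by rw [neg_one_mul, one_mul]; exact h⟩
    · exact ⟨1, Or.inl rfl, by rw [neg_one_mul, neg_one_mul, neg_inj]; exact h⟩
    · exact ⟨-1, Or.inr rfl, by rw [neg_neg, one_mul, neg_one_mul]; omega⟩
  set P : ℤ := 2 * l * q + n - 2 * N with hP
  have hρρ : (ρ : ℝ) * ρ = 1 := by rcases hρ with rfl | rfl <;> norm_num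
  have hρabs : |(ρ : ℝ)| = 1 := by rcases hρ with rfl | rfl <;> norm_num
  have hform : ψ / Real.pi = ρ * (((ρ * P : ℤ) : ℝ) - (q.natAbs : ℝ) * (lam / Real.pi)) := by
    have h1 : (σ : ℝ) * q = -ρ * (q.natAbs : ℝ) := by
      have h := congrArg (fun t : ℤ => (t : ℝ)) hρq
      simpa only [Int.cast_mul, Int.cast_neg, Int.cast_natCast] using h
    have h2 : ψ = P * Real.pi + (σ * q) * lam := by
      rw [hψ, hΘ, hl, hP]; push_cast; ring
    rw [h2, h1]
    push_cast
    field_simp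
    linear_combination (-P * Real.pi) * hρρ
  have hform' : |ψ| / Real.pi = |((ρ * P : ℤ) : ℝ) - (q.natAbs : ℝ) * (lam / Real.pi)| := by
    rw [← abs_of_pos hpi, ← abs_div, abs_of_pos hpi, hform, abs_mul, hρabs, one_mul]
  have hq1 : 1 ≤ q.natAbs := Int.natAbs_pos.2 hq
  have hH := H (ρ * P) q.natAbs (by
    intro h0
    rw [Prod.mk.injEq] at h0
    omega)
  rw [← hform'] at hH
  set p : ℤ := ρ * P
  set Q : ℝ := (q.natAbs : ℝ) with hQ
  have hQq : Q = |(q : ℝ)| := by rw [hQ, Nat.cast_natAbs, Int.cast_abs]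
  have hQ1 : 1 ≤ Q := by rw [hQ]; exact_mod_cast hq1
  have hp : |(p : ℝ)| + Q ≤ K * (Q + 1) := by
    have h1 : |(p : ℝ)| ≤ |(p : ℝ) - Q * (lam / Real.pi)| + |Q * (lam / Real.pi)| := by
      have := abs_add_le ((p : ℝ) - Q * (lam / Real.pi)) (Q * (lam / Real.pi))
      simpa using this
    rw [← hform', abs_mul, abs_div, abs_of_pos hpi, abs_of_pos (by linarith : 0 < Q)] at h1
    have h2 : |ψ| / Real.pi ≤ 1 := (div_le_one hpi).2 hψpi
    have h3 : 0 ≤ |lam| / Real.pi := by positivity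
    rw [hK]
    nlinarith
  have hbase : 0 < |(p : ℝ)| + Q := by positivity
  have hpow : (|(p : ℝ)| + Q) ^ τ ≤ K ^ m * (Q + 1) ^ m := by
    calc (|(p : ℝ)| + Q) ^ τ ≤ (K * (Q + 1)) ^ τ :=
          Real.rpow_le_rpow hbase.le hp hτ.le
      _ ≤ (K * (Q + 1)) ^ (m : ℝ) :=
          Real.rpow_le_rpow_of_exponent_le (by nlinarith) (Nat.le_ceil τ)
      _ = K ^ m * (Q + 1) ^ m := by rw [Real.rpow_natCast, mul_pow]
  rw [← hQq]
  have hK0 : 0 < K ^ m := by positivity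
  have hQ0 : 0 < (Q + 1) ^ m := by positivity
  have h5 : μ / (K ^ m * (Q + 1) ^ m) ≤ |ψ| / Real.pi :=
    (div_le_div_of_nonneg_left hμ.le (Real.rpow_pos_of_pos hbase τ) hpow).trans hH
  calc 2 * μ / K ^ m = (Q + 1) ^ m * (2 * (μ / (K ^ m * (Q + 1) ^ m))) := by field_simp
    _ ≤ (Q + 1) ^ m * (2 * (|ψ| / Real.pi)) := by gcongr
    _ = (Q + 1) ^ m * (2 / Real.pi * |ψ|) := by ring
    _ ≤ _ := by gcongr

/-! ### Reduction to the harmonic oscillator -/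

/-- Each derivative of the phase `e^{i (c s + θ(s) x²)}` produces a polynomial factor in `x`. -/
theorem quadraticPhase_mem_temperateFamily (c : ℝ) {θ : ℝ → ℝ} (hθ : ContDiff ℝ (⊤ : ℕ∞) θ) {T : ℝ}
    (hT : 0 < T) (hp : ∀ s, θ (s + T) = θ s) :
    (fun s x => Complex.exp (Complex.I * ((c * s + θ s * x ^ 2 : ℝ) : ℂ))) ∈ temperateFamily := by
  set E : ℝ → ℝ → ℂ := fun s x => Complex.exp (Complex.I * ((c * s + θ s * x ^ 2 : ℝ) : ℂ)) with hE
  have hθc : Continuous θ := hθ.continuous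
  have hθd : ContDiff ℝ (⊤ : ℕ∞) (deriv θ) := (contDiff_infty_iff_deriv.1 hθ).2
  have hx2 := mul_mem_temperateFamily snd_mem_temperateFamily snd_mem_temperateFamily
  have h1 := periodic_mem_temperateFamily (Complex.ofRealCLM.contDiff.comp hθ) hT
    (fun s => by simp [hp])
  have h2 := periodic_mem_temperateFamily (Complex.ofRealCLM.contDiff.comp hθd) hT (fun s => by
    have : deriv θ (s + T) = deriv θ s := by
      rw [← deriv_comp_add_const]
      exact congrArg (fun g => deriv g s) (funext hp)
    simp [this])
  have g1 := temperateFamily.smul_mem Complex.I (add_mem (const_mem_temperateFamily (c : ℂ))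
    (mul_mem_temperateFamily h2 hx2))
  have g2 := temperateFamily.smul_mem (2 * Complex.I) (mul_mem_temperateFamily h1
    snd_mem_temperateFamily)
  refine subset_jet_partials {F | ∃ g ∈ temperateFamily, F = g * E} ?_ ?_ E
    ⟨fun _ _ => 1, const_mem_temperateFamily 1, by ext s x; simp⟩
  · rintro _ ⟨g, hg, rfl⟩
    obtain ⟨hgc, C, k, hC⟩ := jet_le hg
    refine ⟨hgc.mul (by simp only [hE]; fun_prop), C, k, fun s x => ?_⟩
    simp only [Pi.mul_apply, hE, norm_mul]
    rw [mul_comm Complex.I, Complex.norm_exp_ofReal_mul_I, mul_one]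
    exact hC s x
  · rintro _ ⟨g, hg, rfl⟩
    refine ⟨_, Submodule.mem_sup_left (Submodule.subset_span
      ⟨_, add_mem (dS_mem_jet hg) (mul_mem_temperateFamily hg g1), rfl⟩), _,
      Submodule.mem_sup_left (Submodule.subset_span
      ⟨_, add_mem (dX_mem_jet hg) (mul_mem_temperateFamily hg g2), rfl⟩), fun s x => ?_, fun s x => ?_⟩
    · have hd : HasDerivAt (fun t => E t x) _ s :=
        (((((hasDerivAt_id s).const_mul c).add
          (((contDiff_infty_iff_deriv.1 hθ).1 s).hasDerivAt.mul_const (x ^ 2))).ofReal_comp).const_mul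
            Complex.I).cexp
      refine ((hasDerivAt_dS hg s x).mul hd).congr_deriv ?_
      simp only [Pi.add_apply, Pi.mul_apply, Pi.smul_apply, smul_eq_mul, hE, id, Function.comp,
        Complex.ofRealCLM_apply]
      push_cast
      ring
    · have hd : HasDerivAt (fun y => E s y) _ x :=
        ((((hasDerivAt_pow 2 x).const_mul (θ s)).const_add (c * s)).ofReal_comp.const_mul
          Complex.I).cexp
      refine ((hasDerivAt_dX hg s x).mul hd).congr_deriv ?_
      simp only [Pi.add_apply, Pi.mul_apply, Pi.smul_apply, smul_eq_mul, hE, Function.comp,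
        Complex.ofRealCLM_apply]
      push_cast
      ring

/-- The factor `e^{-i s e} e^{i α' x² / 2} e^{-α / 2}` relating `v(s, x)` to the function
`u(s, x e^{-α})` evolving under the harmonic oscillator. -/
noncomputable def gauge (a₀ : ℝ → ℂ) (e : ℝ) (s x : ℝ) : ℂ :=
  Complex.exp (Complex.I * ((-e * s + deriv (logNorm a₀) s / 2 * x ^ 2 : ℝ) : ℂ)) *
    (Real.exp (-(logNorm a₀ s) / 2) : ℂ)

/-- The inverse of `gauge`, in the variables `(s, y)` with `y = x e^{-α}`. -/
noncomputable def gaugeInv (a₀ : ℝ → ℂ) (e : ℝ) (s y : ℝ) : ℂ :=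
  Complex.exp (Complex.I *
    ((e * s + -(deriv (logNorm a₀) s / 2 * Real.exp (2 * logNorm a₀ s)) * y ^ 2 : ℝ) : ℂ)) *
    (Real.exp (logNorm a₀ s / 2) : ℂ)

section Gauge

variable {R : ℝ → ℝ} {Λ : ℝ} {a₀ : ℝ → ℂ} {β : ℝ → ℝ}

theorem IsFloquet.deriv_logNorm_periodic (h : IsFloquet R Λ a₀ β) (s : ℝ) :
    deriv (logNorm a₀) (s + 2 * Real.pi) = deriv (logNorm a₀) s := by
  rw [← deriv_comp_add_const]
  exact congrArg (fun g => deriv g s) (funext h.logNorm_periodic)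

theorem real_periodic_mem {f : ℝ → ℝ} (hf : ContDiff ℝ (⊤ : ℕ∞) f)
    (hp : ∀ s, f (s + 2 * Real.pi) = f s) : (fun s _ => (f s : ℂ)) ∈ temperateFamily :=
  periodic_mem_temperateFamily (Complex.ofRealCLM.contDiff.comp hf) Real.two_pi_pos
    (fun s => by simp [hp])

theorem gauge_mem (h : IsFloquet R Λ a₀ β) (hR : ContDiff ℝ (⊤ : ℕ∞) R) (e : ℝ) :
    gauge a₀ e ∈ temperateFamily := by
  have hα := contDiff_logNorm h.isWronskianSol hR
  exact mul_mem_temperateFamily (quadraticPhase_mem_temperateFamily (-e)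
    ((contDiff_infty_iff_deriv.1 hα).2.div_const 2) Real.two_pi_pos
    fun s => by rw [h.deriv_logNorm_periodic])
    (real_periodic_mem (f := fun s => Real.exp (-(logNorm a₀ s) / 2)) (hα.neg.div_const 2).exp
      fun s => by rw [h.logNorm_periodic])

theorem gaugeInv_mem (h : IsFloquet R Λ a₀ β) (hR : ContDiff ℝ (⊤ : ℕ∞) R) (e : ℝ) :
    gaugeInv a₀ e ∈ temperateFamily := by
  have hα := contDiff_logNorm h.isWronskianSol hR
  exact mul_mem_temperateFamily (quadraticPhase_mem_temperateFamily e
    (((contDiff_infty_iff_deriv.1 hα).2.div_const 2).mul (contDiff_const.mul hα).exp).neg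
    Real.two_pi_pos fun s => by rw [h.deriv_logNorm_periodic, h.logNorm_periodic])
    (real_periodic_mem (f := fun s => Real.exp (logNorm a₀ s / 2)) (hα.div_const 2).exp
      fun s => by rw [h.logNorm_periodic])

/-- Rescaling of a Schwartz family by `e^{σ α(s)}` in the second variable. -/
theorem mul_rescale_mem (h : IsFloquet R Λ a₀ β) (hR : ContDiff ℝ (⊤ : ℕ∞) R) (σ : ℝ)
    {g F : ℝ → ℝ → ℂ} (hg : g ∈ temperateFamily) (hF : F ∈ schwartzFamily) :
    (fun s x => g s x * F s (x * Real.exp (σ * logNorm a₀ s))) ∈ schwartzFamily := by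
  have hα := contDiff_logNorm h.isWronskianSol hR
  have hα' := (contDiff_infty_iff_deriv.1 hα).2
  have hκ : ContDiff ℝ (⊤ : ℕ∞) (fun s => Real.exp (σ * logNorm a₀ s)) :=
    (contDiff_const.mul hα).exp
  obtain ⟨C, hC⟩ := bounded_of_periodic (f := fun s => ((σ * logNorm a₀ s : ℝ) : ℂ))
    (Complex.continuous_ofReal.comp (continuous_const.mul hα.continuous)) Real.two_pi_pos
    fun s => by rw [h.logNorm_periodic]
  refine mul_comp_mem_schwartzFamily hg hF (κ := fun s => Real.exp (σ * logNorm a₀ s))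
    (κ' := fun s => Real.exp (σ * logNorm a₀ s) * (σ * deriv (logNorm a₀) s)) (c := Real.exp (-C))
    (Real.exp_pos _) (fun s => ?_) (fun s => ?_)
    (real_periodic_mem hκ fun s => by rw [h.logNorm_periodic]) ?_
  · have := hC s
    rw [Complex.norm_real, Real.norm_eq_abs] at this
    exact Real.exp_le_exp.2 (neg_le_of_abs_le this)
  · exact (((contDiff_infty_iff_deriv.1 hα).1 s).hasDerivAt.const_mul σ).exp
  · have := mul_mem_temperateFamily (real_periodic_mem (hκ.mul (contDiff_const.mul hα'))
      fun s => by rw [h.logNorm_periodic, h.deriv_logNorm_periodic]) snd_mem_temperateFamily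
      (g := fun s _ => ((Real.exp (σ * logNorm a₀ s) * (σ * deriv (logNorm a₀) s) : ℝ) : ℂ))
    convert this using 1
    ext s x
    simp

/-- Conjugation of `i ∂_s + ½ ∂_x² - ½ R x² - e` by the gauge factor and the rescaling gives
`i ∂_s - e^{-2α} H` with the harmonic oscillator `H`.  The terms in `x ∂_x` cancel, and the terms in `x²`
combine to `e^{-2α} y² / 2` by the equation `α'' + α'² + R = e^{-4α}`. -/
theorem gauge_equation (h : IsFloquet R Λ a₀ β) {e : ℝ} {u : ℝ → ℝ → ℂ} (hu : u ∈ schwartzFamily)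
    (s x : ℝ) :
    let v : ℝ → ℝ → ℂ := fun s x => gauge a₀ e s x * u s (x * Real.exp (-1 * logNorm a₀ s))
    let y := x * Real.exp (-1 * logNorm a₀ s)
    Complex.I * deriv (fun t => v t x) s + 1 / 2 * iteratedDeriv 2 (fun y => v s y) x
        - 1 / 2 * ((R s * x ^ 2 : ℝ) : ℂ) * v s x - (e : ℂ) * v s x =
      gauge a₀ e s x * (Complex.I * dS u s y - (Real.exp (-2 * logNorm a₀ s) : ℂ) *
        (-(1 / 2) * dX (dX u) s y + 1 / 2 * (y : ℂ) ^ 2 * u s y)) := by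
  intro v y
  have hW := h.isWronskianSol
  set α := logNorm a₀ with hα
  have hαd : ∀ s, HasDerivAt α (deriv α s) s := fun s =>
    (hasDerivAt_logNorm hW s).differentiableAt.hasDerivAt
  have hα2 := hasDerivAt_deriv_logNorm hW
  -- derivatives of the gauge factor
  have hEs : HasDerivAt (fun t => gauge a₀ e t x)
      ((-Complex.I * e + Complex.I * ((Real.exp (-4 * α s) - deriv α s ^ 2 - R s : ℝ) : ℂ) / 2 * x ^ 2
        - ((deriv α s : ℝ) : ℂ) / 2) * gauge a₀ e s x) s := by
    have h1 := (((((hasDerivAt_id s).const_mul (-e)).add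
      (((hα2 s).div_const 2).mul_const (x ^ 2))).ofReal_comp).const_mul Complex.I).cexp
    have h2 := (((hαd s).neg.div_const 2).exp).ofReal_comp
    refine (h1.mul h2).congr_deriv ?_
    simp only [gauge, ← hα, Pi.add_apply, id, Pi.neg_apply]
    push_cast
    ring
  have hEx : ∀ x, HasDerivAt (fun x => gauge a₀ e s x)
      (Complex.I * ((deriv α s : ℝ) : ℂ) * x * gauge a₀ e s x) x := by
    intro x
    have h1 := (((((hasDerivAt_pow 2 x).const_mul (deriv α s / 2)).const_add (-e * s)).ofReal_comp).const_mul
      Complex.I).cexp.mul_const ((Real.exp (-(α s) / 2) : ℝ) : ℂ)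
    refine h1.congr_deriv ?_
    simp only [gauge, ← hα]
    push_cast
    ring
  -- derivatives of the rescaled function
  set κ : ℝ := Real.exp (-1 * α s) with hκ
  have hus : HasDerivAt (fun t => u t (x * Real.exp (-1 * α t)))
      (dS u s y - ((deriv α s : ℝ) : ℂ) * y * dX u s y) s := by
    have hFd : HasFDerivAt (fun z : ℝ × ℝ => u z.1 z.2)
        (fderiv ℝ (fun z : ℝ × ℝ => u z.1 z.2) (s, y)) (s, y) :=
      ((schwartzFamily_contDiff hu).differentiable (by simp) _).hasFDerivAt
    have e1 := (hasDerivAt_fst_fderiv (schwartzFamily_contDiff hu) s y).deriv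
    have e2 := (hasDerivAt_snd_fderiv (schwartzFamily_contDiff hu) s y).deriv
    have h3 := HasFDerivAt.comp_hasDerivAt (l := fun z : ℝ × ℝ => u z.1 z.2)
      (f := fun t => (t, x * Real.exp (-1 * α t))) s hFd
      ((hasDerivAt_id s).prodMk ((((hαd s).const_mul (-1)).exp).const_mul x))
    refine h3.congr_deriv ?_
    have : ((1 : ℝ), x * (Real.exp (-1 * α s) * (-1 * deriv α s))) =
        (1, 0) + (-(deriv α s * y)) • ((0 : ℝ), (1 : ℝ)) := by
      simp only [Prod.smul_mk, smul_eq_mul, mul_zero, mul_one, Prod.mk_add_mk, add_zero, zero_add,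
        Prod.mk.injEq, true_and, y]
      ring
    rw [this, map_add, map_smul, ← e1, ← e2, Complex.real_smul]
    simp only [dS, dX]
    push_cast
    ring
  have hux : ∀ w ∈ schwartzFamily, ∀ x, HasDerivAt (fun x => w s (x * κ)) (κ * dX w s (x * κ)) x := by
    intro w hw x
    have := (hasDerivAt_dX hw s (x * κ)).scomp x ((hasDerivAt_id x).mul_const κ)
    refine this.congr_deriv ?_
    simp
  have hvs : deriv (fun t => v t x) s = _ := (hEs.mul hus).deriv
  have hvx : deriv (fun x => v s x) = fun x =>
      Complex.I * ((deriv α s : ℝ) : ℂ) * x * gauge a₀ e s x * u s (x * κ) +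
        gauge a₀ e s x * (κ * dX u s (x * κ)) := by
    ext x
    exact ((hEx x).mul (hux u hu x)).deriv
  have hvxx : ∀ d, HasDerivAt (fun x : ℝ =>
      Complex.I * ((deriv α s : ℝ) : ℂ) * x * gauge a₀ e s x * u s (x * κ) +
        gauge a₀ e s x * (κ * dX u s (x * κ))) d x →
      iteratedDeriv 2 (fun x => v s x) x = d := fun d hd => by
    rw [iteratedDeriv_succ, iteratedDeriv_one, hvx]
    exact hd.deriv
  rw [hvs, hvxx _ (((((((hasDerivAt_id x).ofReal_comp).const_mul (Complex.I * ((deriv α s : ℝ) : ℂ))).mul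
      (hEx x))).mul (hux u hu x)).add
        ((hEx x).mul ((hux (dX u) (dX_mem_schwartzFamily hu) x).const_mul (κ : ℂ))))]
  have hκ2 : (Real.exp (-2 * α s) : ℂ) = (κ : ℂ) ^ 2 := by
    rw [hκ, ← Complex.ofReal_pow, ← Real.exp_nat_mul]; congr 2; push_cast; ring
  have hκ4 : (Real.exp (-4 * α s) : ℝ) = κ ^ 4 := by
    rw [hκ, ← Real.exp_nat_mul]; congr 1; push_cast; ring
  rw [hκ2, hκ4]
  have hyd : y = x * κ := rfl
  have hv : v s x = gauge a₀ e s x * u s (x * κ) := rfl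
  rw [hv, hyd]
  simp only [id, Pi.mul_apply, ← hκ]
  push_cast
  set E := gauge a₀ e s x
  have hI : Complex.I ^ 2 = -1 := Complex.I_sq
  ring_nf
  simp only [hI]
  ring

end Gauge

/-! ### The linear equation -/

/-- Integration of a rapidly decreasing quasi-periodic sequence, with quasi-periodic primitives: the
constants of integration are divided by `θ k - 1`, which is at least polynomially small, unless
`θ k = 1`, where the mean value has to vanish. -/
theorem exists_primitive {g : ℕ → ℝ → ℂ} (hg : g ∈ rapidSeq) {T : ℝ} (hT : 0 < T) {θ : ℕ → ℂ}
    (hθ : ∀ k, ‖θ k‖ = 1) (hgθ : ∀ k s, g k (s + T) = θ k * g k s) {c₀ : ℝ} (hc₀ : 0 < c₀) {m : ℕ}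
    (hdiv : ∀ k : ℕ, (θ k = 1 ∧ ∫ t in (0 : ℝ)..T, g k t = 0) ∨
      c₀ ≤ ((k : ℝ) + 1) ^ m * ‖θ k - 1‖) :
    ∃ c ∈ rapidSeq, (∀ k s, HasDerivAt (c k) (-Complex.I * g k s) s) ∧
      ∀ k s, c k (s + T) = θ k * c k s := by
  obtain ⟨g', -, hg'⟩ := rapidSeq_deriv hg
  have hgc : ∀ k, Continuous (g k) := fun k =>
    continuous_iff_continuousAt.2 fun s => (hg' k s).continuousAt
  -- the initial value `-i ∫ g / (θ - 1)`; it is `0` where `θ k = 1` since `x / 0 = 0`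
  set i₀ : ℕ → ℂ := fun k => -Complex.I * (∫ t in (0 : ℝ)..T, g k t) / (θ k - 1) with hi₀
  set c : ℕ → ℝ → ℂ := fun k s => i₀ k + -Complex.I * ∫ t in (0 : ℝ)..s, g k t with hc
  have hcd : ∀ k s, HasDerivAt (c k) (-Complex.I * g k s) s := fun k s =>
    (((hgc k).integral_hasStrictDerivAt 0 s).hasDerivAt.const_mul (-Complex.I)).const_add _
  have hcθ : ∀ k s, c k (s + T) = θ k * c k s := by
    intro k s
    have hd : ∀ s, HasDerivAt (fun s => c k (s + T) - θ k * c k s) 0 s := by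
      intro s
      refine (((hcd k (s + T)).comp_add_const s T).sub ((hcd k s).const_mul (θ k))).congr_deriv ?_
      rw [hgθ]; ring
    have h1 := is_const_of_deriv_eq_zero (fun s => (hd s).differentiableAt)
      (fun s => (hd s).deriv) s 0
    rw [← sub_eq_zero]
    refine h1.trans ?_
    simp only [hc, zero_add, intervalIntegral.integral_same, mul_zero, add_zero]
    by_cases h2 : θ k = 1
    · have h3 : ∫ t in (0 : ℝ)..T, g k t = 0 := by
        rcases hdiv k with h3 | h3
        · exact h3.2
        · rw [h2] at h3; simp at h3; exact absurd h3 (not_le.2 hc₀)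
      rw [h3, h2]; ring
    · have h3 : θ k - 1 ≠ 0 := sub_ne_zero.2 h2
      simp only [hi₀]
      field_simp
      ring
  refine ⟨c, subset_rapidSeq {c} ?_ ?_ c rfl, hcd, hcθ⟩
  · rintro _ rfl N
    obtain ⟨C, hC⟩ := rapidSeq_bound hg N
    obtain ⟨D, hD⟩ := rapidSeq_bound hg (N + m)
    refine ⟨D * T / c₀ + C * T, fun k s => ?_⟩
    have hk : (0 : ℝ) < ((k : ℝ) + 1) ^ N := by positivity
    have hk' : (0 : ℝ) < ((k : ℝ) + 1) ^ (N + m) := by positivity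
    have hper : Function.Periodic (fun s => ‖c k s‖) T := fun s => by
      simp only [hcθ, norm_mul, hθ, one_mul]
    obtain ⟨t, ht, e⟩ := hper.exists_mem_Ico₀ hT s
    rw [e]
    have hint : ∀ (n : ℕ) (B : ℝ), (∀ s, ((k : ℝ) + 1) ^ n * ‖g k s‖ ≤ B) →
        ∀ t ∈ Set.Icc 0 T, ((k : ℝ) + 1) ^ n * ‖∫ t in (0 : ℝ)..t, g k t‖ ≤ B * T := by
      intro n B hB t ht
      have hn : (0 : ℝ) < ((k : ℝ) + 1) ^ n := by positivity
      have hB0 : 0 ≤ B := le_trans (by positivity) (hB 0)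
      have := intervalIntegral.norm_integral_le_of_norm_le_const (a := 0) (b := t) (f := g k)
        (C := B / ((k : ℝ) + 1) ^ n) fun s _ => by
          rw [le_div_iff₀ hn, mul_comm]; exact hB s
      rw [sub_zero, abs_of_nonneg ht.1] at this
      calc ((k : ℝ) + 1) ^ n * ‖∫ t in (0 : ℝ)..t, g k t‖
          ≤ ((k : ℝ) + 1) ^ n * (B / ((k : ℝ) + 1) ^ n * t) := by gcongr
        _ = B * t := by field_simp
        _ ≤ B * T := by gcongr; exact ht.2
    have hi : ((k : ℝ) + 1) ^ N * ‖i₀ k‖ ≤ D * T / c₀ := by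
      have hI := hint (N + m) D (hD k) T ⟨hT.le, le_rfl⟩
      have hDT : 0 ≤ D * T := le_trans (by positivity) hI
      simp only [hi₀, norm_div, norm_mul, norm_neg, Complex.norm_I, one_mul]
      rcases hdiv k with h3 | h3
      · rw [h3.2]; simp only [norm_zero, zero_div, mul_zero]; positivity
      · have h4 : 0 < ‖θ k - 1‖ := by
          rcases (norm_nonneg (θ k - 1)).eq_or_lt with h4 | h4
          · rw [← h4, mul_zero] at h3; exact absurd h3 (not_le.2 hc₀)
          · exact h4
        rw [le_div_iff₀ hc₀, mul_div_assoc', div_mul_eq_mul_div, div_le_iff₀ h4]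
        calc ((k : ℝ) + 1) ^ N * ‖∫ t in (0 : ℝ)..T, g k t‖ * c₀
            ≤ ((k : ℝ) + 1) ^ N * ‖∫ t in (0 : ℝ)..T, g k t‖ * (((k : ℝ) + 1) ^ m * ‖θ k - 1‖) := by
              gcongr
          _ = ((k : ℝ) + 1) ^ (N + m) * ‖∫ t in (0 : ℝ)..T, g k t‖ * ‖θ k - 1‖ := by
              rw [pow_add]; ring
          _ ≤ D * T * ‖θ k - 1‖ := by gcongr
    calc ((k : ℝ) + 1) ^ N * ‖c k t‖
        ≤ ((k : ℝ) + 1) ^ N * (‖i₀ k‖ + ‖∫ t in (0 : ℝ)..t, g k t‖) := by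
          gcongr
          refine (norm_add_le _ _).trans ?_
          rw [norm_mul, norm_neg, Complex.norm_I, one_mul]
      _ ≤ D * T / c₀ + C * T := by
          rw [mul_add]
          exact add_le_add hi (hint N C (hC k) t ⟨ht.1, ht.2.le⟩)
  · rintro _ rfl
    exact ⟨_, Submodule.mem_sup_right (rapidSeq.smul_mem (-Complex.I) hg), hcd⟩

/-- `v` has the regularity and twisted periodicity required of the solutions of the hierarchy, and
solves `(i ∂_s + ½ ∂_x² - ½ R x² - e) v = f`. -/
def SolvesLinear (R : ℝ → ℝ) (ω e : ℝ) (v f : ℝ → ℝ → ℂ) : Prop :=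
  v ∈ schwartzFamily ∧ (∀ s x, v (s + 2 * Real.pi) x = v s (ω * x)) ∧
    ∀ s x : ℝ, Complex.I * deriv (fun t => v t x) s + 1 / 2 * iteratedDeriv 2 (fun y => v s y) x
        - 1 / 2 * ((R s * x ^ 2 : ℝ) : ℂ) * v s x - (e : ℂ) * v s x = f s x

section Linear

variable {R : ℝ → ℝ} {Λ ω : ℝ} {a₀ : ℝ → ℂ} {β : ℝ → ℝ}

theorem hermiteFun_twist (hω : ω = 1 ∨ ω = -1) (k : ℕ) (y : ℝ) :
    hermiteFun k (ω * y) = ω ^ k * hermiteFun k y := by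
  rcases hω with rfl | rfl
  · simp
  · rw [neg_one_mul, hermiteFun_neg]

theorem gauge_twist (h : IsFloquet R Λ a₀ β) (hω : ω = 1 ∨ ω = -1) (e s x : ℝ) :
    gauge a₀ e (s + 2 * Real.pi) x =
      Complex.exp (-(Complex.I * ((2 * Real.pi * e : ℝ) : ℂ))) * gauge a₀ e s (ω * x) := by
  have : (ω * x) ^ 2 = x ^ 2 := by rcases hω with rfl | rfl <;> ring
  rw [gauge, gauge, h.logNorm_periodic, h.deriv_logNorm_periodic, this, ← mul_assoc,
    ← Complex.exp_add]
  congr 2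
  push_cast
  ring

/-- A rapidly decreasing solution of the mode equations gives a solution of the linear equation. -/
theorem solvesLinear_of_modes (h : IsFloquet R Λ a₀ β) (hR : ContDiff ℝ (⊤ : ℕ∞) R)
    (hω : ω = 1 ∨ ω = -1) (e : ℝ) {b f : ℕ → ℝ → ℂ} (hb : b ∈ rapidSeq) (hf : f ∈ rapidSeq)
    (hbt : ∀ k s, b k (s + 2 * Real.pi) =
      Complex.exp (Complex.I * ((2 * Real.pi * e : ℝ) : ℂ)) * (ω : ℂ) ^ k * b k s)
    (hode : ∀ k s, HasDerivAt (b k) (-Complex.I * ((Real.exp (-2 * logNorm a₀ s) : ℂ) *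
      (((1 / 2 + (k : ℝ) : ℝ) : ℂ) * b k s) + f k s)) s) :
    SolvesLinear R ω e
      (fun s x => gauge a₀ e s x * hermiteSum b s (x * Real.exp (-1 * logNorm a₀ s)))
      (fun s x => gauge a₀ e s x * hermiteSum f s (x * Real.exp (-1 * logNorm a₀ s))) := by
  have hα := contDiff_logNorm h.isWronskianSol hR
  have hu := hermiteSum_mem hb
  refine ⟨mul_rescale_mem h hR (-1) (gauge_mem h hR e) hu, fun s x => ?_, fun s x => ?_⟩
  · have h1 : ∀ y, hermiteSum b (s + 2 * Real.pi) y =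
        Complex.exp (Complex.I * ((2 * Real.pi * e : ℝ) : ℂ)) * hermiteSum b s (ω * y) := by
      intro y
      simp only [hermiteSum]
      rw [← tsum_mul_left]
      refine tsum_congr fun k => ?_
      rw [hbt, hermiteFun_twist hω]
      push_cast
      ring
    simp only [h1, gauge_twist h hω, h.logNorm_periodic, Complex.exp_neg, mul_assoc ω x]
    have := Complex.exp_ne_zero (Complex.I * ((2 * Real.pi * e : ℝ) : ℂ))
    field_simp
  · rw [gauge_equation h hu s x]
    set y := x * Real.exp (-1 * logNorm a₀ s)
    have hwt : (fun (k : ℕ) s => ((1 / 2 + (k : ℝ) : ℝ) : ℂ) * b k s) ∈ rapidSeq :=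
      weight_mem_rapidSeq hb (C := 1) (M := 1) fun k => by
        rw [Complex.norm_real, Real.norm_eq_abs, abs_of_nonneg (by positivity), pow_one, one_mul]
        linarith
    have hκ : (fun s _ => (Real.exp (-2 * logNorm a₀ s) : ℂ)) ∈ temperateFamily :=
      real_periodic_mem (contDiff_const.mul hα).exp fun s => by rw [h.logNorm_periodic]
    have hκb := temperate_mul_mem_rapidSeq hwt hκ
    have hsum : dS (hermiteSum b) s y = -Complex.I * ((Real.exp (-2 * logNorm a₀ s) : ℂ) *
        hermiteSum (fun k s => ((1 / 2 + (k : ℝ) : ℝ) : ℂ) * b k s) s y + hermiteSum f s y) := by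
      have := (hasDerivAt_hermiteSum_s hb (rapidSeq.smul_mem (-Complex.I) (add_mem hκb hf))
        hode s y).deriv
      rw [hermiteSum_smul, hermiteSum_add hκb hf] at this
      rw [dS, this]
      congr 2
      simp only [hermiteSum]
      rw [← tsum_mul_left]
      exact tsum_congr fun k => by ring
    rw [oscillator_hermiteSum hb, hsum]
    have hI : Complex.I * Complex.I = -1 := Complex.I_mul_I
    linear_combination (-gauge a₀ e s x * ((Real.exp (-2 * logNorm a₀ s) : ℂ) *
        hermiteSum (fun k s => ((1 / 2 + (k : ℝ) : ℝ) : ℂ) * b k s) s y + hermiteSum f s y)) * hI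

/-- The multipliers of the mode equations: after removal of the phase `e^{-i (k + 1/2) β}`, the `k`-th
coefficient is multiplied over one period by `e^{i ((k - k₀) Λ + π n (k + k₀))}` with `n = (ω - 1) / 2`,
that is, by `1` for `k = k₀`.  The value of `energy` is chosen for that purpose. -/
theorem mode_multiplier (hω : ω = 1 ∨ ω = -1) (Λ : ℝ) (k₀ : ℕ) : ∃ n : ℤ, ∀ k : ℕ,
    Complex.exp (Complex.I * (((1 / 2 + (k : ℝ)) * Λ : ℝ) : ℂ)) *
      (Complex.exp (Complex.I * ((2 * Real.pi * energy ω Λ k₀ : ℝ) : ℂ)) * (ω : ℂ) ^ k) =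
    Complex.exp (Complex.I * (((((k : ℤ) - k₀ : ℤ) : ℝ) * Λ +
      Real.pi * ((n * ((k : ℤ) + k₀) : ℤ) : ℝ) : ℝ) : ℂ)) := by
  obtain ⟨n, hn, hωn⟩ : ∃ n : ℤ, (ω - 1) / 2 = n ∧
      (ω : ℂ) = Complex.exp (Complex.I * ((Real.pi * (n : ℝ) : ℝ) : ℂ)) := by
    rcases hω with rfl | rfl
    · exact ⟨0, by simp, by simp⟩
    · refine ⟨-1, by norm_num, ?_⟩
      have : Complex.I * ((Real.pi * ((-1 : ℤ) : ℝ) : ℝ) : ℂ) = -(Real.pi * Complex.I) := by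
        push_cast; ring
      rw [this, Complex.exp_neg, Complex.exp_pi_mul_I]
      norm_num
  refine ⟨n, fun k => ?_⟩
  rw [hωn, ← Complex.exp_nat_mul, ← Complex.exp_add, ← Complex.exp_add]
  congr 1
  have hE : 2 * Real.pi * energy ω Λ k₀ = -Λ / 2 + Real.pi * k₀ * n - k₀ * Λ := by
    rw [energy, ← hn]
    have := Real.pi_ne_zero
    field_simp
    ring
  rw [hE]
  push_cast
  ring

theorem exp_neg_phase (β : ℝ → ℝ) (k : ℕ) (s : ℝ) :
    Complex.exp (Complex.I * ((-1 * ((1 / 2 + (k : ℝ)) * β s) : ℝ) : ℂ)) *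
      Complex.exp (Complex.I * ((1 * ((1 / 2 + (k : ℝ)) * β s) : ℝ) : ℂ)) = 1 := by
  rw [← Complex.exp_add, ← Complex.exp_zero]
  congr 1
  push_cast
  ring

/-- The mode sequence `δ_{k k₀} e^{-i (k + 1/2) β}` of `hermiteMode`. -/
noncomputable def modeSeq (β : ℝ → ℝ) (k₀ : ℕ) : ℕ → ℝ → ℂ := fun k s =>
  Complex.exp (Complex.I * ((-1 * ((1 / 2 + (k : ℝ)) * β s) : ℝ) : ℂ)) * if k = k₀ then 1 else 0

theorem arg_deriv_mem (h : IsFloquet R Λ a₀ β) (hR : ContDiff ℝ (⊤ : ℕ∞) R) :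
    (fun s _ => (Real.exp (-2 * logNorm a₀ s) : ℂ)) ∈ temperateFamily :=
  real_periodic_mem (contDiff_const.mul (contDiff_logNorm h.isWronskianSol hR)).exp
    fun s => by rw [h.logNorm_periodic]

theorem modeSeq_mem (h : IsFloquet R Λ a₀ β) (hR : ContDiff ℝ (⊤ : ℕ∞) R) (k₀ : ℕ) :
    modeSeq β k₀ ∈ rapidSeq :=
  phase_mul_mem_rapidSeq (single_mem_rapidSeq k₀) h.hasDerivAt_arg (arg_deriv_mem h hR) (-1)

theorem hermiteMode_eq (ω Λ : ℝ) (a₀ : ℝ → ℂ) (β : ℝ → ℝ) (k₀ : ℕ) :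
    hermiteMode ω Λ a₀ β k₀ = fun s x => gauge a₀ (energy ω Λ k₀) s x *
      hermiteSum (modeSeq β k₀) s (x * Real.exp (-1 * logNorm a₀ s)) := by
  ext s x
  have h1 : ∀ y, hermiteSum (modeSeq β k₀) s y =
      Complex.exp (Complex.I * ((-1 * ((1 / 2 + (k₀ : ℝ)) * β s) : ℝ) : ℂ)) *
        (hermiteFun k₀ y : ℂ) := by
    intro y
    rw [hermiteSum, tsum_eq_single k₀]
    · simp [modeSeq]
    · intro k hk
      simp [modeSeq, hk]
  rw [h1, hermiteMode, gauge]
  have h2 : Complex.exp (Complex.I * ((-energy ω Λ k₀ * s + deriv (logNorm a₀) s / 2 * x ^ 2 : ℝ) : ℂ))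
      = Complex.exp (-(Complex.I * (s * energy ω Λ k₀ : ℝ))) *
        Complex.exp (Complex.I * (deriv (logNorm a₀) s * x ^ 2 / 2 : ℝ)) := by
    rw [← Complex.exp_add]; congr 1; push_cast; ring
  have h3 : Complex.I * ((-1 * ((1 / 2 + (k₀ : ℝ)) * β s) : ℝ) : ℂ) =
      -(Complex.I * ((1 / 2 + (k₀ : ℝ)) * β s : ℝ)) := by push_cast; ring
  rw [h2, h3, neg_one_mul]
  push_cast
  ring

theorem phase_add (h : IsFloquet R Λ a₀ β) (σ : ℝ) (k : ℕ) (s : ℝ) :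
    Complex.exp (Complex.I * ((σ * ((1 / 2 + (k : ℝ)) * β (s + 2 * Real.pi)) : ℝ) : ℂ)) =
      Complex.exp (Complex.I * ((σ * ((1 / 2 + (k : ℝ)) * Λ) : ℝ) : ℂ)) *
        Complex.exp (Complex.I * ((σ * ((1 / 2 + (k : ℝ)) * β s) : ℝ) : ℂ)) := by
  rw [h.arg_add, ← Complex.exp_add]
  congr 1
  push_cast
  ring

theorem exp_neg_mul_multiplier (ω Λ : ℝ) (k₀ k : ℕ) {z : ℂ}
    (hz : Complex.exp (Complex.I * (((1 / 2 + (k : ℝ)) * Λ : ℝ) : ℂ)) *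
      (Complex.exp (Complex.I * ((2 * Real.pi * energy ω Λ k₀ : ℝ) : ℂ)) * (ω : ℂ) ^ k) = z) :
    Complex.exp (Complex.I * ((-1 * ((1 / 2 + (k : ℝ)) * Λ) : ℝ) : ℂ)) * z =
      Complex.exp (Complex.I * ((2 * Real.pi * energy ω Λ k₀ : ℝ) : ℂ)) * (ω : ℂ) ^ k := by
  rw [← hz, ← mul_assoc, ← Complex.exp_add]
  have : Complex.I * ((-1 * ((1 / 2 + (k : ℝ)) * Λ) : ℝ) : ℂ) +
      Complex.I * (((1 / 2 + (k : ℝ)) * Λ : ℝ) : ℂ) = 0 := by push_cast; ring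
  rw [this, Complex.exp_zero, one_mul]

theorem hasDerivAt_phase (h : IsFloquet R Λ a₀ β) (σ : ℝ) (k : ℕ) (s : ℝ) :
    HasDerivAt (fun s => Complex.exp (Complex.I * ((σ * ((1 / 2 + (k : ℝ)) * β s) : ℝ) : ℂ)))
      (Complex.exp (Complex.I * ((σ * ((1 / 2 + (k : ℝ)) * β s) : ℝ) : ℂ)) *
        (Complex.I * ((σ * ((1 / 2 + (k : ℝ)) * Real.exp (-2 * logNorm a₀ s)) : ℝ) : ℂ))) s :=
  (((((h.hasDerivAt_arg s).const_mul (1 / 2 + (k : ℝ))).const_mul σ).ofReal_comp).const_mul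
    Complex.I).cexp

/-- `hermiteMode` lies in the kernel of the linear operator: its only mode is `k₀`, whose multiplier
is `1`. -/
theorem hermiteMode_solves (h : IsFloquet R Λ a₀ β) (hR : ContDiff ℝ (⊤ : ℕ∞) R)
    (hω : ω = 1 ∨ ω = -1) (k₀ : ℕ) :
    SolvesLinear R ω (energy ω Λ k₀) (hermiteMode ω Λ a₀ β k₀) 0 := by
  rw [hermiteMode_eq]
  obtain ⟨n, hn⟩ := mode_multiplier hω Λ k₀
  have := solvesLinear_of_modes h hR hω (energy ω Λ k₀) (modeSeq_mem h hR k₀)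
    (zero_mem rapidSeq) (fun k s => ?_) (fun k s => ?_)
  · convert this using 1
    ext s x
    simp [hermiteSum]
  · by_cases hk : k = k₀
    · subst hk
      have h1 := exp_neg_mul_multiplier ω Λ k k (hn k)
      have h2 : Complex.exp (Complex.I * (((((k : ℤ) - k : ℤ) : ℝ) * Λ +
          Real.pi * ((n * ((k : ℤ) + k) : ℤ) : ℝ) : ℝ) : ℂ)) = 1 := by
        refine Complex.exp_eq_one_iff.2 ⟨n * k, ?_⟩
        push_cast; ring
      rw [h2, mul_one] at h1
      simp only [modeSeq, phase_add h, h1]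
      ring
    · simp [modeSeq, hk]
  · refine ((hasDerivAt_phase h (-1) k s).mul_const (if k = k₀ then (1 : ℂ) else 0)).congr_deriv ?_
    simp only [modeSeq, Pi.zero_apply]
    push_cast
    ring

/-- Solvability of the linear equation: the right-hand side `f` is admissible after subtracting
a suitable multiple of the kernel element `hermiteMode`. -/
theorem exists_solvesLinear (h : IsFloquet R Λ a₀ β) (hR : ContDiff ℝ (⊤ : ℕ∞) R)
    (hω : ω = 1 ∨ ω = -1) (k₀ : ℕ) {c₀ : ℝ} (hc₀ : 0 < c₀) {m : ℕ}
    (hdiv : ∀ q n : ℤ, q ≠ 0 → c₀ ≤ (|(q : ℝ)| + 1) ^ m *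
      ‖Complex.exp (Complex.I * ((q * Λ + Real.pi * n : ℝ) : ℂ)) - 1‖)
    {f : ℝ → ℝ → ℂ} (hf : f ∈ schwartzFamily) (hft : ∀ s x, f (s + 2 * Real.pi) x = f s (ω * x)) :
    ∃ (z : ℂ) (v : ℝ → ℝ → ℂ), SolvesLinear R ω (energy ω Λ k₀) v
      (fun s x => z * hermiteMode ω Λ a₀ β k₀ s x + f s x) := by
  set e := energy ω Λ k₀ with he
  have hpi := Real.two_pi_pos
  -- the right-hand side in the variables of the harmonic oscillator
  set F : ℝ → ℝ → ℂ := fun s y => gaugeInv a₀ e s y * f s (y * Real.exp (1 * logNorm a₀ s)) with hFdef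
  have hF : F ∈ schwartzFamily := mul_rescale_mem h hR 1 (gaugeInv_mem h hR e) hf
  have hFf : ∀ s x, gauge a₀ e s x * F s (x * Real.exp (-1 * logNorm a₀ s)) = f s x := by
    intro s x
    have h1 : x * Real.exp (-1 * logNorm a₀ s) * Real.exp (1 * logNorm a₀ s) = x := by
      rw [mul_assoc, ← Real.exp_add]; simp
    have h2 : Real.exp (2 * logNorm a₀ s) * (x * Real.exp (-1 * logNorm a₀ s)) ^ 2 = x ^ 2 := by
      rw [mul_pow, mul_left_comm, ← Real.exp_nat_mul, ← Real.exp_add]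
      push_cast
      rw [show 2 * logNorm a₀ s + 2 * (-1 * logNorm a₀ s) = 0 by ring, Real.exp_zero, mul_one]
    have h3 : gauge a₀ e s x * gaugeInv a₀ e s (x * Real.exp (-1 * logNorm a₀ s)) = 1 := by
      have h4 : -(deriv (logNorm a₀) s / 2 * Real.exp (2 * logNorm a₀ s)) *
          (x * Real.exp (-1 * logNorm a₀ s)) ^ 2 = -(deriv (logNorm a₀) s / 2) * x ^ 2 := by
        rw [← h2]; ring
      rw [gauge, gaugeInv, h4, Complex.ofReal_exp, Complex.ofReal_exp, ← Complex.exp_add,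
        ← Complex.exp_add, ← Complex.exp_add, ← Complex.exp_zero]
      congr 1
      push_cast
      ring
    simp only [hFdef]
    rw [h1, ← mul_assoc, h3, one_mul]
  have hFt : ∀ s y, F (s + 2 * Real.pi) y =
      Complex.exp (Complex.I * ((2 * Real.pi * e : ℝ) : ℂ)) * F s (ω * y) := by
    intro s y
    have : (ω * y) ^ 2 = y ^ 2 := by rcases hω with rfl | rfl <;> ring
    simp only [hFdef, gaugeInv]
    rw [h.logNorm_periodic, h.deriv_logNorm_periodic, hft, this, mul_assoc ω]
    have hsplit : ∀ b : ℝ, Complex.exp (Complex.I * ((e * (s + 2 * Real.pi) + b : ℝ) : ℂ)) =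
        Complex.exp (Complex.I * ((2 * Real.pi * e : ℝ) : ℂ)) *
          Complex.exp (Complex.I * ((e * s + b : ℝ) : ℂ)) := fun b => by
      rw [← Complex.exp_add]; congr 1; push_cast; ring
    rw [hsplit]
    ring
  have hFk := hermiteCoeff_mem hF
  have hFkt : ∀ k s, hermiteCoeff F k (s + 2 * Real.pi) =
      Complex.exp (Complex.I * ((2 * Real.pi * e : ℝ) : ℂ)) * (ω : ℂ) ^ k * hermiteCoeff F k s := by
    intro k s
    simp only [hermiteCoeff, hFt, mul_assoc]
    rw [integral_const_mul]
    congr 1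
    rcases hω with rfl | rfl
    · simp
    · rw [← integral_const_mul, ← integral_neg_eq_self]
      refine integral_congr_ae (ae_of_all _ fun y => ?_)
      simp only [neg_one_mul, neg_neg, hermiteFun_neg]
      push_cast
      ring
  obtain ⟨n, hn⟩ := mode_multiplier hω Λ k₀
  set θ : ℕ → ℂ := fun k => Complex.exp (Complex.I * (((((k : ℤ) - k₀ : ℤ) : ℝ) * Λ +
      Real.pi * ((n * ((k : ℤ) + k₀) : ℤ) : ℝ) : ℝ) : ℂ)) with hθ
  have hθ0 : θ k₀ = 1 := by
    refine Complex.exp_eq_one_iff.2 ⟨n * k₀, ?_⟩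
    push_cast; ring
  have hG := phase_mul_mem_rapidSeq hFk h.hasDerivAt_arg (arg_deriv_mem h hR) 1
  set G : ℕ → ℝ → ℂ := fun k s => Complex.exp (Complex.I * ((1 * ((1 / 2 + (k : ℝ)) * β s) : ℝ) : ℂ)) *
    hermiteCoeff F k s with hGdef
  have hGc : ∀ k, Continuous (G k) := by
    intro k
    obtain ⟨G', -, hG'⟩ := rapidSeq_deriv hG
    exact continuous_iff_continuousAt.2 fun s => (hG' k s).continuousAt
  -- `z` makes the mean value of the resonant mode `k₀` vanish
  set z : ℂ := -(((2 * Real.pi : ℝ) : ℂ)⁻¹ * ∫ t in (0 : ℝ)..(2 * Real.pi), G k₀ t) with hz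
  set g : ℕ → ℝ → ℂ := G + z • fun k (_ : ℝ) => if k = k₀ then (1 : ℂ) else 0 with hg
  have hgmem : g ∈ rapidSeq := add_mem hG (rapidSeq.smul_mem z (single_mem_rapidSeq k₀))
  have hgt : ∀ k s, g k (s + 2 * Real.pi) = θ k * g k s := by
    intro k s
    have h1 : G k (s + 2 * Real.pi) = θ k * G k s := by
      simp only [hGdef, hθ]
      rw [← hn k, phase_add h, hFkt, one_mul]
      ring
    simp only [hg, Pi.add_apply, Pi.smul_apply, smul_eq_mul, h1]
    by_cases hk : k = k₀
    · subst hk; simp [hθ0]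
    · simp [hk]
  obtain ⟨c, hc, hcd, hct⟩ := exists_primitive hgmem hpi (θ := θ)
    (fun k => by simp only [hθ]; rw [mul_comm Complex.I, Complex.norm_exp_ofReal_mul_I]) hgt
    (c₀ := c₀ / ((k₀ : ℝ) + 1) ^ m) (by positivity) (m := m) (fun k => by
      by_cases hk : k = k₀
      · left
        subst hk
        refine ⟨hθ0, ?_⟩
        simp only [hg, Pi.add_apply, Pi.smul_apply, if_true, smul_eq_mul, mul_one]
        rw [intervalIntegral.integral_add ((hGc k).intervalIntegrable _ _)
          (continuous_const.intervalIntegrable _ _), intervalIntegral.integral_const, sub_zero, hz]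
        have : ((2 * Real.pi : ℝ) : ℂ) ≠ 0 := by exact_mod_cast hpi.ne'
        rw [Complex.real_smul]
        field_simp
        ring
      · right
        have h1 := hdiv ((k : ℤ) - k₀) (n * ((k : ℤ) + k₀)) (by omega)
        rw [div_le_iff₀ (by positivity)]
        refine h1.trans ?_
        have h2 : |(((k : ℤ) - k₀ : ℤ) : ℝ)| + 1 ≤ ((k : ℝ) + 1) * ((k₀ : ℝ) + 1) := by
          have hk1 : (0 : ℝ) ≤ k := k.cast_nonneg
          have hk2 : (0 : ℝ) ≤ k₀ := k₀.cast_nonneg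
          have : |(((k : ℤ) - k₀ : ℤ) : ℝ)| ≤ k + k₀ := by
            push_cast
            rw [abs_le]; constructor <;> linarith
          nlinarith
        calc (|(((k : ℤ) - k₀ : ℤ) : ℝ)| + 1) ^ m * ‖θ k - 1‖
            ≤ (((k : ℝ) + 1) * ((k₀ : ℝ) + 1)) ^ m * ‖θ k - 1‖ := by gcongr
          _ = _ := by rw [mul_pow]; ring)
  have hb := phase_mul_mem_rapidSeq hc h.hasDerivAt_arg (arg_deriv_mem h hR) (-1)
  have hmode := modeSeq_mem h hR k₀
  have hrhs := add_mem hFk (rapidSeq.smul_mem z hmode)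
  have := solvesLinear_of_modes h hR hω e hb hrhs (fun k s => ?_) (fun k s => ?_)
  · refine ⟨z, _, this.1, this.2.1, fun s x => (this.2.2 s x).trans ?_⟩
    simp only [hermiteSum_add hFk (rapidSeq.smul_mem z hmode), hermiteSum_smul,
      hermiteSum_hermiteCoeff hF, hermiteMode_eq]
    rw [mul_add, hFf]
    ring
  · have h1 := exp_neg_mul_multiplier ω Λ k₀ k (hn k)
    simp only [phase_add h, hct]
    linear_combination (Complex.exp (Complex.I * ((-1 * ((1 / 2 + (k : ℝ)) * β s) : ℝ) : ℂ)) * c k s) * h1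
  · refine ((hasDerivAt_phase h (-1) k s).mul (hcd k s)).congr_deriv ?_
    have h1 := exp_neg_phase β k s
    have h2 : Complex.exp (Complex.I * ((-1 * ((1 / 2 + (k : ℝ)) * β s) : ℝ) : ℂ)) * g k s =
        (hermiteCoeff F + z • modeSeq β k₀) k s := by
      simp only [hg, hGdef, Pi.add_apply, Pi.smul_apply, smul_eq_mul, modeSeq]
      linear_combination hermiteCoeff F k s * h1
    rw [← h2]
    push_cast
    ring

end Linear

/-! ### Existence of a normalized Floquet triple -/

/-- Global existence for an ODE with globally Lipschitz right-hand side vanishing at `0`: the integral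
equation for `y / cosh (c s)` is a contraction in the space of bounded continuous functions. -/
theorem exists_forall_hasDerivAt {V : Type*} [NormedAddCommGroup V] [NormedSpace ℝ V]
    [CompleteSpace V] {f : ℝ → V → V} (hf : Continuous fun z : ℝ × V => f z.1 z.2) {K : NNReal}
    (hK : ∀ t, LipschitzWith K (f t)) (h0 : ∀ t, f t 0 = 0) (y₀ : V) :
    ∃ y : ℝ → V, y 0 = y₀ ∧ ∀ s, HasDerivAt y (f s (y s)) s := by
  set c : ℝ := 2 * (K + 1) with hc
  have hK0 : (0 : ℝ) ≤ K := K.2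
  have hc0 : 0 < c := by positivity
  have hcosh : ∀ s, 0 < Real.cosh (c * s) := fun s => Real.cosh_pos _
  have hcc : Continuous fun s => Real.cosh (c * s) :=
    Real.continuous_cosh.comp (continuous_const.mul continuous_id)
  have hint : ∀ s, |∫ t in (0 : ℝ)..s, Real.cosh (c * t)| ≤ c⁻¹ * Real.cosh (c * s) := by
    intro s
    have hd : ∀ x ∈ Set.uIcc 0 s, HasDerivAt (fun s => c⁻¹ * Real.sinh (c * s)) (Real.cosh (c * x)) x :=
      fun x _ => ((((hasDerivAt_id x).const_mul c).sinh).const_mul c⁻¹).congr_deriv (by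
        simp only [id]; field_simp)
    rw [intervalIntegral.integral_eq_sub_of_hasDerivAt hd (hcc.intervalIntegrable _ _)]
    simp only [mul_zero, Real.sinh_zero, sub_zero, abs_mul, abs_of_pos (inv_pos.2 hc0)]
    gcongr
    rw [abs_le]
    exact ⟨by linarith [Real.exp_pos (c * s), Real.sinh_add_cosh (c * s)],
      (Real.sinh_lt_cosh _).le⟩
  -- an integral bounded by `cosh`
  have key : ∀ (g : ℝ → V) (B : ℝ), 0 ≤ B → (∀ t, ‖g t‖ ≤ B * Real.cosh (c * t)) → ∀ s,
      ‖(Real.cosh (c * s))⁻¹ • ∫ t in (0 : ℝ)..s, g t‖ ≤ c⁻¹ * B := by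
    intro g B hB hg s
    have h1 := intervalIntegral.norm_integral_le_abs_of_norm_le (μ := volume) (a := 0) (b := s)
      (ae_of_all _ hg) ((continuous_const.mul hcc).intervalIntegrable _ _)
    rw [intervalIntegral.integral_const_mul, abs_mul, abs_of_nonneg hB] at h1
    rw [norm_smul, norm_inv, Real.norm_of_nonneg (hcosh s).le, inv_mul_le_iff₀ (hcosh s)]
    calc _ ≤ B * (c⁻¹ * Real.cosh (c * s)) := h1.trans (by gcongr; exact hint s)
      _ = _ := by ring
  have hfc : ∀ w : BoundedContinuousFunction ℝ V,
      Continuous fun t => f t (Real.cosh (c * t) • w t) := fun w =>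
    hf.comp (continuous_id.prodMk (hcc.smul w.continuous))
  have hfb : ∀ (t : ℝ) (v w : V), ‖f t (Real.cosh (c * t) • v) - f t (Real.cosh (c * t) • w)‖ ≤
      K * ‖v - w‖ * Real.cosh (c * t) := by
    intro t v w
    have := (hK t).norm_sub_le (Real.cosh (c * t) • v) (Real.cosh (c * t) • w)
    rw [← smul_sub, norm_smul, Real.norm_of_nonneg (hcosh t).le] at this
    linarith
  set T : BoundedContinuousFunction ℝ V → BoundedContinuousFunction ℝ V := fun w =>
    BoundedContinuousFunction.ofNormedAddCommGroup
      (fun s => (Real.cosh (c * s))⁻¹ • y₀ +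
        (Real.cosh (c * s))⁻¹ • ∫ t in (0 : ℝ)..s, f t (Real.cosh (c * t) • w t))
      (((hcc.inv₀ fun s => (hcosh s).ne').smul continuous_const).add
        ((hcc.inv₀ fun s => (hcosh s).ne').smul
          (intervalIntegral.continuous_primitive (fun a b => (hfc w).intervalIntegrable a b) 0)))
      (‖y₀‖ + c⁻¹ * (K * ‖w‖)) (fun s => by
        refine (norm_add_le _ _).trans (add_le_add ?_ (key _ _ (by positivity) (fun t => ?_) s))
        · rw [norm_smul, norm_inv, Real.norm_of_nonneg (hcosh s).le]
          exact mul_le_of_le_one_left (norm_nonneg _) (inv_le_one_of_one_le₀ (Real.one_le_cosh _))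
        · have := hfb t (w t) 0
          rw [smul_zero, h0, sub_zero, sub_zero] at this
          refine this.trans ?_
          gcongr
          exact w.norm_coe_le_norm t) with hT
  have hcontr : ContractingWith (1 / 2) T := by
    refine ⟨by norm_num, LipschitzWith.of_dist_le_mul fun v w => ?_⟩
    rw [BoundedContinuousFunction.dist_le (by positivity)]
    intro s
    have h1 : T v s - T w s = (Real.cosh (c * s))⁻¹ • ∫ t in (0 : ℝ)..s,
        (f t (Real.cosh (c * t) • v t) - f t (Real.cosh (c * t) • w t)) := by
      rw [intervalIntegral.integral_sub ((hfc v).intervalIntegrable _ _)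
        ((hfc w).intervalIntegrable _ _), smul_sub]
      simp only [hT, BoundedContinuousFunction.coe_ofNormedAddCommGroup]
      abel
    rw [dist_eq_norm, h1]
    refine (key _ (K * dist v w) (by positivity) (fun t => (hfb t _ _).trans ?_) s).trans ?_
    · gcongr
      rw [← dist_eq_norm]
      exact BoundedContinuousFunction.dist_coe_le_dist t
    · rw [← mul_assoc]
      gcongr
      rw [inv_mul_le_iff₀ hc0, hc]
      push_cast
      linarith
  set w := hcontr.fixedPoint
  have hw : ∀ s, Real.cosh (c * s) • w s =
      y₀ + ∫ t in (0 : ℝ)..s, f t (Real.cosh (c * t) • w t) := by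
    intro s
    have h1 : T w s = w s := congrArg (fun u : BoundedContinuousFunction ℝ V => u s)
      hcontr.fixedPoint_isFixedPt
    conv_lhs => rw [← h1]
    simp only [hT, BoundedContinuousFunction.coe_ofNormedAddCommGroup]
    rw [smul_add, smul_smul, smul_smul, mul_inv_cancel₀ (hcosh s).ne', one_smul, one_smul]
  refine ⟨fun s => Real.cosh (c * s) • w s, by simp only [hw 0]; simp, fun s => ?_⟩
  have h2 := ((hfc w).integral_hasStrictDerivAt 0 s).hasDerivAt.const_add y₀
  simp only [← hw] at h2
  exact h2

section Existence

variable {R : ℝ → ℝ}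

/-- The first-order system `A' = 2 B`, `B' = -(R/2) A`, with complex unknowns. -/
noncomputable def hillField (R : ℝ → ℝ) (t : ℝ) (z : ℂ × ℂ) : ℂ × ℂ :=
  (2 * z.2, -((R t / 2 : ℝ) : ℂ) * z.1)

theorem hillField_lipschitz {K : NNReal} (hK : ∀ t, |R t| ≤ K) (t : ℝ) :
    LipschitzWith (K + 2) (hillField R t) := by
  refine LipschitzWith.of_dist_le_mul fun z w => ?_
  rw [dist_eq_norm, dist_eq_norm, Prod.norm_def]
  have hK0 : (0 : ℝ) ≤ K := K.2
  have h1 : ‖z.1 - w.1‖ ≤ ‖z - w‖ := norm_fst_le (z - w)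
  have h2 : ‖z.2 - w.2‖ ≤ ‖z - w‖ := norm_snd_le (z - w)
  have h3 : (hillField R t z - hillField R t w).1 = 2 * (z.2 - w.2) := by simp [hillField]; ring
  have h4 : (hillField R t z - hillField R t w).2 = -((R t / 2 : ℝ) : ℂ) * (z.1 - w.1) := by
    simp [hillField]; ring
  rw [h3, h4, norm_mul, norm_mul, norm_neg, Complex.norm_real, Real.norm_eq_abs, abs_div]
  have h5 := hK t
  have h6 : |R t| / |(2 : ℝ)| ≤ K := by
    rw [abs_of_pos (by norm_num : (0 : ℝ) < 2)]; linarith [abs_nonneg (R t)]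
  push_cast
  refine max_le ?_ ?_
  · rw [show ‖(2 : ℂ)‖ = 2 by simp]
    nlinarith [norm_nonneg (z - w)]
  · calc _ ≤ (K : ℝ) * ‖z - w‖ := by gcongr
      _ ≤ _ := by nlinarith [norm_nonneg (z - w)]

/-- A complex solution of `y'' + R y = 0` with multiplier `e^{i lam}` and non-zero Wronskian: it starts
from an eigenvector of the Poincaré map, which is not proportional to a real vector since the
eigenvalue is not real. -/
theorem exists_quasiperiodic (hR : Continuous R) (hper : ∀ s, R (s + 2 * Real.pi) = R s)
    {M : Matrix (Fin 2) (Fin 2) ℝ} (hM : IsLinearizedPoincareMap R M) {lam : ℝ}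
    (hlam : HasMultipliers M lam) (hd : IsDiophantine lam) :
    ∃ A : ℝ → ℂ, Differentiable ℝ A ∧ (∀ s, HasDerivAt (deriv A) (-((R s : ℂ) * A s)) s) ∧
      (∀ s, ‖A (s + 2 * Real.pi)‖ = ‖A s‖) ∧ ((starRingEnd ℂ) (A 0) * deriv A 0).im ≠ 0 := by
  obtain ⟨C, hC⟩ := bounded_of_periodic (f := fun s => (R s : ℂ))
    (Complex.continuous_ofReal.comp hR) Real.two_pi_pos fun s => by rw [hper]
  have hC' : ∀ t, |R t| ≤ (C.toNNReal : NNReal) := fun t => by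
    have := hC t
    rw [Complex.norm_real, Real.norm_eq_abs] at this
    exact this.trans (Real.le_coe_toNNReal C)
  have hL := hillField_lipschitz hC'
  have hcont : Continuous fun z : ℝ × (ℂ × ℂ) => hillField R z.1 z.2 := by
    unfold hillField
    have : Continuous fun z : ℝ × (ℂ × ℂ) => ((R z.1 / 2 : ℝ) : ℂ) :=
      Complex.continuous_ofReal.comp ((hR.comp continuous_fst).div_const 2)
    fun_prop
  set z := Complex.exp (Complex.I * lam) with hz
  have hz1 : ‖z‖ = 1 := by rw [hz, mul_comm, Complex.norm_exp_ofReal_mul_I]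
  obtain ⟨ξ, hξ, hξz⟩ := (mem_multipliers_iff hlam z).1 (Or.inl rfl)
  obtain ⟨y, hy0, hy⟩ := exists_forall_hasDerivAt hcont hL (fun t => by simp [hillField]) (ξ 0, ξ 1)
  set A : ℝ → ℂ := fun s => (y s).1
  set B : ℝ → ℂ := fun s => (y s).2
  have hA : ∀ s, HasDerivAt A (2 * B s) s := fun s =>
    (ContinuousLinearMap.fst ℝ ℂ ℂ).hasFDerivAt.comp_hasDerivAt s (hy s)
  have hB : ∀ s, HasDerivAt B (-((R s / 2 : ℝ) : ℂ) * A s) s := fun s =>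
    (ContinuousLinearMap.snd ℝ ℂ ℂ).hasFDerivAt.comp_hasDerivAt s (hy s)
  have hA0 : A 0 = ξ 0 := congrArg Prod.fst hy0
  have hB0 : B 0 = ξ 1 := congrArg Prod.snd hy0
  have hdA : deriv A = fun s => 2 * B s := funext fun s => (hA s).deriv
  -- the values after one period
  have hre := hM (fun s => (A s).re) (fun s => (B s).re)
    (fun s => (hasDerivAt_re (hA s)).congr_deriv (by simp))
    (fun s => (hasDerivAt_re (hB s)).congr_deriv (by
      rw [← Complex.ofReal_neg, Complex.re_ofReal_mul]))
  have him := hM (fun s => (A s).im) (fun s => (B s).im)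
    (fun s => (hasDerivAt_im (hA s)).congr_deriv (by simp))
    (fun s => (hasDerivAt_im (hB s)).congr_deriv (by
      rw [← Complex.ofReal_neg, Complex.im_ofReal_mul]))
  have e1 : (M 0 0 : ℂ) * ξ 0 + M 0 1 * ξ 1 = z * ξ 0 := by
    have := congrFun hξz 0
    simpa [Matrix.mulVec, dotProduct, Fin.sum_univ_two] using this
  have e2 : (M 1 0 : ℂ) * ξ 0 + M 1 1 * ξ 1 = z * ξ 1 := by
    have := congrFun hξz 1
    simpa [Matrix.mulVec, dotProduct, Fin.sum_univ_two] using this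
  have hAp : A (2 * Real.pi) = z * A 0 := by
    have r := congrFun hre 0
    have i := congrFun him 0
    simp only [Matrix.mulVec, dotProduct, Fin.sum_univ_two, Matrix.cons_val_zero,
      Matrix.cons_val_one] at r i
    rw [hA0, ← e1]
    apply Complex.ext <;> simp [r, i, hA0, hB0]
  have hBp : B (2 * Real.pi) = z * B 0 := by
    have r := congrFun hre 1
    have i := congrFun him 1
    simp only [Matrix.mulVec, dotProduct, Fin.sum_univ_two, Matrix.cons_val_zero,
      Matrix.cons_val_one] at r i
    rw [hB0, ← e2]
    apply Complex.ext <;> simp [r, i, hA0, hB0]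
  have hquasi : (fun s => y (s + 2 * Real.pi)) = fun s => z • y s := by
    refine ODE_solution_unique_univ (v := hillField R) (s := fun _ => Set.univ) (t₀ := 0)
      (fun t => (hL t).lipschitzOnWith) (fun t => ⟨?_, trivial⟩) (fun t => ⟨?_, trivial⟩) ?_
    · refine ((hy (t + 2 * Real.pi)).comp_add_const t (2 * Real.pi)).congr_deriv ?_
      simp only [hillField, hper]
    · refine ((hy t).const_smul z).congr_deriv ?_
      simp only [hillField, Prod.smul_fst, Prod.smul_snd, Prod.smul_mk, smul_eq_mul, Prod.mk.injEq]
      constructor <;> ring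
    · rw [zero_add]
      exact Prod.ext hAp hBp
  refine ⟨A, fun s => (hA s).differentiableAt, fun s => ?_, fun s => ?_, fun hW => ?_⟩
  · rw [hdA]
    refine ((hB s).const_mul 2).congr_deriv ?_
    push_cast
    ring
  · have : A (s + 2 * Real.pi) = z * A s := congrArg Prod.fst (congrFun hquasi s)
    rw [this, norm_mul, hz1, one_mul]
  · -- otherwise the eigenvalue is real and `lam / π` is an integer
    rw [hdA, hA0] at hW
    simp only [hB0, Complex.mul_im, Complex.mul_re, Complex.conj_re, Complex.conj_im,
      Complex.re_ofNat, Complex.im_ofNat] at hW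
    have hW' : (ξ 0).re * (ξ 1).im = (ξ 0).im * (ξ 1).re := by linarith
    have e1r := congrArg Complex.re e1
    have e1i := congrArg Complex.im e1
    have e2r := congrArg Complex.re e2
    have e2i := congrArg Complex.im e2
    simp only [Complex.add_re, Complex.add_im, Complex.mul_re, Complex.mul_im, Complex.ofReal_re,
      Complex.ofReal_im, zero_mul, sub_zero, add_zero] at e1r e1i e2r e2i
    have n0 : z.im * ((ξ 0).re ^ 2 + (ξ 0).im ^ 2) = 0 := by
      linear_combination (ξ 0).im * e1r - (ξ 0).re * e1i + M 0 1 * hW'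
    have n1 : z.im * ((ξ 1).re ^ 2 + (ξ 1).im ^ 2) = 0 := by
      linear_combination (ξ 1).im * e2r - (ξ 1).re * e2i - M 1 0 * hW'
    have hzi : z.im = 0 := by
      by_contra hne
      have m0 := (mul_eq_zero.1 n0).resolve_left hne
      have m1 := (mul_eq_zero.1 n1).resolve_left hne
      refine hξ (funext fun i => ?_)
      have aux : ∀ w : ℂ, w.re ^ 2 + w.im ^ 2 = 0 → w = 0 := fun w hw =>
        Complex.ext (by simp only [Complex.zero_re]; nlinarith [sq_nonneg w.re, sq_nonneg w.im])
          (by simp only [Complex.zero_im]; nlinarith [sq_nonneg w.re, sq_nonneg w.im])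
      fin_cases i
      · exact aux _ m0
      · exact aux _ m1
    have hsin : Real.sin lam = 0 := by
      rw [← hzi, hz, mul_comm, Complex.exp_ofReal_mul_I_im]
    obtain ⟨n, hn⟩ := Real.sin_eq_zero_iff.1 hsin
    obtain ⟨τ, μ, -, hμ, hdi⟩ := hd
    have := hdi n 1 (by simp)
    rw [← hn, mul_div_assoc, div_self Real.pi_ne_zero, mul_one, Nat.cast_one, one_mul, sub_self,
      abs_zero] at this
    have hpos : 0 < μ / (|(n : ℝ)| + 1) ^ τ := by positivity
    exact absurd this (not_le.2 hpos)

/-- A quasi-periodic solution, normalized, with the primitive of `|a₀|⁻²` as its argument. -/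
theorem exists_isFloquet (hR : Continuous R) (hper : ∀ s, R (s + 2 * Real.pi) = R s)
    {M : Matrix (Fin 2) (Fin 2) ℝ} (hM : IsLinearizedPoincareMap R M) {lam : ℝ}
    (hlam : HasMultipliers M lam) (hd : IsDiophantine lam) :
    ∃ (Λ : ℝ) (a₀ : ℝ → ℂ) (β : ℝ → ℝ), IsFloquet R Λ a₀ β := by
  obtain ⟨A, hAd, hAo, hAn, hAW, hApos⟩ : ∃ A : ℝ → ℂ, Differentiable ℝ A ∧
      (∀ s, HasDerivAt (deriv A) (-((R s : ℂ) * A s)) s) ∧ (∀ s, ‖A (s + 2 * Real.pi)‖ = ‖A s‖) ∧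
      0 < ((starRingEnd ℂ) (A 0) * deriv A 0).im ∧ A 0 ≠ 0 := by
    obtain ⟨A, hAd, hAo, hAn, hAW⟩ := exists_quasiperiodic hR hper hM hlam hd
    have hA0 : A 0 ≠ 0 := fun h0 => hAW (by simp [h0])
    rcases hAW.lt_or_gt with hneg | hpos
    · -- complex conjugation changes the sign of the Wronskian
      have hcd : ∀ s, HasDerivAt (fun s => (starRingEnd ℂ) (A s)) ((starRingEnd ℂ) (deriv A s)) s :=
        fun s => (hAd s).hasDerivAt.star
      have hcdd : deriv (fun s => (starRingEnd ℂ) (A s)) = fun s => (starRingEnd ℂ) (deriv A s) :=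
        funext fun s => (hcd s).deriv
      refine ⟨fun s => (starRingEnd ℂ) (A s), fun s => (hcd s).differentiableAt, fun s => ?_,
        fun s => by simp only [RCLike.norm_conj, hAn], ?_, by simpa using hA0⟩
      · rw [hcdd]
        refine (hAo s).star.congr_deriv ?_
        simp
      · rw [hcdd]
        simp only [Complex.mul_im, Complex.conj_re, Complex.conj_im] at hneg ⊢
        linarith
    · exact ⟨A, hAd, hAo, hAn, hpos, hA0⟩
  set W := ((starRingEnd ℂ) (A 0) * deriv A 0).im with hW
  have hn0 : 0 < ‖A 0‖ := norm_pos_iff.2 hApos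
  have hsW : 0 < Real.sqrt W := Real.sqrt_pos.2 hAW
  set c : ℂ := (starRingEnd ℂ) (A 0) * (((‖A 0‖ * Real.sqrt W)⁻¹ : ℝ) : ℂ) with hc
  have hcA : c * A 0 = ((‖A 0‖ / Real.sqrt W : ℝ) : ℂ) := by
    have h1 : (starRingEnd ℂ) (A 0) * A 0 = ((‖A 0‖ ^ 2 : ℝ) : ℂ) := by
      rw [mul_comm, Complex.mul_conj, Complex.normSq_eq_norm_sq]
    rw [hc, mul_right_comm, h1, ← Complex.ofReal_mul]
    congr 1
    field_simp
  have hcc : (starRingEnd ℂ) c * c = ((W⁻¹ : ℝ) : ℂ) := by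
    rw [mul_comm, Complex.mul_conj, Complex.normSq_eq_norm_sq]
    congr 1
    rw [hc, norm_mul, RCLike.norm_conj, Complex.norm_real, Real.norm_of_nonneg (by positivity),
      mul_inv, ← mul_assoc, mul_inv_cancel₀ hn0.ne', one_mul, inv_pow, Real.sq_sqrt hAW.le]
  have hd' : ∀ s, HasDerivAt (fun s => c * A s) (c * deriv A s) s := fun s =>
    (hAd s).hasDerivAt.const_mul c
  have hdd : deriv (fun s => c * A s) = fun s => c * deriv A s := funext fun s => (hd' s).deriv
  have hWs : IsWronskianSol R fun s => c * A s := by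
    refine ⟨fun s => (hd' s).differentiableAt, fun s => ?_, ?_⟩
    · rw [hdd]
      exact ((hAo s).const_mul c).congr_deriv (by ring)
    · rw [hdd, map_mul, mul_mul_mul_comm, hcc, Complex.im_ofReal_mul, ← hW,
        inv_mul_cancel₀ hAW.ne']
  have hinit : 0 < (c * A 0).re ∧ (c * A 0).im = 0 := by
    rw [hcA, Complex.ofReal_re, Complex.ofReal_im]
    exact ⟨by positivity, rfl⟩
  have hnorm : ∀ s, ‖c * A (s + 2 * Real.pi)‖ = ‖c * A s‖ := fun s => by
    rw [norm_mul c, norm_mul c, hAn]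
  have hαc : Continuous (logNorm fun s => c * A s) :=
    continuous_iff_continuousAt.2 fun s => (hasDerivAt_logNorm hWs s).continuousAt
  have hgc : Continuous fun t => Real.exp (-2 * logNorm (fun s => c * A s) t) := by fun_prop
  have hgp : Function.Periodic (fun t => Real.exp (-2 * logNorm (fun s => c * A s) t))
      (2 * Real.pi) := fun t => by simp only [logNorm, hnorm]
  refine ⟨∫ t in (0 : ℝ)..(2 * Real.pi), Real.exp (-2 * logNorm (fun s => c * A s) t),
    fun s => c * A s, fun s => ∫ t in (0 : ℝ)..s, Real.exp (-2 * logNorm (fun s => c * A s) t),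
    ⟨hWs.differentiable, hWs.ode, hinit, hWs.wronskian, ?_, by simp, polar_integral hWs hinit,
      hnorm, fun s => ?_⟩⟩
  · exact intervalIntegral.continuous_primitive (fun a b => hgc.intervalIntegrable a b) 0
  · rw [← intervalIntegral.integral_add_adjacent_intervals (hgc.intervalIntegrable 0 s)
      (hgc.intervalIntegrable s (s + 2 * Real.pi)), hgp.intervalIntegral_add_eq s 0, zero_add]

end Existence

/-! ### The hierarchy -/

/-- A sequence satisfying all conditions `P p` exists if every sequence satisfying the conditions
below `p` can be modified from the index `p` on so as to satisfy `P p`, which involves the terms up to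
`p` only. -/
theorem exists_sequence_of_extend {S : Type*} [Nonempty S] {P : ℕ → (ℕ → S) → Prop}
    (hP : ∀ p f g, (∀ j ≤ p, g j = f j) → P p f → P p g)
    (hext : ∀ p f, (∀ j < p, P j f) → ∃ g, (∀ j < p, g j = f j) ∧ P p g) :
    ∃ f, ∀ p, P p f := by
  have hext' : ∀ p (f : {f // ∀ j < p, P j f}), ∃ g : {g // ∀ j < p + 1, P j g},
      ∀ j < p, g.1 j = f.1 j := by
    rintro p ⟨f, hf⟩
    obtain ⟨g, hg, hgp⟩ := hext p f hf
    refine ⟨⟨g, fun j hj => ?_⟩, hg⟩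
    rcases (Nat.lt_succ_iff.1 hj).lt_or_eq with h | rfl
    · exact hP j f g (fun i hi => hg i (hi.trans_lt h)) (hf j h)
    · exact hgp
  choose step hstep using hext'
  let u : ∀ p, {f : ℕ → S // ∀ j < p, P j f} := fun p =>
    Nat.rec ⟨fun _ => Classical.arbitrary S, fun j hj => absurd hj j.not_lt_zero⟩ step p
  have hu : ∀ p j, j < p → (u (j + 1)).1 j = (u p).1 j := by
    intro p j hj
    induction p, (hj : j + 1 ≤ p) using Nat.le_induction with
    | base => rfl
    | succ p hp ih => exact ih.trans (hstep p (u p) j hp).symm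
  refine ⟨fun j => (u (j + 1)).1 j, fun p => ?_⟩
  exact hP p (u (p + 1)).1 _ (fun j hj => hu (p + 1) j (Nat.lt_succ_of_le hj))
    ((u (p + 1)).2 p p.lt_succ_self)

section Hierarchy

variable {r₀ ω : ℝ} {a : ℝ → ℝ → ℝ} {Λ : ℝ} {a₀ : ℝ → ℂ} {β : ℝ → ℝ} {k₀ : ℕ} {ε δ : ℝ}

theorem SolvesLevel.congr {E E' : ℕ → ℂ} {v v' : ℕ → ℝ → ℝ → ℂ} {p : ℕ}
    (heq : ∀ j ≤ p, E' j = E j ∧ v' j = v j) (h : SolvesLevel ω a ε δ Λ a₀ β k₀ E v p) :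
    SolvesLevel ω a ε δ Λ a₀ β k₀ E' v' p := by
  obtain ⟨h1, h2⟩ := heq 0 p.zero_le
  obtain ⟨h3, h4⟩ := heq p le_rfl
  refine ⟨?_, ?_, ?_, ?_⟩
  · rw [h1, h2]; exact h.start
  · rw [h4]; exact h.smoothSchwartz
  · rw [h4]; exact h.twist
  · rw [h1, h2, h3, h4, source_congr fun j hj => heq j hj.le]; exact h.equation

/-- The step of the recursion: `E_p` is determined by the solvability of the resonant mode `k₀`. -/
theorem SolvesLevel.extend (ha : IsFermiMetric r₀ ω a) {M : Matrix (Fin 2) (Fin 2) ℝ}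
    (hM : IsLinearizedPoincareMap (curv a) M) {lam : ℝ} (hlam : HasMultipliers M lam)
    (hd : IsDiophantine lam) (h : IsFloquet (curv a) Λ a₀ β) {p : ℕ} {E : ℕ → ℂ}
    {v : ℕ → ℝ → ℝ → ℂ} (hv : ∀ j < p, SolvesLevel ω a ε δ Λ a₀ β k₀ E v j) :
    ∃ (E' : ℕ → ℂ) (v' : ℕ → ℝ → ℝ → ℂ), (∀ j < p, E' j = E j ∧ v' j = v j) ∧
      SolvesLevel ω a ε δ Λ a₀ β k₀ E' v' p := by
  have hR := contDiff_curv ha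
  rcases p.eq_zero_or_pos with rfl | hp
  · obtain ⟨h1, h2, h3⟩ := hermiteMode_solves h hR ha.orientation k₀
    exact ⟨fun _ => energy ω Λ k₀, fun _ => hermiteMode ω Λ a₀ β k₀,
      fun j hj => absurd hj j.not_lt_zero,
      ⟨fun _ => ⟨rfl, rfl⟩, isSmoothSchwartz_of_mem h1, h2, h3⟩⟩
  · obtain ⟨hE0, hv0⟩ := (hv 0 hp).start rfl
    have hmem : ∀ j < p, v j ∈ schwartzFamily := fun j hj =>
      mem_schwartzFamily_of_twist (hv j hj).smoothSchwartz ha.orientation (hv j hj).twist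
    obtain ⟨c, hc, m, hdiv⟩ := small_divisors hd (h.multiplier hM hlam)
    obtain ⟨z, w, h1, h2, h3⟩ := exists_solvesLinear h hR ha.orientation k₀ hc hdiv
      (source_mem ha ε δ E hmem) (source_twist ha ε δ E fun j hj => (hv j hj).twist)
    have hlt : ∀ j < p, Function.update E p z j = E j ∧ Function.update v p w j = v j := fun j hj =>
      ⟨Function.update_of_ne hj.ne _ _, Function.update_of_ne hj.ne _ _⟩
    refine ⟨Function.update E p z, Function.update v p w, hlt, ⟨fun h0 => absurd h0 hp.ne', ?_, ?_, ?_⟩⟩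
    · rw [Function.update_self]; exact isSmoothSchwartz_of_mem h1
    · rw [Function.update_self]; exact h2
    · rw [source_congr hlt, (hlt 0 hp).1, (hlt 0 hp).2, hE0, hv0, Function.update_self,
        Function.update_self]
      simp only [if_neg hp.ne']
      exact h3

end Hierarchy

end WKB

theorem proposition5 (r₀ ω : ℝ) (a : ℝ → ℝ → ℝ) (ha : WKB.IsFermiMetric r₀ ω a)
    (M : Matrix (Fin 2) (Fin 2) ℝ) (hM : WKB.IsLinearizedPoincareMap (WKB.curv a) M)
    (lam : ℝ) (hstable : WKB.HasMultipliers M lam) (hdioph : WKB.IsDiophantine lam) :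
    (∃ (Λ : ℝ) (a₀ : ℝ → ℂ) (β : ℝ → ℝ), WKB.IsFloquet (WKB.curv a) Λ a₀ β ∧
      ∃ m : ℤ, Λ = lam + 2 * Real.pi * m ∨ Λ = -lam + 2 * Real.pi * m) ∧
    ∀ (Λ : ℝ) (a₀ : ℝ → ℂ) (β : ℝ → ℝ), WKB.IsFloquet (WKB.curv a) Λ a₀ β →
      ∀ (k₀ : ℕ) (ε δ : ℝ),
        (∀ (p : ℕ) (E : ℕ → ℂ) (v : ℕ → ℝ → ℝ → ℂ),
          (∀ j < p, WKB.SolvesLevel ω a ε δ Λ a₀ β k₀ E v j) →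
          ∃ (E' : ℕ → ℂ) (v' : ℕ → ℝ → ℝ → ℂ),
            (∀ j < p, E' j = E j ∧ v' j = v j) ∧
            WKB.SolvesLevel ω a ε δ Λ a₀ β k₀ E' v' p) ∧
        ∃ (E : ℕ → ℂ) (v : ℕ → ℝ → ℝ → ℂ),
          ∀ p, WKB.SolvesLevel ω a ε δ Λ a₀ β k₀ E v p := by
  refine ⟨?_, fun Λ a₀ β h k₀ ε δ =>
    ⟨fun p E v hv => WKB.SolvesLevel.extend ha hM hstable hdioph h hv, ?_⟩⟩
  · obtain ⟨Λ, a₀, β, h⟩ := WKB.exists_isFloquet (WKB.contDiff_curv ha).continuous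
      (WKB.curv_periodic ha) hM hstable hdioph
    refine ⟨Λ, a₀, β, h, ?_⟩
    rcases h.multiplier hM hstable with e | e
    · obtain ⟨m, hm⟩ := WKB.exists_int_of_exp_I_mul_eq e
      exact ⟨m, Or.inl hm⟩
    · obtain ⟨m, hm⟩ := WKB.exists_int_of_exp_I_mul_eq (y := -lam) (e.trans (by push_cast; ring_nf))
      exact ⟨m, Or.inr hm⟩
  · obtain ⟨f, hf⟩ := WKB.exists_sequence_of_extend
      (P := fun p (f : ℕ → ℂ × (ℝ → ℝ → ℂ)) => WKB.SolvesLevel ω a ε δ Λ a₀ β k₀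
        (fun j => (f j).1) (fun j => (f j).2) p)
      (fun p f g hfg hf => hf.congr fun j hj => by rw [hfg j hj]; exact ⟨rfl, rfl⟩)
      (fun p f hf => by
        obtain ⟨E', v', hlt, hs⟩ := WKB.SolvesLevel.extend ha hM hstable hdioph h hf
        exact ⟨fun j => (E' j, v' j), fun j hj => Prod.ext (hlt j hj).1 (hlt j hj).2, hs⟩)
    exact ⟨fun j => (f j).1, fun j => (f j).2, hf⟩
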